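/- Let $G$ be a second countable locally compact Hausdorff topological group with a fixed Haar measure, and let $A$ be a $G$-$C^*$-algebra (a possibly non-unital $C^*$-algebra with an action $\alpha$ of $G$ by $*$-automorphisms such that $g\mapsto\alpha_g(a)$ is continuous for every $a\in A$). Every open subgroup of $G$ carries the restricted action and the restricted Haar measure. The reduced crossed product $A\rtimes_r G$ is the completion of $C_c(G,A)$ for the norm of the left regular representation on the Hilbert $A$-module $L^2(G)\otimes A$, i.e. the closure of the algebra of operators $(\lambda(f)\xi)(x)=\int_G\alpha_{x}^{-1}(f(y))\,\xi(y^{-1}x)\,dy$, $f\in C_c(G,A)$. $K_0$ and $K_1$ denote the $K$-groups of (possibly non-unital) $C^*$-algebras. (1) Let $H$ be an open subgroup of $G$. There is a unique $*$-homomorphism $\iota_H^G: A\rtimes_r H\to A\rtimes_r G$ that maps every $f\in C_c(H,A)$ to its extension by zero in $C_c(G,A)$, and it is isometric. It induces homomorphisms of abelian groups $\mathcal T_H^G=(\iota_H^G)_*: K_j(A\rtimes_r H)\to K_j(A\rtimes_r G)$, $j=0,1$. The same holds for open subgroups $H\subset H'$ of $G$, with $\iota_H^{H'}:A\rtimes_r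 H\to A\rtimes_r H'$ and $\mathcal T_H^{H'}$. (2) Let $G_1\subset G_2\subset G_3\subset\cdots$ be an ascending sequence of open subgroups of $G$. For $j=0,1$ the groups $K_j(A\rtimes_r G_n)$ with the homomorphisms $\mathcal T_{G_m}^{G_n}$ ($m\le n$) form an inductive system of abelian groups. (3) If moreover $G=\bigcup_n G_n$, then $\bigcup_n\iota_{G_n}^G(A\rtimes_r G_n)$ is dense in $A\rtimes_r G$, and $A\rtimes_r G$ with the maps $\iota_{G_n}^G$ is the $C^*$-inductive limit of the system $(A\rtimes_r G_n,\iota_{G_m}^{G_n})$. For $j=0,1$ the homomorphisms $\mathcal T_{G_n}^G$ induce an isomorphism $$\varinjlim_n K_j(A\rtimes_r G_n)\;\cong\;K_j(A\rtimes_r G).$$ -/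

import Mathlib

open MeasureTheory Topology UniformSpace
open scoped CompactlySupported

set_option linter.unusedSectionVars false

universe u v w

noncomputable section

namespace CrossedProduct

section Pre

variable {G : Type u} {A : Type v} [Group G] [TopologicalSpace G] [IsTopologicalGroup G]
  [MeasurableSpace G] [BorelSpace G] [NonUnitalCStarAlgebra A]

/-- `C_c(G, A)`, to be equipped with the `A`-valued inner product `⟨ξ, η⟩ = ∫ ξ(x)* η(x) dμ(x)`
and the norm `‖ξ‖ = ‖⟨ξ, ξ⟩‖ ^ (1/2)`. -/
def PreL2 (A : Type v) [NonUnitalCStarAlgebra A] (_μ : Measure G) : Type (max u v) := C_c(G, A)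

namespace PreL2

variable (μ : Measure G)

instance : AddCommGroup (PreL2 A μ) := inferInstanceAs (AddCommGroup C_c(G, A))
instance : Module ℂ (PreL2 A μ) := inferInstanceAs (Module ℂ C_c(G, A))
instance : FunLike (PreL2 A μ) G A := inferInstanceAs (FunLike C_c(G, A) G A)

variable {μ}

@[ext] theorem ext {ξ η : PreL2 A μ} (h : ∀ x, ξ x = η x) : ξ = η := DFunLike.ext _ _ h
@[simp] theorem add_apply (ξ η : PreL2 A μ) (x : G) : (ξ + η) x = ξ x + η x := rfl
@[simp] theorem sub_apply (ξ η : PreL2 A μ) (x : G) : (ξ - η) x = ξ x - η x := rfl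
@[simp] theorem zero_apply (x : G) : (0 : PreL2 A μ) x = 0 := rfl
@[simp] theorem smul_apply (c : ℂ) (ξ : PreL2 A μ) (x : G) : (c • ξ) x = c • ξ x := rfl

theorem continuous (ξ : PreL2 A μ) : Continuous ξ := 
  (show C_c(G, A) from ξ).toContinuousMap.continuous
theorem hasCompactSupport (ξ : PreL2 A μ) : HasCompactSupport ξ :=
  CompactlySupportedContinuousMap.hasCompactSupport' ξ

/-- Builds an element of `PreL2` from a function. -/
def mk (f : G → A) (hf : Continuous f) (hs : HasCompactSupport f) : PreL2 A μ :=
  (⟨⟨f, hf⟩, hs⟩ : C_c(G, A))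

@[simp] theorem mk_apply (f : G → A) (hf : Continuous f) (hs : HasCompactSupport f) (x : G) :
    (mk f hf hs : PreL2 A μ) x = f x := rfl

/-- The `A`-valued inner product, conjugate linear in the first variable. -/
def inner (ξ η : PreL2 A μ) : A := ∫ x, star (ξ x) * η x ∂μ

variable [μ.IsHaarMeasure]

theorem integrable (ξ η : PreL2 A μ) : Integrable (fun x => star (ξ x) * η x) μ := by
  refine Continuous.integrable_of_hasCompactSupport ?_ ?_
  · exact ξ.continuous.star.mul η.continuous
  · exact η.hasCompactSupport.mul_left

theorem inner_add_right (ξ η ζ : PreL2 A μ) : inner ξ (η + ζ) = inner ξ η + inner ξ ζ := by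
  simp only [inner, add_apply, mul_add]
  exact integral_add (integrable ξ η) (integrable ξ ζ)

theorem inner_smul_right (c : ℂ) (ξ η : PreL2 A μ) : inner ξ (c • η) = c • inner ξ η := by
  simp only [inner, smul_apply, mul_smul_comm]
  exact integral_smul c _

theorem star_inner (ξ η : PreL2 A μ) : star (inner ξ η) = inner η ξ := by
  have h := ((starL' ℝ : A ≃L[ℝ] A) : A →L[ℝ] A).integral_comp_comm (integrable ξ η)
  have h2 : star (inner ξ η) = ∫ x, star (star (ξ x) * η x) ∂μ := h.symm
  rw [h2]
  simp [inner]

theorem inner_add_left (ξ η ζ : PreL2 A μ) : inner (ξ + η) ζ = inner ξ ζ + inner η ζ := by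
  rw [← star_inner, inner_add_right, star_add, star_inner, star_inner]

theorem inner_smul_left (c : ℂ) (ξ η : PreL2 A μ) : inner (c • ξ) η = star c • inner ξ η := by
  rw [← star_inner, inner_smul_right, star_smul, star_inner]

theorem inner_sub_right (ξ η ζ : PreL2 A μ) : inner ξ (η - ζ) = inner ξ η - inner ξ ζ := by
  have := inner_add_right ξ (η - ζ) ζ
  rw [sub_add_cancel] at this
  rw [this, add_sub_cancel_right]

theorem inner_sub_left (ξ η ζ : PreL2 A μ) : inner (ξ - η) ζ = inner ξ ζ - inner η ζ := by
  rw [← star_inner, inner_sub_right, star_sub, star_inner, star_inner]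

theorem inner_real_smul_right (c : ℝ) (ξ η : PreL2 A μ) :
    inner ξ ((c : ℂ) • η) = c • inner ξ η := by
  rw [inner_smul_right, Complex.coe_smul]

/-- Right multiplication by an element of `A`. -/
def mulRight (ξ : PreL2 A μ) (a : A) : PreL2 A μ :=
  mk (fun x => ξ x * a) (ξ.continuous.mul continuous_const) (ξ.hasCompactSupport.mul_right)

theorem inner_mulRight_right (ξ η : PreL2 A μ) (a : A) :
    inner ξ (mulRight η a) = inner ξ η * a := by
  simp only [inner, mulRight, mk_apply, ← mul_assoc]
  exact ((ContinuousLinearMap.mul ℂ A).flip a).integral_comp_comm (integrable ξ η)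

theorem inner_mulRight_left (ξ η : PreL2 A μ) (a : A) :
    inner (mulRight ξ a) η = star a * inner ξ η := by
  rw [← star_inner, inner_mulRight_right, star_mul, star_inner]

section Order

attribute [local instance] CStarAlgebra.spectralOrder CStarAlgebra.spectralOrderedRing

theorem inner_self_nonneg (ξ : PreL2 A μ) : 0 ≤ inner ξ ξ :=
  integral_nonneg fun x => star_mul_self_nonneg (ξ x)

theorem eq_zero_of_inner_self (ξ : PreL2 A μ) (h : inner ξ ξ = 0) : ξ = 0 := by
  have h1 : (fun x => star (ξ x) * ξ x) =ᵐ[μ] 0 := by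
    refine (integrable ξ ξ).ae_eq_zero_of_forall_setIntegral_eq_zero fun s hs _ => ?_
    have hadd := integral_add_compl hs (integrable ξ ξ)
    have e1 : (0 : A) ≤ ∫ x in s, star (ξ x) * ξ x ∂μ :=
      integral_nonneg fun x => star_mul_self_nonneg (ξ x)
    have e2 : (0 : A) ≤ ∫ x in sᶜ, star (ξ x) * ξ x ∂μ :=
      integral_nonneg fun x => star_mul_self_nonneg (ξ x)
    refine le_antisymm ?_ e1
    calc _ ≤ (∫ x in s, star (ξ x) * ξ x ∂μ) + ∫ x in sᶜ, star (ξ x) * ξ x ∂μ :=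
          le_add_of_nonneg_right e2
      _ = inner ξ ξ := hadd
      _ = 0 := h
  have h2 : (fun x => star (ξ x) * ξ x) = 0 :=
    (Continuous.ae_eq_iff_eq μ (ξ.continuous.star.mul ξ.continuous) continuous_zero).1 h1
  ext x
  exact CStarRing.star_mul_self_eq_zero_iff _ |>.1 (congrFun h2 x)

instance : Norm (PreL2 A μ) := ⟨fun ξ => Real.sqrt ‖inner ξ ξ‖⟩

theorem norm_sq (ξ : PreL2 A μ) : ‖ξ‖ ^ 2 = ‖inner ξ ξ‖ := Real.sq_sqrt (_root_.norm_nonneg _)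

theorem norm_nonneg' (ξ : PreL2 A μ) : 0 ≤ ‖ξ‖ := Real.sqrt_nonneg _

theorem norm_eq_zero' (ξ : PreL2 A μ) : ‖ξ‖ = 0 ↔ ξ = 0 := by
  constructor
  · intro h
    have := norm_sq ξ
    rw [h] at this
    exact eq_zero_of_inner_self ξ (norm_eq_zero.1 (by simpa using this.symm))
  · rintro rfl
    have : inner (0 : PreL2 A μ) 0 = 0 := by simp [inner]
    have h2 := norm_sq (0 : PreL2 A μ)
    rw [this] at h2
    simpa using h2

theorem inner_mul_inner_swap_le (ξ η : PreL2 A μ) :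
    inner η ξ * inner ξ η ≤ ‖ξ‖ ^ 2 • inner η η := by
  rcases eq_or_ne ξ 0 with h | h
  · subst h
    have h0 : ‖(0 : PreL2 A μ)‖ = 0 := (norm_eq_zero' _).2 rfl
    simp [inner, h0]
  · have hpos : 0 < ‖ξ‖ := lt_of_le_of_ne (norm_nonneg' ξ) (fun h' => h ((norm_eq_zero' ξ).1 h'.symm))
    set t : ℝ := ‖ξ‖ ^ 2 with ht
    have htpos : 0 < t := by positivity
    set a := inner ξ η with ha
    have hstar : inner η ξ = star a := (star_inner ξ η).symm
    have h1 : 0 ≤ inner (mulRight ξ a - (t : ℂ) • η) (mulRight ξ a - (t : ℂ) • η) :=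
      inner_self_nonneg _
    have h2 : inner (mulRight ξ a - (t : ℂ) • η) (mulRight ξ a - (t : ℂ) • η) =
        star a * inner ξ ξ * a - t • (star a * a) - t • (star a * a) + t • (t • inner η η) := by
      rw [inner_sub_right, inner_sub_left, inner_sub_left, inner_mulRight_right,
        inner_mulRight_right, inner_mulRight_left, inner_real_smul_right, inner_real_smul_right,
        inner_mulRight_left, inner_smul_left, inner_smul_left, hstar, ← ha]
      simp only [Complex.star_def, Complex.conj_ofReal, Complex.coe_smul, smul_mul_assoc]
      abel
    have h3 : star a * inner ξ ξ * a ≤ t • (star a * a) := by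
      have := CStarAlgebra.star_left_conjugate_le_norm_smul (a := a) (b := inner ξ ξ)
        (star_inner ξ ξ)
      rwa [← norm_sq] at this
    rw [h2] at h1
    have h4 : 0 ≤ t • (t • inner η η) - t • (star a * a) := by
      refine h1.trans ?_
      have : star a * inner ξ ξ * a - t • (star a * a) ≤ 0 := sub_nonpos.2 h3
      calc _ = (star a * inner ξ ξ * a - t • (star a * a)) +
            (t • (t • inner η η) - t • (star a * a)) := by abel
        _ ≤ 0 + (t • (t • inner η η) - t • (star a * a)) := by gcongr
        _ = _ := zero_add _
    rw [hstar]
    have h5 := sub_nonneg.1 h4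
    exact (smul_le_smul_iff_of_pos_left htpos).1 h5

theorem norm_inner_le (ξ η : PreL2 A μ) : ‖inner ξ η‖ ≤ ‖ξ‖ * ‖η‖ := by
  have h : ‖inner ξ η‖ ^ 2 ≤ (‖ξ‖ * ‖η‖) ^ 2 := by
    calc ‖inner ξ η‖ ^ 2 = ‖inner η ξ * inner ξ η‖ := by
          rw [← star_inner ξ η, CStarRing.norm_star_mul_self, pow_two]
      _ ≤ ‖‖ξ‖ ^ 2 • inner η η‖ := by
          refine CStarAlgebra.norm_le_norm_of_nonneg_of_le ?_ (inner_mul_inner_swap_le ξ η)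
          rw [← star_inner ξ η]
          exact star_mul_self_nonneg _
      _ = (‖ξ‖ * ‖η‖) ^ 2 := by
          rw [norm_smul, ← norm_sq, mul_pow]; simp
  exact (pow_le_pow_iff_left₀ (norm_nonneg _)
    (mul_nonneg (norm_nonneg' _) (norm_nonneg' _)) two_ne_zero).1 h

theorem normedSpaceCore : NormedSpace.Core ℂ (PreL2 A μ) where
  norm_nonneg := norm_nonneg'
  norm_eq_zero_iff := norm_eq_zero'
  norm_smul c ξ := by
    have h : ‖c • ξ‖ ^ 2 = (‖c‖ * ‖ξ‖) ^ 2 := by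
      rw [norm_sq, inner_smul_left, inner_smul_right, norm_smul, norm_smul, mul_pow, norm_sq,
        norm_star]
      ring
    exact (pow_left_inj₀ (norm_nonneg' _) (mul_nonneg (norm_nonneg _) (norm_nonneg' _))
      two_ne_zero).1 h
  norm_triangle ξ η := by
    have h : ‖ξ + η‖ ^ 2 ≤ (‖ξ‖ + ‖η‖) ^ 2 := by
      calc ‖ξ + η‖ ^ 2 = ‖inner ξ ξ + inner η ξ + (inner ξ η + inner η η)‖ := by
            rw [norm_sq, inner_add_right, inner_add_left, inner_add_left]
        _ ≤ ‖inner ξ ξ‖ + ‖inner η ξ‖ + (‖inner ξ η‖ + ‖inner η η‖) := by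
            refine (norm_add_le _ _).trans ?_
            gcongr <;> exact norm_add_le _ _
        _ ≤ ‖ξ‖ ^ 2 + ‖η‖ * ‖ξ‖ + (‖ξ‖ * ‖η‖ + ‖η‖ ^ 2) := by
            rw [norm_sq, norm_sq]
            gcongr <;> exact norm_inner_le _ _
        _ = (‖ξ‖ + ‖η‖) ^ 2 := by ring
    exact (pow_le_pow_iff_left₀ (norm_nonneg' _)
      (add_nonneg (norm_nonneg' _) (norm_nonneg' _)) two_ne_zero).1 h

end Order

instance : NormedAddCommGroup (PreL2 A μ) := NormedAddCommGroup.ofCore normedSpaceCore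
instance : NormedSpace ℂ (PreL2 A μ) := NormedSpace.ofCore normedSpaceCore

/-- The inner product as a bounded sesquilinear map. -/
def innerSL : PreL2 A μ →L⋆[ℂ] PreL2 A μ →L[ℂ] A :=
  LinearMap.mkContinuous₂
    (LinearMap.mk₂'ₛₗ (starRingEnd ℂ) (RingHom.id ℂ) inner inner_add_left inner_smul_left
      inner_add_right inner_smul_right) 1
    fun ξ η => by simpa using norm_inner_le ξ η

@[simp] theorem innerSL_apply (ξ η : PreL2 A μ) : innerSL ξ η = inner ξ η := rfl

end PreL2

end Pre

section Hilbert

variable {G : Type u} [Group G] [TopologicalSpace G] [IsTopologicalGroup G]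
  [MeasurableSpace G] [BorelSpace G]

/-- The Hilbert `A`-module `L²(G, μ) ⊗ A`: the completion of `C_c(G, A)` for the norm
`‖ξ‖ = ‖∫ ξ(x)* ξ(x) dμ(x)‖ ^ (1/2)`. -/
abbrev L2 (A : Type v) [NonUnitalCStarAlgebra A] (μ : Measure G) [μ.IsHaarMeasure] :
    Type (max u v) := Completion (PreL2 A μ)

variable {A : Type v} [NonUnitalCStarAlgebra A] {μ : Measure G} [μ.IsHaarMeasure]

namespace L2

/-- The `A`-valued inner product of `L²(G, μ) ⊗ A`, as a bounded sesquilinear map: the continuous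
extension of `⟨ξ, η⟩ = ∫ ξ(x)* η(x) dμ(x)`. -/
def form : L2 A μ →L⋆[ℂ] L2 A μ →L[ℂ] A :=
  (PreL2.innerSL (A := A) (μ := μ)).fromCompletion.flip.fromCompletion.flip

@[simp] theorem form_coe (ξ η : PreL2 A μ) :
    form (ξ : L2 A μ) (η : L2 A μ) = PreL2.inner ξ η := by
  simp [form]

theorem star_form (x y : L2 A μ) : star (form x y) = form y x := by
  induction x, y using Completion.induction_on₂ with
  | hp => exact isClosed_eq (by fun_prop) (by fun_prop)
  | ih ξ η => simp [PreL2.star_inner]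

theorem norm_form_self (x : L2 A μ) : ‖form x x‖ = ‖x‖ ^ 2 := by
  induction x using Completion.induction_on with
  | hp => exact isClosed_eq (by fun_prop) (by fun_prop)
  | ih ξ => simp [PreL2.norm_sq]

theorem norm_form_le (x y : L2 A μ) : ‖form x y‖ ≤ ‖x‖ * ‖y‖ := by
  induction x, y using Completion.induction_on₂ with
  | hp => exact isClosed_le (by fun_prop) (by fun_prop)
  | ih ξ η => simpa using PreL2.norm_inner_le ξ η

theorem ext_form {x y : L2 A μ} (h : ∀ z, form z x = form z y) : x = y := by
  have h1 : form (x - y) (x - y) = 0 := by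
    rw [map_sub (form (x - y)), h, sub_self]
  have h2 := norm_form_self (x - y)
  rw [h1, norm_zero] at h2
  exact sub_eq_zero.1 (norm_eq_zero.1 (pow_eq_zero_iff two_ne_zero |>.1 h2.symm))

end L2

variable (A μ) in
/-- The bounded operators `T` on `L²(G, μ) ⊗ A` that have an adjoint: an operator `S` with
`⟨T x, y⟩ = ⟨x, S y⟩` for all `x, y`. -/
def adjointableSubalgebra : Subalgebra ℂ (L2 A μ →L[ℂ] L2 A μ) where
  carrier := {T | ∃ S : L2 A μ →L[ℂ] L2 A μ, ∀ x y, L2.form (T x) y = L2.form x (S y)}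
  mul_mem' := by
    rintro T T' ⟨S, hS⟩ ⟨S', hS'⟩
    exact ⟨S' * S, fun x y => by simp [hS, hS']⟩
  add_mem' := by
    rintro T T' ⟨S, hS⟩ ⟨S', hS'⟩
    exact ⟨S + S', fun x y => by simp [hS, hS']⟩
  algebraMap_mem' c := ⟨algebraMap ℂ _ (star c), fun x y => by
    simp [Algebra.algebraMap_eq_smul_one]⟩

variable (A μ) in
/-- The C⋆-algebra of adjointable operators on the Hilbert module `L²(G, μ) ⊗ A`, with the
operator norm and with the adjoint as star. -/
def Adjointable : Type (max u v) := adjointableSubalgebra A μ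

namespace Adjointable

instance : NormedRing (Adjointable A μ) := inferInstanceAs (NormedRing (adjointableSubalgebra A μ))
instance : NormedAlgebra ℂ (Adjointable A μ) :=
  inferInstanceAs (NormedAlgebra ℂ (adjointableSubalgebra A μ))

/-- The underlying bounded operator. -/
def toCLM (T : Adjointable A μ) : L2 A μ →L[ℂ] L2 A μ := T.1

instance : CoeFun (Adjointable A μ) (fun _ => L2 A μ → L2 A μ) := ⟨fun T => T.toCLM⟩

theorem ext {T T' : Adjointable A μ} (h : ∀ x, T x = T' x) : T = T' :=
  Subtype.ext (ContinuousLinearMap.ext h)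

@[simp] theorem add_apply (T T' : Adjointable A μ) (x : L2 A μ) : (T + T') x = T x + T' x := rfl
@[simp] theorem mul_apply (T T' : Adjointable A μ) (x : L2 A μ) : (T * T') x = T (T' x) := rfl
@[simp] theorem smul_apply (c : ℂ) (T : Adjointable A μ) (x : L2 A μ) : (c • T) x = c • T x := rfl
theorem norm_def (T : Adjointable A μ) : ‖T‖ = ‖T.toCLM‖ := rfl

/-- Builds an adjointable operator from an operator and an adjoint of it. -/
def mk (T S : L2 A μ →L[ℂ] L2 A μ) (h : ∀ x y, L2.form (T x) y = L2.form x (S y)) :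
    Adjointable A μ := ⟨T, S, h⟩

@[simp] theorem mk_apply (T S : L2 A μ →L[ℂ] L2 A μ)
    (h : ∀ x y, L2.form (T x) y = L2.form x (S y)) (x : L2 A μ) : mk T S h x = T x := rfl

instance : Star (Adjointable A μ) where
  star T := ⟨T.2.choose, T.toCLM, fun x y =>
    (L2.star_form _ _).symm.trans
      ((congrArg star (T.2.choose_spec y x).symm).trans (L2.star_form _ _))⟩

/-- The defining property of the adjoint. -/
theorem form_star_right (T : Adjointable A μ) (x y : L2 A μ) :
    L2.form x (star T y) = L2.form (T x) y := (T.2.choose_spec x y).symm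

theorem form_star_left (T : Adjointable A μ) (x y : L2 A μ) :
    L2.form (star T x) y = L2.form x (T y) := by
  rw [← L2.star_form, form_star_right, L2.star_form]

theorem eq_star {T S : Adjointable A μ} (h : ∀ x y, L2.form (T x) y = L2.form x (S y)) :
    star T = S :=
  ext fun y => L2.ext_form fun x => by rw [form_star_right, h]

instance : StarRing (Adjointable A μ) where
  star_involutive T := eq_star fun x y => form_star_left T x y
  star_mul T S := eq_star fun x y => by simp [form_star_right]
  star_add T S := eq_star fun x y => by simp [form_star_right]

instance : StarModule ℂ (Adjointable A μ) where
  star_smul c T := eq_star fun x y => by simp [form_star_right]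

instance : CStarRing (Adjointable A μ) where
  norm_mul_self_le T := by
    have h : ‖T‖ ≤ Real.sqrt ‖star T * T‖ := by
      rw [norm_def]
      refine ContinuousLinearMap.opNorm_le_bound _ (Real.sqrt_nonneg _) fun x => ?_
      refine abs_le_of_sq_le_sq' ?_ (by positivity) |>.2
      rw [mul_pow, Real.sq_sqrt (norm_nonneg _), ← L2.norm_form_self]
      calc ‖L2.form (T x) (T x)‖ = ‖L2.form x ((star T * T) x)‖ := by
            rw [mul_apply, form_star_right]
        _ ≤ ‖x‖ * ‖(star T * T) x‖ := L2.norm_form_le _ _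
        _ ≤ ‖x‖ * (‖star T * T‖ * ‖x‖) := by
            gcongr; exact (star T * T).toCLM.le_opNorm x
        _ = ‖star T * T‖ * ‖x‖ ^ 2 := by ring
    calc ‖T‖ * ‖T‖ ≤ Real.sqrt ‖star T * T‖ * Real.sqrt ‖star T * T‖ := by gcongr
      _ = ‖star T * T‖ := Real.mul_self_sqrt (norm_nonneg _)

instance : CompleteSpace (Adjointable A μ) := by
  refine Metric.complete_of_cauchySeq_tendsto fun u hu => ?_
  have hiso : Isometry (toCLM : Adjointable A μ → _) := isometry_subtype_coe
  have hu1 : CauchySeq fun n => (u n).toCLM := hu.map hiso.uniformContinuous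
  have hu2 : CauchySeq fun n => (star (u n)).toCLM := by
    have : CauchySeq fun n => star (u n) := by
      rw [Metric.cauchySeq_iff] at hu ⊢
      intro ε hε
      obtain ⟨N, hN⟩ := hu ε hε
      refine ⟨N, fun m hm n hn => ?_⟩
      rw [dist_eq_norm, ← star_sub, norm_star, ← dist_eq_norm]
      exact hN m hm n hn
    exact this.map hiso.uniformContinuous
  obtain ⟨T, hT⟩ := cauchySeq_tendsto_of_complete hu1
  obtain ⟨S, hS⟩ := cauchySeq_tendsto_of_complete hu2
  refine ⟨mk T S fun x y => ?_, tendsto_subtype_rng.2 hT⟩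
  have h1 : Filter.Tendsto (fun n => L2.form (u n x) y) Filter.atTop (𝓝 (L2.form (T x) y)) := by
    have hc : Continuous fun R : L2 A μ →L[ℂ] L2 A μ => L2.form (R x) y := by fun_prop
    exact (hc.tendsto T).comp hT
  have h2 : Filter.Tendsto (fun n => L2.form x (star (u n) y)) Filter.atTop
      (𝓝 (L2.form x (S y))) := by
    have hc : Continuous fun R : L2 A μ →L[ℂ] L2 A μ => L2.form x (R y) := by fun_prop
    exact (hc.tendsto S).comp hS
  refine tendsto_nhds_unique h1 ?_
  simpa only [form_star_right] using h2

instance : CStarAlgebra (Adjointable A μ) where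

end Adjointable

end Hilbert

section Action

variable {G : Type u} [Group G] [TopologicalSpace G]

/-- A `G`-C⋆-algebra structure on `A`: an action of `G` on `A` by ⋆-automorphisms such that
`g ↦ g • a` is continuous for every `a`. -/
structure Action (G : Type u) [Group G] [TopologicalSpace G] (A : Type v)
    [NonUnitalCStarAlgebra A] where
  /-- The action, as a homomorphism into the group of ⋆-automorphisms. -/
  aut : G →* (A ≃⋆ₐ[ℂ] A)
  continuous_aut : ∀ a : A, Continuous fun g => aut g a

/-- The restriction of an action along a continuous group homomorphism. -/
def Action.comap {H : Type w} [Group H] [TopologicalSpace H] {A : Type v}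
    [NonUnitalCStarAlgebra A] (α : Action G A) (φ : H →* G) (hφ : Continuous φ) : Action H A where
  aut := α.aut.comp φ
  continuous_aut a := (α.continuous_aut a).comp hφ

end Action

section Regular

variable {G : Type u} [Group G] [TopologicalSpace G] [IsTopologicalGroup G]
  [MeasurableSpace G] [BorelSpace G]
  {A : Type v} [NonUnitalCStarAlgebra A] {μ : Measure G} [μ.IsHaarMeasure]

namespace PreL2

/-- Left translation: `(translate g ξ)(x) = ξ(g⁻¹ x)`. -/
def translate (g : G) (ξ : PreL2 A μ) : PreL2 A μ :=
  mk (fun x => ξ (g⁻¹ * x)) (ξ.continuous.comp (continuous_const_mul g⁻¹))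
    (ξ.hasCompactSupport.comp_homeomorph (Homeomorph.mulLeft g⁻¹))

@[simp] theorem translate_apply (g : G) (ξ : PreL2 A μ) (x : G) :
    translate g ξ x = ξ (g⁻¹ * x) := rfl

theorem inner_translate (g : G) (ξ η : PreL2 A μ) :
    inner (translate g ξ) η = inner ξ (translate g⁻¹ η) := by
  have := integral_mul_left_eq_self (μ := μ) (fun x => star (ξ (g⁻¹ * x)) * η x) g
  simp only [inner, translate_apply, inv_inv]
  rw [← this]
  simp

theorem norm_translate (g : G) (ξ : PreL2 A μ) : ‖translate g ξ‖ = ‖ξ‖ := by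
  have h : ‖translate g ξ‖ ^ 2 = ‖ξ‖ ^ 2 := by
    rw [norm_sq, norm_sq, inner_translate]
    congr 2
    ext x
    simp
  exact (pow_left_inj₀ (norm_nonneg' _) (norm_nonneg' _) two_ne_zero).1 h

/-- Pointwise multiplication by `x ↦ x⁻¹ • a`. -/
def act (α : Action G A) (a : A) (ξ : PreL2 A μ) : PreL2 A μ :=
  mk (fun x => α.aut x⁻¹ a * ξ x)
    (((α.continuous_aut a).comp continuous_inv).mul ξ.continuous) ξ.hasCompactSupport.mul_left

@[simp] theorem act_apply (α : Action G A) (a : A) (ξ : PreL2 A μ) (x : G) :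
    act α a ξ x = α.aut x⁻¹ a * ξ x := rfl

theorem inner_act (α : Action G A) (a : A) (ξ η : PreL2 A μ) :
    inner (act α a ξ) η = inner ξ (act α (star a) η) := by
  simp [inner, mul_assoc, map_star]

section Order

attribute [local instance] CStarAlgebra.spectralOrder CStarAlgebra.spectralOrderedRing

theorem norm_act_le (α : Action G A) (a : A) (ξ : PreL2 A μ) : ‖act α a ξ‖ ≤ ‖a‖ * ‖ξ‖ := by
  have h : ‖act α a ξ‖ ^ 2 ≤ (‖a‖ * ‖ξ‖) ^ 2 := by
    rw [norm_sq, mul_pow, norm_sq]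
    have h1 : inner (act α a ξ) (act α a ξ) ≤ ‖a‖ ^ 2 • inner ξ ξ := by
      rw [inner, inner, ← integral_smul]
      refine integral_mono (integrable _ _) ((integrable ξ ξ).smul _) fun x => ?_
      have hn : ‖star (α.aut x⁻¹ a) * α.aut x⁻¹ a‖ = ‖a‖ ^ 2 := by
        rw [CStarRing.norm_star_mul_self, ← pow_two]
        congr 1
        exact NonUnitalStarAlgHom.norm_map (α.aut x⁻¹) (α.aut x⁻¹).injective a
      have := CStarAlgebra.star_left_conjugate_le_norm_smul (a := ξ x)
        (b := star (α.aut x⁻¹ a) * α.aut x⁻¹ a) (IsSelfAdjoint.star_mul_self _)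
      rw [hn] at this
      simpa [mul_assoc] using this
    calc _ ≤ ‖‖a‖ ^ 2 • inner ξ ξ‖ :=
          CStarAlgebra.norm_le_norm_of_nonneg_of_le (inner_self_nonneg _) h1
      _ = _ := by rw [norm_smul]; simp
  exact (pow_le_pow_iff_left₀ (norm_nonneg' _)
    (mul_nonneg (norm_nonneg _) (norm_nonneg' _)) two_ne_zero).1 h

end Order

theorem continuous_translate [LocallyCompactSpace G] (ξ : PreL2 A μ) :
    Continuous fun g => translate g ξ := by
  rw [continuous_iff_continuousAt]
  intro g₀
  obtain ⟨N, hN, hNg⟩ := exists_compact_mem_nhds g₀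
  have hK := hN.mul ξ.hasCompactSupport.isCompact
  have hK' := hK.union ((translate g₀ ξ).hasCompactSupport.isCompact)
  have hc : ContinuousOn (fun g => ∫ x, star ((translate g ξ - translate g₀ ξ) x) *
      (translate g ξ - translate g₀ ξ) x ∂μ) N := by
    refine continuousOn_integral_of_compact_support hK' ?_ ?_
    · have : Continuous fun p : G × G => ξ (p.1⁻¹ * p.2) :=
        ξ.continuous.comp (by fun_prop)
      have h2 : Continuous fun p : G × G => ξ (g₀⁻¹ * p.2) :=
        ξ.continuous.comp (by fun_prop)
      exact ((this.sub h2).star.mul (this.sub h2)).continuousOn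
    · intro g x hg hx
      have h1 : ξ (g⁻¹ * x) = 0 := by
        by_contra hne
        exact hx (Or.inl ⟨g, hg, g⁻¹ * x, subset_tsupport _ hne, by simp⟩)
      have h2 : (translate g₀ ξ) x = 0 := by
        by_contra hne
        exact hx (Or.inr (subset_tsupport _ hne))
      simp only [sub_apply, h2]
      simp [h1]
  have hc2 := (hc.continuousAt hNg).norm.sqrt
  rw [ContinuousAt, tendsto_iff_norm_sub_tendsto_zero]
  have h0 : √‖∫ x, star ((translate g₀ ξ - translate g₀ ξ) x) *
      (translate g₀ ξ - translate g₀ ξ) x ∂μ‖ = 0 := by simp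
  have := hc2.tendsto
  rw [h0] at this
  exact this

/-- Left translation as a bounded operator. -/
def translateL (g : G) : PreL2 A μ →L[ℂ] PreL2 A μ :=
  LinearMap.mkContinuous
    { toFun := translate g
      map_add' := fun _ _ => rfl
      map_smul' := fun _ _ => rfl } 1 fun ξ => by
      rw [one_mul]; exact (norm_translate g ξ).le

/-- `act` as a bounded operator. -/
def actL (α : Action G A) (a : A) : PreL2 A μ →L[ℂ] PreL2 A μ :=
  LinearMap.mkContinuous
    { toFun := act α a
      map_add' := fun ξ η => by ext x; simp [mul_add]
      map_smul' := fun c ξ => by ext x; exact mul_smul_comm _ _ _ } ‖a‖ (norm_act_le α a)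

end PreL2

variable (A μ) in
/-- The left regular representation of `G` on `L²(G, μ) ⊗ A`: `(U g ξ)(x) = ξ(g⁻¹ x)`. -/
def regU (g : G) : L2 A μ →L[ℂ] L2 A μ := (PreL2.translateL g).completion

@[simp] theorem regU_coe (g : G) (ξ : PreL2 A μ) :
    regU A μ g (ξ : L2 A μ) = (PreL2.translate g ξ : L2 A μ) := by
  simp [regU]; rfl

theorem norm_regU_apply (g : G) (x : L2 A μ) : ‖regU A μ g x‖ = ‖x‖ := by
  induction x using Completion.induction_on with
  | hp => exact isClosed_eq (by fun_prop) (by fun_prop)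
  | ih ξ => simp [PreL2.norm_translate]

theorem form_regU (g : G) (x y : L2 A μ) :
    L2.form (regU A μ g x) y = L2.form x (regU A μ g⁻¹ y) := by
  induction x, y using Completion.induction_on₂ with
  | hp => exact isClosed_eq (by fun_prop) (by fun_prop)
  | ih ξ η => simp [PreL2.inner_translate]

variable (μ) in
/-- The representation `π` of `A` on `L²(G, μ) ⊗ A` covariant with `U`:
`(π a ξ)(x) = (x⁻¹ • a) ξ(x)`. -/
def regπ (α : Action G A) (a : A) : L2 A μ →L[ℂ] L2 A μ := (PreL2.actL α a).completion

@[simp] theorem regπ_coe (α : Action G A) (a : A) (ξ : PreL2 A μ) :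
    regπ μ α a (ξ : L2 A μ) = (PreL2.act α a ξ : L2 A μ) := by
  simp [regπ]; rfl

theorem norm_regπ_apply_le (α : Action G A) (a : A) (x : L2 A μ) :
    ‖regπ μ α a x‖ ≤ ‖a‖ * ‖x‖ := by
  induction x using Completion.induction_on with
  | hp => exact isClosed_le (by fun_prop) (by fun_prop)
  | ih ξ => simpa using PreL2.norm_act_le α a ξ

theorem form_regπ (α : Action G A) (a : A) (x y : L2 A μ) :
    L2.form (regπ μ α a x) y = L2.form x (regπ μ α (star a) y) := by
  induction x, y using Completion.induction_on₂ with
  | hp => exact isClosed_eq (by fun_prop) (by fun_prop)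
  | ih ξ η => simp [PreL2.inner_act]

theorem regπ_sub (α : Action G A) (a b : A) : regπ μ α (a - b) = regπ μ α a - regπ μ α b := by
  ext x
  induction x using Completion.induction_on with
  | hp => exact isClosed_eq (by fun_prop) (by fun_prop)
  | ih ξ =>
    rw [_root_.sub_apply, regπ_coe, regπ_coe, regπ_coe, ← Completion.coe_sub]
    congr 1
    ext x
    simp [sub_mul]

theorem continuous_regπ (α : Action G A) : Continuous (regπ μ α) := by
  refine LipschitzWith.continuous (K := 1) (LipschitzWith.of_dist_le_mul fun a b => ?_)
  rw [dist_eq_norm, dist_eq_norm, ← regπ_sub, NNReal.coe_one, one_mul]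
  exact ContinuousLinearMap.opNorm_le_bound _ (norm_nonneg _) (norm_regπ_apply_le α _)

variable [LocallyCompactSpace G]

theorem continuous_regU_apply (x : L2 A μ) : Continuous fun g => regU A μ g x := by
  refine continuous_of_uniform_approx_of_continuous fun u hu => ?_
  obtain ⟨ε, hε, hεu⟩ := Metric.mem_uniformity_dist.1 hu
  obtain ⟨ξ, hξ⟩ := (Completion.denseRange_coe (α := PreL2 A μ)).exists_dist_lt x hε
  refine ⟨fun g => regU A μ g (ξ : L2 A μ), ?_, fun g => hεu ?_⟩
  · simp only [regU_coe]
    exact (Completion.continuous_coe _).comp (PreL2.continuous_translate ξ)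
  · rwa [dist_eq_norm, ← map_sub, norm_regU_apply, ← dist_eq_norm]

theorem continuous_regU_apply' {Y : Type*} [TopologicalSpace Y] {g : Y → G} {z : Y → L2 A μ}
    (hg : Continuous g) (hz : Continuous z) : Continuous fun t => regU A μ (g t) (z t) := by
  rw [continuous_iff_continuousAt]
  intro t₀
  rw [ContinuousAt, tendsto_iff_norm_sub_tendsto_zero]
  have h1 : Filter.Tendsto (fun t => ‖z t - z t₀‖ +
      ‖regU A μ (g t) (z t₀) - regU A μ (g t₀) (z t₀)‖) (𝓝 t₀) (𝓝 0) := by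
    have : Continuous fun t => ‖z t - z t₀‖ +
      ‖regU A μ (g t) (z t₀) - regU A μ (g t₀) (z t₀)‖ :=
      ((hz.sub continuous_const).norm).add
        ((((continuous_regU_apply (z t₀)).comp hg).sub continuous_const).norm)
    simpa using this.tendsto t₀
  refine squeeze_zero (fun _ => norm_nonneg _) (fun t => ?_) h1
  calc _ = ‖regU A μ (g t) (z t - z t₀) +
          (regU A μ (g t) (z t₀) - regU A μ (g t₀) (z t₀))‖ := by
        rw [map_sub]; congr 1; abel
    _ ≤ _ := by
        refine (norm_add_le _ _).trans ?_
        rw [norm_regU_apply]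

/-- The strong integral `x ↦ ∫ F(y) x dμ(y)` of a strongly continuous family of operators of
compact support. -/
def strongIntegral (F : G → L2 A μ →L[ℂ] L2 A μ) (hF : ∀ x, Continuous fun y => F y x)
    (hs : HasCompactSupport F) (b : G → ℝ) (hb : Integrable b μ) (hFb : ∀ y, ‖F y‖ ≤ b y) :
    L2 A μ →L[ℂ] L2 A μ :=
  have hint : ∀ x, Integrable (fun y => F y x) μ := fun x =>
    (hF x).integrable_of_hasCompactSupport (hs.comp_left (g := fun T : L2 A μ →L[ℂ] L2 A μ => T x) rfl)
  LinearMap.mkContinuous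
    { toFun := fun x => ∫ y, F y x ∂μ
      map_add' := fun x x' => by
        simp only [map_add]
        exact integral_add (hint x) (hint x')
      map_smul' := fun c x => by
        simp only [map_smul]
        exact integral_smul c _ }
    (∫ y, b y ∂μ) fun x => by
      have := norm_integral_le_of_norm_le (f := fun y => F y x) (hb.mul_const ‖x‖)
        (Filter.Eventually.of_forall fun y => ((F y).le_opNorm x).trans (by gcongr; exact hFb y))
      rwa [integral_mul_const] at this

theorem form_strongIntegral (F S : G → L2 A μ →L[ℂ] L2 A μ) (hF hs b hb hFb hS hs' b' hb' hSb)
    (h : ∀ y x z, L2.form (F y x) z = L2.form x (S y z)) (x z : L2 A μ) :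
    L2.form (strongIntegral F hF hs b hb hFb x) z =
      L2.form x (strongIntegral S hS hs' b' hb' hSb z) := by
  have hint : Integrable (fun y => F y x) μ :=
    (hF x).integrable_of_hasCompactSupport
      (hs.comp_left (g := fun T : L2 A μ →L[ℂ] L2 A μ => T x) rfl)
  have hint' : Integrable (fun y => S y z) μ :=
    (hS z).integrable_of_hasCompactSupport
      (hs'.comp_left (g := fun T : L2 A μ →L[ℂ] L2 A μ => T z) rfl)
  change L2.form (∫ y, F y x ∂μ) z = L2.form x (∫ y, S y z ∂μ)
  rw [← L2.star_form, ← (L2.form z).integral_comp_comm hint, ← (L2.form x).integral_comp_comm hint']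
  have hst := ((starL' ℝ : A ≃L[ℝ] A) : A →L[ℝ] A).integral_comp_comm
    ((L2.form z).integrable_comp hint)
  refine hst.symm.trans ?_
  refine integral_congr_ae (Filter.Eventually.of_forall fun y => ?_)
  exact (L2.star_form _ _).trans (h y x z)

theorem regularRep_aux (f : C_c(G, A)) : Integrable (fun y => ‖f y‖) μ :=
  (f.continuous.norm).integrable_of_hasCompactSupport f.hasCompactSupport.norm

theorem regπ_zero (α : Action G A) : regπ μ α (0 : A) = 0 := by
  simpa using regπ_sub (μ := μ) α 0 0

/-- The integrated form of the regular covariant representation `(π, U)`: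
`λ(f) x = ∫ π(f(y)) U(y) x dμ(y)` for `f` in `C_c(G, A)`. On functions this is
`(λ(f) ξ)(x) = ∫ (x⁻¹ • f(y)) ξ(y⁻¹ x) dμ(y)`. -/
def regularRep (α : Action G A) (μ : Measure G) [μ.IsHaarMeasure] (f : C_c(G, A)) :
    Adjointable A μ :=
  Adjointable.mk
    (strongIntegral (fun y => regπ μ α (f y) ∘L regU A μ y)
      (fun x => ((continuous_regπ α).comp f.continuous).clm_apply (continuous_regU_apply x))
      (f.hasCompactSupport.mono fun y hy h0 => hy (by simp [h0, regπ_zero]))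
      (fun y => ‖f y‖) (regularRep_aux f)
      (fun y => ContinuousLinearMap.opNorm_le_bound _ (norm_nonneg _) fun x => by
        simpa [norm_regU_apply] using norm_regπ_apply_le α (f y) (regU A μ y x)))
    (strongIntegral (fun y => regU A μ y⁻¹ ∘L regπ μ α (star (f y)))
      (fun x => continuous_regU_apply' continuous_inv
        (((continuous_regπ α).comp f.continuous.star).clm_apply continuous_const))
      (f.hasCompactSupport.mono fun y hy h0 => hy (by simp [h0, regπ_zero]))
      (fun y => ‖f y‖) (regularRep_aux f)
      (fun y => ContinuousLinearMap.opNorm_le_bound _ (norm_nonneg _) fun x => by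
        simpa [norm_regU_apply] using norm_regπ_apply_le α (star (f y)) x))
    (form_strongIntegral _ _ _ _ _ _ _ _ _ _ _ _ fun y x z => by
      simp [form_regπ, form_regU])

/-- The defining formula of the integrated form. -/
theorem regularRep_apply (α : Action G A) (f : C_c(G, A)) (x : L2 A μ) :
    regularRep α μ f x = ∫ y, regπ μ α (f y) (regU A μ y x) ∂μ := rfl

/-- The reduced crossed product `A ⋊_r G`: the C⋆-algebra generated by the operators `λ(f)`,
`f ∈ C_c(G, A)`, on the Hilbert module `L²(G, μ) ⊗ A`. These operators form a ⋆-subalgebra, the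
image of the twisted convolution ⋆-algebra `C_c(G, A)`, so this is the completion of `C_c(G, A)`
for the norm `‖f‖ = ‖λ(f)‖` of the left regular representation. -/
def ReducedCrossedProduct (α : Action G A) (μ : Measure G) [μ.IsHaarMeasure] : Type (max u v) :=
  (NonUnitalStarAlgebra.adjoin ℂ (Set.range (regularRep α μ))).topologicalClosure

namespace ReducedCrossedProduct

instance (α : Action G A) : NonUnitalCStarAlgebra (ReducedCrossedProduct α μ) :=
  haveI : IsClosed ((NonUnitalStarAlgebra.adjoin ℂ
      (Set.range (regularRep α μ))).topologicalClosure : Set (Adjointable A μ)) :=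
    NonUnitalStarSubalgebra.isClosed_topologicalClosure _
  inferInstanceAs (NonUnitalCStarAlgebra
    (NonUnitalStarAlgebra.adjoin ℂ (Set.range (regularRep α μ))).topologicalClosure)

/-- The canonical map `C_c(G, A) → A ⋊_r G`. -/
def ofCc (α : Action G A) (μ : Measure G) [μ.IsHaarMeasure] (f : C_c(G, A)) :
    ReducedCrossedProduct α μ :=
  ⟨regularRep α μ f, NonUnitalStarSubalgebra.le_topologicalClosure _
    (NonUnitalStarAlgebra.subset_adjoin ℂ _ ⟨f, rfl⟩)⟩

end ReducedCrossedProduct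

end Regular

section Extension

/-- Extension by zero of a compactly supported function along an open embedding. -/
def extendByZero {X : Type*} {Y : Type*} {A : Type*} [TopologicalSpace X] [TopologicalSpace Y]
    [T2Space Y] [TopologicalSpace A] [Zero A] (φ : X → Y) (hφ : IsOpenEmbedding φ)
    (f : C_c(X, A)) : C_c(Y, A) where
  toFun := Function.extend φ f 0
  continuous_toFun := continuous_of_tsupport fun y hy => by
    obtain ⟨x, -, rfl⟩ := f.hasCompactSupport.tsupport_extend_zero_subset hφ.continuous hy
    rw [← hφ.continuousAt_iff, Function.extend_comp hφ.injective]
    exact f.continuous.continuousAt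
  hasCompactSupport' := f.hasCompactSupport.extend_zero hφ.continuous

variable {G : Type u} [Group G] [TopologicalSpace G] [IsTopologicalGroup G]
  [LocallyCompactSpace G] [T2Space G] [MeasurableSpace G] [BorelSpace G]
  {A : Type v} [NonUnitalCStarAlgebra A]

/-- A ⋆-homomorphism `ψ : A ⋊_r H → A ⋊_r K` is *induced by extension by zero* along an open
embedding `φ : H → K` if it maps `f ∈ C_c(H, A)` to its extension by zero in `C_c(K, A)`. -/
def IsInducedByExtension {H : Type u} [Group H] [TopologicalSpace H] [IsTopologicalGroup H]
    [LocallyCompactSpace H] [MeasurableSpace H] [BorelSpace H]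
    {αH : Action H A} {μH : Measure H} [μH.IsHaarMeasure]
    {α : Action G A} {μ : Measure G} [μ.IsHaarMeasure]
    (φ : H →* G) (hφ : IsOpenEmbedding φ)
    (ψ : ReducedCrossedProduct αH μH →⋆ₙₐ[ℂ] ReducedCrossedProduct α μ) : Prop :=
  ∀ f : C_c(H, A), ψ (ReducedCrossedProduct.ofCc αH μH f) =
    ReducedCrossedProduct.ofCc α μ (extendByZero φ hφ f)

end Extension

section OpenSubgroup

variable {G : Type u} [Group G] [TopologicalSpace G] [IsTopologicalGroup G]

theorem isOpenEmbedding_subtype (H : OpenSubgroup G) :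
    IsOpenEmbedding (SubgroupClass.subtype H : H →* G) :=
  H.isOpen.isOpenEmbedding_subtypeVal

theorem isOpenEmbedding_inclusion {H K : OpenSubgroup G} (h : H ≤ K) :
    IsOpenEmbedding (SubgroupClass.inclusion h : H →* K) :=
  IsOpenEmbedding.of_comp _ (isOpenEmbedding_subtype K) (isOpenEmbedding_subtype H)

instance (H : OpenSubgroup G) : IsTopologicalGroup H :=
  inferInstanceAs (IsTopologicalGroup H.toSubgroup)

instance [LocallyCompactSpace G] (H : OpenSubgroup G) : LocallyCompactSpace H :=
  H.isOpen.locallyCompactSpace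

variable [MeasurableSpace G] [BorelSpace G]

/-- The restriction of a measure on `G` to an open subgroup `H`. -/
def restrictMeasure (μ : Measure G) (H : OpenSubgroup G) : Measure H :=
  μ.comap (SubgroupClass.subtype H)

instance (μ : Measure G) [μ.IsHaarMeasure] (H : OpenSubgroup G) :
    (restrictMeasure μ H).IsHaarMeasure :=
  Measure.IsHaarMeasure.comap (mH := inferInstance) μ (isOpenEmbedding_subtype H)

/-- The reduced crossed product `A ⋊_r H` by an open subgroup `H` of `G`, for the restriction of
the action and of the Haar measure of `G` to `H`. -/
abbrev SubgroupCrossedProduct [LocallyCompactSpace G] {A : Type v} [NonUnitalCStarAlgebra A]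
    (α : Action G A) (μ : Measure G) [μ.IsHaarMeasure] (H : OpenSubgroup G) : Type (max u v) :=
  ReducedCrossedProduct
    (α.comap (SubgroupClass.subtype H) (isOpenEmbedding_subtype H).continuous)
    (restrictMeasure μ H)

end OpenSubgroup

/-- The universal property of a C⋆-inductive limit: `Y`, with the maps `κ n : X n → Y`, is the
colimit of the system `(X n, f)` in the category of C⋆-algebras (tested on the C⋆-algebras of a
given universe). -/
def IsCStarInductiveLimit (X : ℕ → Type u) [∀ n, NonUnitalCStarAlgebra (X n)]
    (f : ∀ m n, m ≤ n → (X m →⋆ₙₐ[ℂ] X n)) (Y : Type v) [NonUnitalCStarAlgebra Y]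
    (κ : ∀ n, X n →⋆ₙₐ[ℂ] Y) : Prop :=
  (∀ m n (h : m ≤ n), (κ n).comp (f m n h) = κ m) ∧
  ∀ (B : Type w) [NonUnitalCStarAlgebra B] (ψ : ∀ n, X n →⋆ₙₐ[ℂ] B),
    (∀ m n (h : m ≤ n), (ψ n).comp (f m n h) = ψ m) →
      ∃! Ψ : Y →⋆ₙₐ[ℂ] B, ∀ n, Ψ.comp (κ n) = ψ n

end CrossedProduct

namespace KTheory

open scoped Matrix

/-- The block diagonal sum `diag(p, q)` of two square matrices. -/
def diagSum {B : Type u} [Zero B] {m n : ℕ} (p : Matrix (Fin m) (Fin m) B)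
    (q : Matrix (Fin n) (Fin n) B) : Matrix (Fin (m + n)) (Fin (m + n)) B :=
  Matrix.reindex finSumFinEquiv finSumFinEquiv (Matrix.fromBlocks p 0 0 q)

section diagSum

variable {B : Type u} [CStarAlgebra B] {C : Type v} [CStarAlgebra C] {m n : ℕ}

theorem diagSum_mul (p p' : Matrix (Fin m) (Fin m) B) (q q' : Matrix (Fin n) (Fin n) B) :
    diagSum p q * diagSum p' q' = diagSum (p * p') (q * q') := by
  simp [diagSum, Matrix.submatrix_mul_equiv, Matrix.fromBlocks_multiply]

theorem star_diagSum (p : Matrix (Fin m) (Fin m) B) (q : Matrix (Fin n) (Fin n) B) :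
    star (diagSum p q) = diagSum (star p) (star q) := by
  simp [diagSum, Matrix.star_eq_conjTranspose, Matrix.fromBlocks_conjTranspose]

theorem diagSum_one : diagSum (1 : Matrix (Fin m) (Fin m) B) (1 : Matrix (Fin n) (Fin n) B) = 1 := by
  simp [diagSum]

theorem diagSum_map (φ : B →⋆ₐ[ℂ] C) (p : Matrix (Fin m) (Fin m) B)
    (q : Matrix (Fin n) (Fin n) B) : (diagSum p q).map φ = diagSum (p.map φ) (q.map φ) := by
  ext i j
  obtain ⟨i, rfl⟩ := finSumFinEquiv.surjective i
  obtain ⟨j, rfl⟩ := finSumFinEquiv.surjective j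
  rcases i with i | i <;> rcases j with j | j <;> simp [diagSum]

theorem star_map (φ : B →⋆ₐ[ℂ] C) {k l : Type*} (p : Matrix k l B) :
    (p.map φ)ᴴ = (pᴴ).map φ :=
  (Matrix.conjTranspose_map φ fun x => map_star φ x).symm

end diagSum

/-- A projection in some matrix algebra `M_n(B)`. -/
structure ProjMat (B : Type u) [CStarAlgebra B] where
  size : ℕ
  val : Matrix (Fin size) (Fin size) B
  isStarProjection : IsStarProjection val

namespace ProjMat

variable {B : Type u} [CStarAlgebra B] {C : Type v} [CStarAlgebra C]

/-- Murray–von Neumann equivalence of projections in matrix algebras of possibly different sizes: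
`p = v v*` and `q = v* v` for a rectangular matrix `v`. -/
def Equivalent (p q : ProjMat B) : Prop :=
  ∃ v : Matrix (Fin p.size) (Fin q.size) B, v * vᴴ = p.val ∧ vᴴ * v = q.val

/-- The direct sum `diag(p, q)`. -/
def sum (p q : ProjMat B) : ProjMat B where
  size := p.size + q.size
  val := diagSum p.val q.val
  isStarProjection :=
    { isIdempotentElem := by
        rw [IsIdempotentElem, diagSum_mul, p.isStarProjection.isIdempotentElem.eq,
          q.isStarProjection.isIdempotentElem.eq]
      isSelfAdjoint := by
        rw [IsSelfAdjoint, star_diagSum, p.isStarProjection.isSelfAdjoint.star_eq,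
          q.isStarProjection.isSelfAdjoint.star_eq] }

/-- The image of a projection under a unital ⋆-homomorphism, applied entrywise. -/
def map (φ : B →⋆ₐ[ℂ] C) (p : ProjMat B) : ProjMat C where
  size := p.size
  val := p.val.map φ
  isStarProjection :=
    { isIdempotentElem := by
        rw [IsIdempotentElem, ← Matrix.map_mul, p.isStarProjection.isIdempotentElem.eq]
      isSelfAdjoint := by
        rw [IsSelfAdjoint, Matrix.star_eq_conjTranspose, star_map, ← Matrix.star_eq_conjTranspose,
          p.isStarProjection.isSelfAdjoint.star_eq] }

end ProjMat

section K0

/-- The relations `[p] = [q]` for `p ∼ q`, and `[diag(p, q)] = [p] + [q]`. -/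
def projRelations (B : Type u) [CStarAlgebra B] : AddSubgroup (FreeAbelianGroup (ProjMat B)) :=
  AddSubgroup.closure
    ({x | ∃ p q : ProjMat B, p.Equivalent q ∧
        x = FreeAbelianGroup.of p - FreeAbelianGroup.of q} ∪
      {x | ∃ p q : ProjMat B, x = FreeAbelianGroup.of (p.sum q) -
        (FreeAbelianGroup.of p + FreeAbelianGroup.of q)})

/-- The group `K_00(B)` of a unital C⋆-algebra `B`: the Grothendieck group of the semigroup of
Murray–von Neumann classes of projections in matrix algebras over `B`, that is, the abelian group
generated by the symbols `[p]`, `p` such a projection, with the relations `[p] = [q]` for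
`p ∼ q`, and `[diag(p, q)] = [p] + [q]`. -/
def K00 (B : Type u) [CStarAlgebra B] : Type u := FreeAbelianGroup (ProjMat B) ⧸ projRelations B

variable {B : Type u} [CStarAlgebra B] {C : Type v} [CStarAlgebra C]

instance : AddCommGroup (K00 B) :=
  inferInstanceAs (AddCommGroup (FreeAbelianGroup (ProjMat B) ⧸ projRelations B))

/-- The class of a projection. -/
def K00.mk (p : ProjMat B) : K00 B := QuotientAddGroup.mk' (projRelations B) (FreeAbelianGroup.of p)

/-- `K_00` is functorial: `[p] ↦ [φ(p)]`. -/
def K00.map (φ : B →⋆ₐ[ℂ] C) : K00 B →+ K00 C :=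
  QuotientAddGroup.map (projRelations B) (projRelations C)
    (FreeAbelianGroup.map (ProjMat.map φ)) <| by
      rw [projRelations, AddSubgroup.closure_le]
      rintro x (⟨p, q, ⟨v, hv, hv'⟩, rfl⟩ | ⟨p, q, rfl⟩)
      · refine AddSubgroup.subset_closure (Or.inl ⟨p.map φ, q.map φ, ⟨v.map φ, ?_, ?_⟩, by simp⟩)
        · change v.map φ * (v.map φ)ᴴ = p.val.map φ
          rw [star_map, ← Matrix.map_mul, hv]
        · change (v.map φ)ᴴ * v.map φ = q.val.map φ
          rw [star_map, ← Matrix.map_mul, hv']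
      · refine AddSubgroup.subset_closure (Or.inr ⟨p.map φ, q.map φ, ?_⟩)
        have : (p.sum q).map φ = (p.map φ).sum (q.map φ) := by
          simp [ProjMat.map, ProjMat.sum, diagSum_map]
        simp [this]

@[simp] theorem K00.map_mk (φ : B →⋆ₐ[ℂ] C) (p : ProjMat B) :
    K00.map φ (K00.mk p) = K00.mk (p.map φ) := by
  change QuotientAddGroup.mk' (projRelations C)
    (FreeAbelianGroup.map (ProjMat.map φ) (FreeAbelianGroup.of p)) = _
  rw [FreeAbelianGroup.map_of_apply]; rfl

theorem K00.hom_ext {M : Type*} [AddCommGroup M] {f g : K00 B →+ M}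
    (h : ∀ p, f (K00.mk p) = g (K00.mk p)) : f = g :=
  QuotientAddGroup.addMonoidHom_ext _ (FreeAbelianGroup.lift_ext _ _ h)

theorem K00.map_comp {D : Type*} [CStarAlgebra D] (ψ : C →⋆ₐ[ℂ] D) (φ : B →⋆ₐ[ℂ] C) :
    K00.map (ψ.comp φ) = (K00.map ψ).comp (K00.map φ) :=
  K00.hom_ext fun p => by simp [ProjMat.map, Matrix.map_map]

/-- The augmentation `A~ → ℂ` of the unitization `A~` of `A`. -/
def augmentation (A : Type u) [NonUnitalCStarAlgebra A] : Unitization ℂ A →⋆ₐ[ℂ] ℂ :=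
  { Unitization.fstHom ℂ A with map_star' := fun _ => rfl }

/-- `K_0(A)`, for a possibly non-unital C⋆-algebra `A`: the kernel of `K_00(A~) → K_00(ℂ)`. -/
def K0 (A : Type u) [NonUnitalCStarAlgebra A] : Type u := (K00.map (augmentation A)).ker

variable {A : Type u} [NonUnitalCStarAlgebra A] {A' : Type v} [NonUnitalCStarAlgebra A']

instance : AddCommGroup (K0 A) := inferInstanceAs (AddCommGroup (K00.map (augmentation A)).ker)

theorem augmentation_comp_starMap (φ : A →⋆ₙₐ[ℂ] A') :
    (augmentation A').comp (Unitization.starMap φ) = augmentation A := by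
  ext x
  change (Unitization.starMap φ (x : Unitization ℂ A)).fst = (x : Unitization ℂ A).fst
  simp

/-- The homomorphism `φ_* : K_0(A) → K_0(A')` induced by a ⋆-homomorphism `φ : A → A'`. -/
def K0.map (φ : A →⋆ₙₐ[ℂ] A') : K0 A →+ K0 A' :=
  ((K00.map (Unitization.starMap φ)).comp (K00.map (augmentation A)).ker.subtype).codRestrict
    (K00.map (augmentation A')).ker fun x => by
      have h := DFunLike.congr_fun (K00.map_comp (augmentation A') (Unitization.starMap φ)) x.1
      rw [augmentation_comp_starMap] at h
      exact h.symm.trans x.2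

end K0

/-- A unitary in some matrix algebra `M_n(B)`. -/
structure UnitaryMat (B : Type u) [CStarAlgebra B] where
  size : ℕ
  val : unitary (Matrix (Fin size) (Fin size) B)

namespace UnitaryMat

variable {B : Type u} [CStarAlgebra B] {C : Type v} [CStarAlgebra C]

/-- The direct sum `diag(u, v)`. -/
def sum (u v : UnitaryMat B) : UnitaryMat B where
  size := u.size + v.size
  val := ⟨diagSum u.val.1 v.val.1, by
    rw [Unitary.mem_iff, star_diagSum, diagSum_mul, diagSum_mul, Unitary.coe_star_mul_self,
      Unitary.coe_star_mul_self, Unitary.mul_star_self_of_mem u.val.2,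
      Unitary.mul_star_self_of_mem v.val.2, diagSum_one]
    exact ⟨rfl, rfl⟩⟩

/-- A unital ⋆-homomorphism applied entrywise to unitary matrices of a fixed size. -/
def mapUnitary (φ : B →⋆ₐ[ℂ] C) {n : ℕ} (u : unitary (Matrix (Fin n) (Fin n) B)) :
    unitary (Matrix (Fin n) (Fin n) C) :=
  ⟨u.1.map φ, by
    rw [Unitary.mem_iff, Matrix.star_eq_conjTranspose, star_map, ← Matrix.star_eq_conjTranspose,
      ← Matrix.map_mul, ← Matrix.map_mul, Unitary.coe_star_mul_self, Unitary.mul_star_self_of_mem u.2]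
    simp⟩

theorem continuous_mapUnitary (φ : B →⋆ₐ[ℂ] C) {n : ℕ} :
    Continuous (mapUnitary φ : unitary (Matrix (Fin n) (Fin n) B) → _) :=
  (continuous_subtype_val.matrix_map (AddMonoidHomClass.continuous_of_bound φ 1 fun x => by
    simpa using NonUnitalStarAlgHom.norm_apply_le φ x)).subtype_mk _

/-- The image of a unitary matrix under a unital ⋆-homomorphism. -/
def map (φ : B →⋆ₐ[ℂ] C) (u : UnitaryMat B) : UnitaryMat C := ⟨u.size, mapUnitary φ u.val⟩

end UnitaryMat

section K1

/-- The relations `[u] = [v]` for `u`, `v` joined by a path in some `U_n(B)`,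
`[diag(u, v)] = [u] + [v]`, and `[1] = 0`. -/
def unitaryRelations (B : Type u) [CStarAlgebra B] :
    AddSubgroup (FreeAbelianGroup (UnitaryMat B)) :=
  AddSubgroup.closure
    ({x | ∃ (n : ℕ) (u v : unitary (Matrix (Fin n) (Fin n) B)), Joined u v ∧
        x = FreeAbelianGroup.of ⟨n, u⟩ - FreeAbelianGroup.of ⟨n, v⟩} ∪
      {x | ∃ u v : UnitaryMat B, x = FreeAbelianGroup.of (u.sum v) -
        (FreeAbelianGroup.of u + FreeAbelianGroup.of v)} ∪
      {x | ∃ n : ℕ, x = FreeAbelianGroup.of ⟨n, 1⟩})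

/-- The group of homotopy classes of unitaries in matrix algebras over a unital C⋆-algebra `B`,
where `u` is identified with `diag(u, 1)` and the sum is `[u] + [v] = [diag(u, v)]` (`= [uv]` for
unitaries of the same size). -/
def K11 (B : Type u) [CStarAlgebra B] : Type u :=
  FreeAbelianGroup (UnitaryMat B) ⧸ unitaryRelations B

variable {B : Type u} [CStarAlgebra B] {C : Type v} [CStarAlgebra C]

instance : AddCommGroup (K11 B) :=
  inferInstanceAs (AddCommGroup (FreeAbelianGroup (UnitaryMat B) ⧸ unitaryRelations B))

/-- `K_11` is functorial: `[u] ↦ [φ(u)]`. -/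
def K11.map (φ : B →⋆ₐ[ℂ] C) : K11 B →+ K11 C :=
  QuotientAddGroup.map (unitaryRelations B) (unitaryRelations C)
    (FreeAbelianGroup.map (UnitaryMat.map φ)) <| by
      rw [unitaryRelations, AddSubgroup.closure_le]
      rintro x ((⟨n, u, v, huv, rfl⟩ | ⟨u, v, rfl⟩) | ⟨n, rfl⟩)
      · exact AddSubgroup.subset_closure (Or.inl (Or.inl
          ⟨n, UnitaryMat.mapUnitary φ u, UnitaryMat.mapUnitary φ v,
            huv.map (UnitaryMat.continuous_mapUnitary φ), by simp [UnitaryMat.map]⟩))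
      · refine AddSubgroup.subset_closure (Or.inl (Or.inr ⟨u.map φ, v.map φ, ?_⟩))
        have : (u.sum v).map φ = (u.map φ).sum (v.map φ) := by
          have h : (diagSum u.val.1 v.val.1).map φ = diagSum (u.val.1.map φ) (v.val.1.map φ) :=
            diagSum_map φ _ _
          exact congrArg (UnitaryMat.mk (u.size + v.size)) (Subtype.ext h)
        simp [this]
      · refine AddSubgroup.subset_closure (Or.inr ⟨n, ?_⟩)
        have : UnitaryMat.mapUnitary φ (1 : unitary (Matrix (Fin n) (Fin n) B)) = 1 :=
          Subtype.ext (by simp [UnitaryMat.mapUnitary])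
        simp [UnitaryMat.map, this]

/-- `K_1(A)`, for a possibly non-unital C⋆-algebra `A`: stable homotopy classes of unitary matrices
over the unitization `A~`. -/
def K1 (A : Type u) [NonUnitalCStarAlgebra A] : Type u := K11 (Unitization ℂ A)

variable {A : Type u} [NonUnitalCStarAlgebra A] {A' : Type v} [NonUnitalCStarAlgebra A']

instance : AddCommGroup (K1 A) := inferInstanceAs (AddCommGroup (K11 (Unitization ℂ A)))

/-- The homomorphism `φ_* : K_1(A) → K_1(A')` induced by a ⋆-homomorphism `φ : A → A'`. -/
def K1.map (φ : A →⋆ₙₐ[ℂ] A') : K1 A →+ K1 A' := K11.map (Unitization.starMap φ)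

end K1

end KTheory

end

/-! ### ⋆-homomorphisms as closed graphs, and C⋆-inductive limits. -/

noncomputable section

namespace CrossedProduct

/-! The inclusion of crossed products is read off from operators on Hilbert modules. Let `V : L²(H)
⊗ A → L²(G) ⊗ A` be extension by zero. It is isometric because `H` carries the restricted Haar
measure, and `λ_G(f) V = V λ_H(f)` when `f ∈ C_c(H, A)` is extended by zero. The range of `V` is
only a part of `L²(G) ⊗ A`, but the twisted right translations `(ρ_x ξ)(y) = x⁻¹ • ξ(y x⁻¹)` commute
with every `λ_G(f)`, and the vectors `ρ_x V η` are total: a compactly supported function meets only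
finitely many cosets of the open subgroup `H` (`coe_mem_span_right_extend`). Hence, in a pair `(T,
T')` with `T' V = V T` and `T' ρ_x = ρ_x T'`, each entry vanishes as soon as the other does. The
pairs that satisfy this together with their adjoints form a closed ⋆-subalgebra containing all
`(λ_H(f), λ_G(f))`, so they are the graph of an injective, hence isometric, ⋆-homomorphism
(`exists_starHom_of_graph`, `exists_isInducedByExtension`). Uniqueness, and with it every
compatibility between inclusions, follows because `C_c` generates the crossed product.

If `G` is the union of the `G_n`, a compact support already lies in one `G_n`. The union of the
images is therefore dense, and a C⋆-algebra containing an inductive system isometrically with dense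
union has the universal property (`isCStarInductiveLimit_of_dense`).

The rest is continuity of K-theory for such dense unions. Density and isometry pass to unitizations
and to matrix algebras. Being almost a projection, a partial isometry or a unitary is an open
condition, so it is met at a finite stage near any exact solution in the limit, and functional
calculus inside that stage corrects the approximation to an exact solution
(`exists_partialIsometry_near`, `exists_isStarProjection_near`). For `K_0` this shows that
projections and Murray–von Neumann equivalences descend to finite stages. For `K_1`, unitaries
descend, and two unitaries at distance less than `2` are joined by a path; the class of a nearby
finite-stage unitary is then locally constant, hence invariant under homotopy. In both cases this
gives an inverse to the map from the direct limit, defined on generators and relations. The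
non-unital groups follow by applying this to unitizations. -/

/-- A closed ⋆-subalgebra of `Y × B` that meets `0 × B` only in `0`, and whose projection to `Y`
is dense, is the graph of a ⋆-homomorphism. -/
theorem exists_starHom_of_graph {Y : Type*} {B : Type*} [NonUnitalCStarAlgebra Y]
    [NonUnitalCStarAlgebra B] (Γ : NonUnitalStarSubalgebra ℂ (Y × B))
    (hcl : IsClosed (Γ : Set (Y × B))) (hinj : ∀ b, ((0 : Y), b) ∈ Γ → b = 0)
    (hd : Dense {y : Y | ∃ b, (y, b) ∈ Γ}) :
    ∃ Ψ : Y →⋆ₙₐ[ℂ] B, ∀ y, (y, Ψ y) ∈ Γ := by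
  have := hcl
  let _ : NonUnitalCStarAlgebra Γ := NonUnitalStarSubalgebra.nonUnitalCStarAlgebra Γ
  let p : Γ →⋆ₙₐ[ℂ] Y :=
    (NonUnitalStarAlgHom.fst ℂ Y B).comp (NonUnitalStarSubalgebraClass.subtype Γ)
  have hp : ∀ x : Γ, p x = x.1.1 := fun _ => rfl
  have hpinj : Function.Injective p := by
    refine (injective_iff_map_eq_zero p).2 fun x hx => ?_
    obtain ⟨⟨y, b⟩, hx'⟩ := x
    obtain rfl : y = 0 := hx
    obtain rfl := hinj b hx'
    rfl
  -- Γ is complete, and an injective ⋆-homomorphism of C⋆-algebras is isometric; so the projection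
  -- to `Y` has closed range, and density makes it surjective.
  have hiso : Isometry p := NonUnitalStarAlgHom.isometry p hpinj
  have hrange : Set.range p = Set.univ := by
    refine (hiso.isClosedEmbedding.isClosed_range.closure_eq.symm.trans ?_)
    refine Dense.closure_eq (hd.mono ?_)
    rintro y ⟨b, hb⟩
    exact ⟨⟨(y, b), hb⟩, rfl⟩
  have hex : ∀ y, ∃ b, (y, b) ∈ Γ := fun y => by
    obtain ⟨⟨⟨y', b⟩, hx⟩, rfl⟩ := (Set.range_eq_univ.1 hrange) y
    exact ⟨b, hx⟩
  have huniq : ∀ {y b b'}, (y, b) ∈ Γ → (y, b') ∈ Γ → b = b' := fun {y b b'} h h' => by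
    have := sub_mem h h'
    rw [Prod.mk_sub_mk, sub_self] at this
    exact sub_eq_zero.1 (hinj _ this)
  choose Ψ hΨ using hex
  exact ⟨{ toFun := Ψ
           map_smul' := fun c y => huniq (hΨ _) (Γ.smul_mem' c (hΨ y))
           map_zero' := huniq (hΨ _) (zero_mem Γ)
           map_add' := fun y y' => huniq (hΨ _) (add_mem (hΨ y) (hΨ y'))
           map_mul' := fun y y' => huniq (hΨ _) (mul_mem (hΨ y) (hΨ y'))
           map_star' := fun y => huniq (hΨ _) (star_mem (hΨ y)) }, hΨ⟩

theorem starHom_ext_of_dense {Y : Type*} {B : Type*} [NonUnitalCStarAlgebra Y]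
    [NonUnitalCStarAlgebra B] {D : Set Y} (hD : Dense D) {Φ Ψ : Y →⋆ₙₐ[ℂ] B}
    (h : ∀ y ∈ D, Φ y = Ψ y) : Φ = Ψ := by
  refine DFunLike.coe_injective (Continuous.ext_on hD ?_ ?_ h)
  · exact AddMonoidHomClass.continuous_of_bound Φ 1 fun x => by
      simpa using NonUnitalStarAlgHom.norm_apply_le Φ x
  · exact AddMonoidHomClass.continuous_of_bound Ψ 1 fun x => by
      simpa using NonUnitalStarAlgHom.norm_apply_le Ψ x

/-- A C⋆-algebra that contains the members of an inductive system isometrically, with dense union,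
is its C⋆-inductive limit. -/
theorem isCStarInductiveLimit_of_dense (X : ℕ → Type u) [∀ n, NonUnitalCStarAlgebra (X n)]
    (f : ∀ m n, m ≤ n → (X m →⋆ₙₐ[ℂ] X n)) (Y : Type v) [NonUnitalCStarAlgebra Y]
    (κ : ∀ n, X n →⋆ₙₐ[ℂ] Y) (hκ : ∀ m n (h : m ≤ n), (κ n).comp (f m n h) = κ m)
    (hiso : ∀ n, Isometry (κ n)) (hd : Dense (⋃ n, Set.range (κ n))) :
    IsCStarInductiveLimit.{u, v, w} X f Y κ := by
  refine ⟨hκ, fun B _ ψ hψ => ?_⟩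
  have hκ' : ∀ {m n} (h : m ≤ n) x, κ n (f m n h x) = κ m x := fun h x =>
    DFunLike.congr_fun (hκ _ _ h) x
  have hψ' : ∀ {m n} (h : m ≤ n) x, ψ n (f m n h x) = ψ m x := fun h x =>
    DFunLike.congr_fun (hψ _ _ h) x
  have hpair : ∀ {p q : Y × B}, (∃ n x, (κ n x, ψ n x) = p) → (∃ n x, (κ n x, ψ n x) = q) →
      ∃ n x y, (κ n x, ψ n x) = p ∧ (κ n y, ψ n y) = q := by
    rintro _ _ ⟨m, x, rfl⟩ ⟨n, y, rfl⟩
    exact ⟨max m n, f m _ (le_max_left m n) x, f n _ (le_max_right m n) y,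
      by rw [hκ', hψ'], by rw [hκ', hψ']⟩
  let Γ₀ : NonUnitalStarSubalgebra ℂ (Y × B) :=
    { carrier := {p | ∃ n x, (κ n x, ψ n x) = p}
      add_mem' := fun hp hq => by
        obtain ⟨n, x, y, rfl, rfl⟩ := hpair hp hq
        exact ⟨n, x + y, by simp⟩
      mul_mem' := fun hp hq => by
        obtain ⟨n, x, y, rfl, rfl⟩ := hpair hp hq
        exact ⟨n, x * y, by simp⟩
      zero_mem' := ⟨0, 0, by simp⟩
      smul_mem' := by
        rintro c _ ⟨n, x, rfl⟩
        exact ⟨n, c • x, by simp⟩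
      star_mem' := by
        rintro _ ⟨n, x, rfl⟩
        exact ⟨n, star x, Prod.ext (map_star _ _) (map_star _ _)⟩ }
  have hΓ : ∀ n x, (κ n x, ψ n x) ∈ Γ₀.topologicalClosure := fun n x =>
    Γ₀.le_topologicalClosure ⟨n, x, rfl⟩
  -- The bound `‖ψ n x‖ ≤ ‖x‖ = ‖κ n x‖` survives closure; it is what makes the closed relation
  -- single-valued.
  have hle : ∀ p ∈ Γ₀.topologicalClosure, ‖p.2‖ ≤ ‖p.1‖ := by
    intro p hp
    refine closure_minimal (s := (Γ₀ : Set (Y × B))) (t := {p | ‖p.2‖ ≤ ‖p.1‖}) ?_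
      (isClosed_le (by fun_prop) (by fun_prop)) hp
    rintro _ ⟨n, x, rfl⟩
    have h1 := NonUnitalStarAlgHom.norm_apply_le (ψ n) x
    have h2 : ‖κ n x‖ = ‖x‖ := (AddMonoidHomClass.isometry_iff_norm (κ n)).1 (hiso n) x
    exact h1.trans h2.ge
  obtain ⟨Ψ, hΨ⟩ := exists_starHom_of_graph Γ₀.topologicalClosure
    Γ₀.isClosed_topologicalClosure (fun b hb => by simpa using hle _ hb) (hd.mono (by
      rintro _ ⟨_, ⟨n, rfl⟩, x, rfl⟩
      exact ⟨_, hΓ n x⟩))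
  have hΨκ : ∀ n x, Ψ (κ n x) = ψ n x := fun n x => by
    have h := hle _ (sub_mem (hΨ (κ n x)) (hΓ n x))
    simpa [sub_eq_zero] using h
  refine ⟨Ψ, fun n => NonUnitalStarAlgHom.ext (hΨκ n), fun Φ hΦ => ?_⟩
  refine starHom_ext_of_dense hd ?_
  rintro _ ⟨_, ⟨n, rfl⟩, x, rfl⟩
  exact (DFunLike.congr_fun (hΦ n) x).trans (hΨκ n x).symm

end CrossedProduct

end

/-! ### Generators of the crossed product and the adjoint of `λ(f)`. -/

noncomputable section

namespace CrossedProduct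

section Generators

variable {G : Type u} [Group G] [TopologicalSpace G] [IsTopologicalGroup G]
  [LocallyCompactSpace G] [MeasurableSpace G] [BorelSpace G]
  {A : Type v} [NonUnitalCStarAlgebra A] {μ : Measure G} [μ.IsHaarMeasure]

namespace ReducedCrossedProduct

/-- The inclusion of the reduced crossed product into the adjointable operators. -/
def incl (α : Action G A) (μ : Measure G) [μ.IsHaarMeasure] :
    ReducedCrossedProduct α μ →⋆ₙₐ[ℂ] Adjointable A μ :=
  NonUnitalStarSubalgebraClass.subtype
    (NonUnitalStarAlgebra.adjoin ℂ (Set.range (regularRep α μ))).topologicalClosure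

theorem isometry_incl (α : Action G A) : Isometry (incl α μ) := isometry_subtype_coe

/-- The crossed product is the closure of the ⋆-algebra generated by the `λ(f)`, and its topology is
induced from the adjointable operators, so the closure can be computed there. Both uniqueness of the
inclusions and density of the union reduce to this. -/
theorem dense_of_ofCc_mem {α : Action G A} (S : NonUnitalStarSubalgebra ℂ (ReducedCrossedProduct α μ))
    (hS : ∀ f, ofCc α μ f ∈ S) : Dense (S : Set (ReducedCrossedProduct α μ)) := by
  intro y
  rw [(isometry_incl α).isUniformInducing.isInducing.closure_eq_preimage_closure_image]
  have hle : NonUnitalStarAlgebra.adjoin ℂ (Set.range (regularRep α μ)) ≤ S.map (incl α μ) := by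
    refine NonUnitalStarAlgebra.adjoin_le ?_
    rintro _ ⟨f, rfl⟩
    exact ⟨ofCc α μ f, hS f, rfl⟩
  exact closure_mono hle y.2

theorem hom_ext_ofCc {α : Action G A} {B : Type*} [NonUnitalCStarAlgebra B]
    {Φ Ψ : ReducedCrossedProduct α μ →⋆ₙₐ[ℂ] B} (h : ∀ f, Φ (ofCc α μ f) = Ψ (ofCc α μ f)) :
    Φ = Ψ :=
  starHom_ext_of_dense (dense_of_ofCc_mem (NonUnitalStarAlgHom.equalizer Φ Ψ) h) fun _ hy => hy

end ReducedCrossedProduct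

theorem integrable_regularRep (α : Action G A) (f : C_c(G, A)) (x : L2 A μ) :
    Integrable (fun y => regπ μ α (f y) (regU A μ y x)) μ := by
  refine Continuous.integrable_of_hasCompactSupport
    (((continuous_regπ α).comp f.continuous).clm_apply (continuous_regU_apply x))
    (f.hasCompactSupport.mono fun y hy h0 => hy ?_)
  simp [h0, regπ_zero]

theorem integrable_star_regularRep (α : Action G A) (f : C_c(G, A)) (x : L2 A μ) :
    Integrable (fun y => regU A μ y⁻¹ (regπ μ α (star (f y)) x)) μ := by
  refine Continuous.integrable_of_hasCompactSupport
    (continuous_regU_apply' continuous_inv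
        (((continuous_regπ α).comp f.continuous.star).clm_apply continuous_const))
    (f.hasCompactSupport.mono fun y hy h0 => hy ?_)
  simp [h0, regπ_zero]

/-- This expresses `λ(f)*` through `π` and `U` directly, without the modular function that would
enter on rewriting it as `λ(f*)`. It suffices for checking that adjoints are intertwined too. -/
theorem star_regularRep_apply (α : Action G A) (f : C_c(G, A)) (x : L2 A μ) :
    star (regularRep α μ f) x = ∫ y, regU A μ y⁻¹ (regπ μ α (star (f y)) x) ∂μ := by
  refine L2.ext_form fun z => ?_
  rw [Adjointable.form_star_right, ← (L2.form z).integral_comp_comm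
    (integrable_star_regularRep α f x), ← L2.star_form, regularRep_apply,
    ← (L2.form x).integral_comp_comm (integrable_regularRep α f z)]
  have hst := ((starL' ℝ : A ≃L[ℝ] A) : A →L[ℝ] A).integral_comp_comm
    ((L2.form x).integrable_comp (integrable_regularRep α f z))
  refine hst.symm.trans (integral_congr_ae (Filter.Eventually.of_forall fun y => ?_))
  refine (L2.star_form _ _).trans ?_
  simp [form_regπ, form_regU]

end Generators

/-! ### Extension by zero from an open subgroup to the Hilbert module of `G`. -/

section Extend

variable {G : Type u} [Group G] [TopologicalSpace G] [IsTopologicalGroup G] [T2Space G]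
  [MeasurableSpace G] [BorelSpace G]
  {H : Type u} [Group H] [TopologicalSpace H] [IsTopologicalGroup H]
  [MeasurableSpace H] [BorelSpace H]
  {A : Type v} [NonUnitalCStarAlgebra A] {μ : Measure G} [μ.IsHaarMeasure]
  {μH : Measure H} [μH.IsHaarMeasure]

theorem integral_comap_of_support_subset {E : Type*} [NormedAddCommGroup E] [NormedSpace ℝ E]
    {φ : H → G} (hφ : IsOpenEmbedding φ) (hμ : μH = μ.comap φ) {F : G → E}
    (hF : ∀ y, y ∉ Set.range φ → F y = 0) : ∫ y, F y ∂μ = ∫ h, F (φ h) ∂μH := by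
  have hm : MeasurableEmbedding φ := hφ.measurableEmbedding
  rw [hμ, ← hm.integral_map, hm.map_comap, setIntegral_eq_integral_of_forall_compl_eq_zero hF]

theorem extendByZero_apply {φ : H → G} (hφ : IsOpenEmbedding φ) (f : C_c(H, A)) (h : H) :
    extendByZero φ hφ f (φ h) = f h := hφ.injective.extend_apply _ _ _

theorem extendByZero_apply_of_notMem {φ : H → G} (hφ : IsOpenEmbedding φ) (f : C_c(H, A)) {y : G}
    (hy : y ∉ Set.range φ) : extendByZero φ hφ f y = 0 :=
  Function.extend_apply' _ _ _ hy

namespace PreL2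

variable (μ) in
/-- Extension by zero along an open embedding. -/
def extend {φ : H → G} (hφ : IsOpenEmbedding φ) (ξ : PreL2 A μH) : PreL2 A μ :=
  (extendByZero φ hφ (show C_c(H, A) from ξ) : C_c(G, A))

@[simp] theorem extend_apply {φ : H → G} (hφ : IsOpenEmbedding φ) (ξ : PreL2 A μH) (h : H) :
    extend μ hφ ξ (φ h) = ξ h := extendByZero_apply hφ _ h

theorem extend_apply_of_notMem {φ : H → G} (hφ : IsOpenEmbedding φ) (ξ : PreL2 A μH) {y : G}
    (hy : y ∉ Set.range φ) : extend μ hφ ξ y = 0 := extendByZero_apply_of_notMem hφ _ hy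

/-- Functions on `G` agree if they agree on the range of `φ` and vanish off it. -/
theorem ext_of_range {φ : H → G} {ξ η : PreL2 A μ} (h : ∀ h, ξ (φ h) = η (φ h))
    (hξ : ∀ y ∉ Set.range φ, ξ y = 0) (hη : ∀ y ∉ Set.range φ, η y = 0) : ξ = η := by
  ext y
  by_cases hy : y ∈ Set.range φ
  · obtain ⟨k, rfl⟩ := hy
    exact h k
  · rw [hξ y hy, hη y hy]

theorem inner_extend {φ : H → G} (hφ : IsOpenEmbedding φ) (hμ : μH = μ.comap φ)
    (ξ η : PreL2 A μH) : inner (extend μ hφ ξ) (extend μ hφ η) = inner ξ η := by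
  rw [inner, integral_comap_of_support_subset hφ hμ fun y hy => by
    rw [extend_apply_of_notMem hφ η hy, mul_zero]]
  simp [inner]

theorem norm_extend {φ : H → G} (hφ : IsOpenEmbedding φ) (hμ : μH = μ.comap φ)
    (ξ : PreL2 A μH) : ‖extend μ hφ ξ‖ = ‖ξ‖ := by
  have h : ‖extend μ hφ ξ‖ ^ 2 = ‖ξ‖ ^ 2 := by rw [norm_sq, norm_sq, inner_extend hφ hμ]
  exact (pow_left_inj₀ (norm_nonneg' _) (norm_nonneg' _) two_ne_zero).1 h

/-- Extension by zero as a bounded operator. -/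
def extendL {φ : H → G} (hφ : IsOpenEmbedding φ) (hμ : μH = μ.comap φ) :
    PreL2 A μH →L[ℂ] PreL2 A μ :=
  LinearMap.mkContinuous
    { toFun := extend μ hφ
      map_add' := fun ξ η => ext_of_range (φ := φ) (by simp)
        (fun y hy => by simp [extend_apply_of_notMem hφ _ hy])
        (fun y hy => by simp [extend_apply_of_notMem hφ _ hy])
      map_smul' := fun c ξ => ext_of_range (φ := φ) (by simp)
        (fun y hy => by simp [extend_apply_of_notMem hφ _ hy])
        (fun y hy => by simp [extend_apply_of_notMem hφ _ hy]) } 1 fun ξ => by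
      rw [one_mul]; exact (norm_extend hφ hμ ξ).le

end PreL2

variable (A) in
/-- The isometric inclusion `L²(H) ⊗ A → L²(G) ⊗ A` of an open subgroup, extension by zero. -/
def extendOp {φ : H → G} (hφ : IsOpenEmbedding φ) (hμ : μH = μ.comap φ) : L2 A μH →L[ℂ] L2 A μ :=
  (PreL2.extendL hφ hμ).completion

@[simp] theorem extendOp_coe {φ : H → G} (hφ : IsOpenEmbedding φ) (hμ : μH = μ.comap φ)
    (ξ : PreL2 A μH) : extendOp A hφ hμ (ξ : L2 A μH) = (PreL2.extend μ hφ ξ : L2 A μ) := by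
  simp [extendOp]; rfl

theorem norm_extendOp {φ : H → G} (hφ : IsOpenEmbedding φ) (hμ : μH = μ.comap φ) (x : L2 A μH) :
    ‖extendOp A hφ hμ x‖ = ‖x‖ := by
  induction x using Completion.induction_on with
  | hp => exact isClosed_eq (by fun_prop) (by fun_prop)
  | ih ξ => simp [PreL2.norm_extend hφ hμ]

/-- Left translation by an element of the subgroup preserves both the subgroup and its complement.
-/
theorem extendOp_regU {φ : H →* G} (hφ : IsOpenEmbedding φ) (hμ : μH = μ.comap φ) (h : H)
    (x : L2 A μH) :
    extendOp A hφ hμ (regU A μH h x) = regU A μ (φ h) (extendOp A hφ hμ x) := by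
  induction x using Completion.induction_on with
  | hp => exact isClosed_eq (by fun_prop) (by fun_prop)
  | ih ξ =>
    simp only [extendOp_coe, regU_coe]
    congr 1
    refine PreL2.ext_of_range (φ := φ) (fun k => ?_)
      (fun y hy => PreL2.extend_apply_of_notMem hφ _ hy) (fun y hy => ?_)
    · rw [PreL2.extend_apply, PreL2.translate_apply, PreL2.translate_apply, ← map_inv, ← map_mul,
        PreL2.extend_apply]
    · rw [PreL2.translate_apply, PreL2.extend_apply_of_notMem hφ]
      rintro ⟨k, hk⟩
      exact hy ⟨h * k, by rw [map_mul, hk, mul_inv_cancel_left]⟩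

theorem extendOp_regπ {φ : H →* G} (hφ : IsOpenEmbedding φ) (hμ : μH = μ.comap φ)
    {αH : Action H A} {α : Action G A} (hα : ∀ h a, αH.aut h a = α.aut (φ h) a) (a : A)
    (x : L2 A μH) :
    extendOp A hφ hμ (regπ μH αH a x) = regπ μ α a (extendOp A hφ hμ x) := by
  induction x using Completion.induction_on with
  | hp => exact isClosed_eq (by fun_prop) (by fun_prop)
  | ih ξ =>
    simp only [extendOp_coe, regπ_coe]
    congr 1
    refine PreL2.ext_of_range (φ := φ) (fun k => ?_)
      (fun y hy => PreL2.extend_apply_of_notMem hφ _ hy) (fun y hy => ?_)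
    · rw [PreL2.extend_apply, PreL2.act_apply, PreL2.act_apply, PreL2.extend_apply, hα, map_inv]
    · rw [PreL2.act_apply, PreL2.extend_apply_of_notMem hφ _ hy, mul_zero]

end Extend

/-! ### Twisted right translations, commuting with the regular representation. -/

section Right

variable {G : Type u} [Group G] [TopologicalSpace G] [IsTopologicalGroup G]
  [LocallyCompactSpace G] [SecondCountableTopology G]
  [MeasurableSpace G] [BorelSpace G]
  {A : Type v} [NonUnitalCStarAlgebra A] {μ : Measure G} [μ.IsHaarMeasure]

theorem norm_aut (α : Action G A) (g : G) (a : A) : ‖α.aut g a‖ = ‖a‖ :=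
  NonUnitalStarAlgHom.norm_map (α.aut g) (α.aut g).injective a

theorem continuous_aut_apply (α : Action G A) (g : G) : Continuous (α.aut g) :=
  (AddMonoidHomClass.isometry_of_norm (α.aut g) (norm_aut α g)).continuous

namespace PreL2

/-- Right translation, twisted by the action: `ξ ↦ (y ↦ x⁻¹ • ξ(y x⁻¹))`. -/
def right (α : Action G A) (x : G) (ξ : PreL2 A μ) : PreL2 A μ :=
  mk (fun y => α.aut x⁻¹ (ξ (y * x⁻¹)))
    ((continuous_aut_apply α x⁻¹).comp (ξ.continuous.comp (continuous_mul_const x⁻¹)))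
    ((ξ.hasCompactSupport.comp_homeomorph (Homeomorph.mulRight x⁻¹)).comp_left (map_zero _))

@[simp] theorem right_apply (α : Action G A) (x : G) (ξ : PreL2 A μ) (y : G) :
    right α x ξ y = α.aut x⁻¹ (ξ (y * x⁻¹)) := rfl

/-- Right translation carries Haar measure to a multiple `c` of itself, by uniqueness of
left-invariant measures, and the automorphism is isometric; the norm is thus scaled by `√c`.
Boundedness is all that is needed: these operators are neither unitary nor linear over `A` in
general. -/
theorem exists_norm_right_le (α : Action G A) (x : G) :
    ∃ C : ℝ, ∀ ξ : PreL2 A μ, ‖right α x ξ‖ ≤ C * ‖ξ‖ := by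
  let c := Measure.haarScalarFactor (μ.map (· * x⁻¹)) μ
  have hc : μ.map (· * x⁻¹) = c • μ := Measure.isMulLeftInvariant_eq_smul _ _
  refine ⟨Real.sqrt c, fun ξ => ?_⟩
  have h : inner (right α x ξ) (right α x ξ) = α.aut x⁻¹ (c • inner ξ ξ) := by
    have h1 : c • inner ξ ξ = ∫ y, star (ξ (y * x⁻¹)) * ξ (y * x⁻¹) ∂μ := by
      rw [inner, ← integral_smul_nnreal_measure, ← hc]
      exact (MeasurableEquiv.mulRight x⁻¹).measurableEmbedding.integral_map _
    have hint : Integrable (fun y => star (ξ (y * x⁻¹)) * ξ (y * x⁻¹)) μ := by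
      have hx : HasCompactSupport fun y => ξ (y * x⁻¹) :=
        ξ.hasCompactSupport.comp_homeomorph (Homeomorph.mulRight x⁻¹)
      have hcx : Continuous fun y => ξ (y * x⁻¹) := ξ.continuous.comp (continuous_mul_const x⁻¹)
      exact (hcx.star.mul hcx).integrable_of_hasCompactSupport hx.mul_left
    let L : A →L[ℂ] A := LinearMap.mkContinuous
      { toFun := α.aut x⁻¹, map_add' := map_add _, map_smul' := map_smul _ } 1
      fun a => by rw [one_mul]; exact (norm_aut α _ a).le
    have h2 := L.integral_comp_comm hint
    rw [h1]
    refine Eq.trans ?_ h2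
    refine integral_congr_ae (Filter.Eventually.of_forall fun y => ?_)
    change star (α.aut x⁻¹ _) * α.aut x⁻¹ _ = α.aut x⁻¹ _
    rw [map_mul (α.aut x⁻¹), map_star (α.aut x⁻¹)]
  have h2 : ‖right α x ξ‖ ^ 2 ≤ (Real.sqrt c * ‖ξ‖) ^ 2 := by
    rw [norm_sq, h, norm_aut, mul_pow, norm_sq, Real.sq_sqrt c.coe_nonneg, NNReal.smul_def, norm_smul]
    simp
  exact (pow_le_pow_iff_left₀ (norm_nonneg' _)
    (mul_nonneg (Real.sqrt_nonneg _) (norm_nonneg' _)) two_ne_zero).1 h2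

/-- `right` as a bounded operator. -/
def rightL (α : Action G A) (x : G) : PreL2 A μ →L[ℂ] PreL2 A μ :=
  LinearMap.mkContinuous
    { toFun := right α x
      map_add' := fun ξ η => by ext y; simp
      map_smul' := fun c ξ => by ext y; simp } _ (exists_norm_right_le α x).choose_spec

theorem right_right_inv (α : Action G A) (x : G) (ξ : PreL2 A μ) :
    right α x (right α x⁻¹ ξ) = ξ := by
  ext y
  rw [right_apply, right_apply, inv_inv, inv_mul_cancel_right, ← StarAlgEquiv.mul_apply, ← map_mul]
  simp

end PreL2

variable (μ) in
/-- The twisted right regular representation on `L²(G) ⊗ A`. -/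
def rightOp (α : Action G A) (x : G) : L2 A μ →L[ℂ] L2 A μ := (PreL2.rightL α x).completion

@[simp] theorem rightOp_coe (α : Action G A) (x : G) (ξ : PreL2 A μ) :
    rightOp μ α x (ξ : L2 A μ) = (PreL2.right α x ξ : L2 A μ) := by
  simp [rightOp]; rfl

theorem rightOp_regU (α : Action G A) (x g : G) (z : L2 A μ) :
    rightOp μ α x (regU A μ g z) = regU A μ g (rightOp μ α x z) := by
  induction z using Completion.induction_on with
  | hp => exact isClosed_eq (by fun_prop) (by fun_prop)
  | ih ξ =>
    simp only [rightOp_coe, regU_coe]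
    congr 1
    ext y
    simp [mul_assoc]

/-- The twist by `x⁻¹` is chosen for this: `x⁻¹ • ((y x⁻¹)⁻¹ • a) = y⁻¹ • a`, so the multiplier at
the translated point becomes the multiplier at `y`. -/
theorem rightOp_regπ (α : Action G A) (x : G) (a : A) (z : L2 A μ) :
    rightOp μ α x (regπ μ α a z) = regπ μ α a (rightOp μ α x z) := by
  induction z using Completion.induction_on with
  | hp => exact isClosed_eq (by fun_prop) (by fun_prop)
  | ih ξ =>
    simp only [rightOp_coe, regπ_coe]
    congr 1
    ext y
    rw [PreL2.right_apply, PreL2.act_apply, PreL2.act_apply, PreL2.right_apply, map_mul,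
      ← StarAlgEquiv.mul_apply, ← map_mul]
    simp

end Right

end CrossedProduct

end

/-! ### The isometric inclusion of crossed products. -/

noncomputable section

namespace CrossedProduct

theorem Adjointable.continuous_apply {G : Type u} [Group G] [TopologicalSpace G]
    [IsTopologicalGroup G] [MeasurableSpace G] [BorelSpace G] {A : Type v}
    [NonUnitalCStarAlgebra A] {μ : Measure G} [μ.IsHaarMeasure] (x : L2 A μ) : 
    Continuous fun T : Adjointable A μ => T x :=
  (ContinuousLinearMap.apply ℂ (L2 A μ) x).continuous.comp
    (show Isometry (toCLM : Adjointable A μ → _) from isometry_subtype_coe).continuous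

section Inclusion

variable {G : Type u} [Group G] [TopologicalSpace G] [IsTopologicalGroup G] [T2Space G]
  [LocallyCompactSpace G] [SecondCountableTopology G] [MeasurableSpace G] [BorelSpace G]
  {H : Type u} [Group H] [TopologicalSpace H] [IsTopologicalGroup H]
  [LocallyCompactSpace H] [MeasurableSpace H] [BorelSpace H]
  {A : Type v} [NonUnitalCStarAlgebra A] {μ : Measure G} [μ.IsHaarMeasure]
  {μH : Measure H} [μH.IsHaarMeasure]

theorem isClopen_range {φ : H →* G} (hφ : IsOpenEmbedding φ) : IsClopen (Set.range φ) :=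
  ⟨Subgroup.isClosed_of_isOpen φ.range hφ.isOpen_range, hφ.isOpen_range⟩

/-- Pointwise multiplication by the indicator function of a clopen set. -/
def PreL2.cut {U : Set G} (hU : IsClopen U) (ξ : PreL2 A μ) : PreL2 A μ :=
  PreL2.mk (U.indicator ξ) (ξ.continuous.indicator (by simp [hU.frontier_eq]))
    (ξ.hasCompactSupport.mono (Set.support_indicator.trans_subset Set.inter_subset_right))

theorem PreL2.cut_apply {U : Set G} (hU : IsClopen U) (ξ : PreL2 A μ) (y : G) :
    cut hU ξ y = U.indicator ξ y := rfl

/-- An open subgroup is also closed, so restriction to it preserves compactness of the support. -/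
theorem PreL2.exists_extend_eq {φ : H →* G} (hφ : IsOpenEmbedding φ) {ξ : PreL2 A μ}
    (hξ : ∀ y ∉ Set.range φ, ξ y = 0) : ∃ η : PreL2 A μH, extend μ hφ η = ξ := by
  have hc : IsClosedEmbedding φ := ⟨hφ.isEmbedding, (isClopen_range hφ).1⟩
  refine ⟨mk (ξ ∘ φ) (ξ.continuous.comp hφ.continuous)
    (ξ.hasCompactSupport.comp_isClosedEmbedding hc), ext_of_range (φ := φ) (fun h => ?_)
      (fun y hy => extend_apply_of_notMem hφ _ hy) hξ⟩
  rw [extend_apply]; rfl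

/-- The right translates of the functions supported on an open subgroup are total. -/
theorem coe_mem_span_right_extend (α : Action G A) {φ : H →* G} (hφ : IsOpenEmbedding φ)
    (hμ : μH = μ.comap φ) (ξ : PreL2 A μ) :
    (ξ : L2 A μ) ∈ Submodule.span ℂ
      (Set.range fun p : G × L2 A μH => rightOp μ α p.1 (extendOp A hφ hμ p.2)) := by
  set S := Submodule.span ℂ
    (Set.range fun p : G × L2 A μH => rightOp μ α p.1 (extendOp A hφ hμ p.2))
  -- Induction on the number of right cosets of the subgroup that cover the points where the
  -- function is nonzero. Cosets are clopen, so cutting along one of them keeps continuity.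
  have key : ∀ (t : Finset G) (ξ : PreL2 A μ),
      (∀ y, ξ y ≠ 0 → ∃ x ∈ t, y * x⁻¹ ∈ Set.range φ) → (ξ : L2 A μ) ∈ S := by
    classical
    intro t
    induction t using Finset.induction_on with
    | empty =>
      intro ξ h
      have : ξ = 0 := PreL2.ext fun y => by
        by_contra hy
        simpa using h y hy
      rw [this, Completion.coe_zero]
      exact zero_mem S
    | insert x t _ ih =>
      intro ξ h
      have hU : IsClopen ((· * x⁻¹) ⁻¹' Set.range φ : Set G) :=
        (isClopen_range hφ).preimage (continuous_mul_const x⁻¹)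
      have hsum : ξ = PreL2.cut hU ξ + PreL2.cut hU.compl ξ := PreL2.ext fun y =>
        (congrFun (Set.indicator_self_add_compl _ ξ) y).symm
      rw [hsum, Completion.coe_add]
      refine add_mem ?_ (ih _ fun y hy => ?_)
      -- Right translation by `x⁻¹` moves the piece living on the coset of `x` onto the subgroup;
      -- translation by `x` brings it back.
      · obtain ⟨η, hη⟩ := PreL2.exists_extend_eq (μH := μH) hφ
          (ξ := PreL2.right α x⁻¹ (PreL2.cut hU ξ)) fun y hy => by
            rw [PreL2.right_apply, PreL2.cut_apply, Set.indicator_of_notMem, map_zero]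
            simpa using hy
        refine Submodule.subset_span ⟨(x, (η : L2 A μH)), ?_⟩
        simp only [extendOp_coe, rightOp_coe]
        rw [hη, PreL2.right_right_inv]
      · rw [PreL2.cut_apply] at hy
        have hyU := Set.mem_of_indicator_ne_zero hy
        rw [Set.indicator_of_mem hyU] at hy
        obtain ⟨z, hz, hz'⟩ := h y hy
        rcases Finset.mem_insert.1 hz with rfl | hz
        · exact absurd hz' hyU
        · exact ⟨z, hz, hz'⟩
  obtain ⟨t, ht⟩ := ξ.hasCompactSupport.isCompact.elim_finite_subcover
    (fun x : G => (· * x⁻¹) ⁻¹' Set.range φ)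
    (fun x => hφ.isOpen_range.preimage (continuous_mul_const x⁻¹))
    (fun y _ => Set.mem_iUnion.2 ⟨y, 1, by simp⟩)
  refine key t ξ fun y hy => ?_
  simpa using ht (subset_tsupport _ hy)

/-- `T'` restricts to `T` on `L²(H) ⊗ A`, and commutes with the right translations. -/
def Intertwines (α : Action G A) {φ : H → G} (hφ : IsOpenEmbedding φ) (hμ : μH = μ.comap φ)
    (T : Adjointable A μH) (T' : Adjointable A μ) : Prop :=
  (∀ x, T' (extendOp A hφ hμ x) = extendOp A hφ hμ (T x)) ∧
    ∀ g x, T' (rightOp μ α g x) = rightOp μ α g (T' x)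

namespace Intertwines

variable {α : Action G A}

theorem add {φ : H → G} {hφ : IsOpenEmbedding φ} {hμ : μH = μ.comap φ}
    {T S : Adjointable A μH} {T' S' : Adjointable A μ} (h : Intertwines α hφ hμ T T')
    (k : Intertwines α hφ hμ S S') : Intertwines α hφ hμ (T + S) (T' + S') :=
  ⟨fun x => by simp [h.1, k.1], fun g x => by simp [h.2, k.2]⟩

theorem mul {φ : H → G} {hφ : IsOpenEmbedding φ} {hμ : μH = μ.comap φ}
    {T S : Adjointable A μH} {T' S' : Adjointable A μ} (h : Intertwines α hφ hμ T T')
    (k : Intertwines α hφ hμ S S') : Intertwines α hφ hμ (T * S) (T' * S') :=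
  ⟨fun x => by simp [h.1, k.1], fun g x => by simp [h.2, k.2]⟩

theorem smul {φ : H → G} {hφ : IsOpenEmbedding φ} {hμ : μH = μ.comap φ}
    {T : Adjointable A μH} {T' : Adjointable A μ} (h : Intertwines α hφ hμ T T')
    (c : ℂ) : Intertwines α hφ hμ (c • T) (c • T') :=
  ⟨fun x => by simp [h.1], fun g x => by simp [h.2]⟩

theorem zero {φ : H → G} {hφ : IsOpenEmbedding φ} {hμ : μH = μ.comap φ} :
    Intertwines α hφ hμ (0 : Adjointable A μH) (0 : Adjointable A μ) :=
  ⟨fun _ => (map_zero _).symm, fun _ _ => (map_zero _).symm⟩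

theorem left_eq_zero {φ : H → G} {hφ : IsOpenEmbedding φ} {hμ : μH = μ.comap φ}
    {T : Adjointable A μH} (h : Intertwines α hφ hμ T 0) : T = 0 := by
  refine Adjointable.ext fun x => ?_
  exact norm_eq_zero.1 ((norm_extendOp hφ hμ _).symm.trans (norm_eq_zero.2 (h.1 x).symm))

/-- If `T = 0`, then `T'` kills the range of `V`; commuting with right translations, it kills all
translates of that range, and these are total. -/
theorem right_eq_zero {φ : H →* G} {hφ : IsOpenEmbedding φ} {hμ : μH = μ.comap φ}
    {T' : Adjointable A μ} (h : Intertwines α hφ hμ 0 T') : T' = 0 := by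
  refine Adjointable.ext fun x => ?_
  change T'.toCLM x = 0
  induction x using Completion.induction_on with
  | hp => exact isClosed_eq (by fun_prop) (by fun_prop)
  | ih ξ =>
    have hle : Submodule.span ℂ (Set.range fun p : G × L2 A μH =>
        rightOp μ α p.1 (extendOp A hφ hμ p.2)) ≤ LinearMap.ker T'.toCLM.toLinearMap := by
      rw [Submodule.span_le]
      rintro _ ⟨⟨g, x⟩, rfl⟩
      refine (h.2 g _).trans ?_
      rw [h.1]
      exact (congrArg _ (map_zero _)).trans (map_zero _)
    exact hle (coe_mem_span_right_extend α hφ hμ ξ)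

theorem regularRep {φ : H →* G} (hφ : IsOpenEmbedding φ) (hμ : μH = μ.comap φ)
    {αH : Action H A} (hα : ∀ h a, αH.aut h a = α.aut (φ h) a) (f : C_c(H, A)) :
    Intertwines α hφ hμ (regularRep αH μH f) (regularRep α μ (extendByZero φ hφ f)) := by
  refine ⟨fun x => ?_, fun g x => ?_⟩
  · rw [regularRep_apply, regularRep_apply, integral_comap_of_support_subset hφ hμ,
      ← (extendOp A hφ hμ).integral_comp_comm (integrable_regularRep αH f x)]
    · simp only [extendByZero_apply, extendOp_regπ hφ hμ hα, extendOp_regU]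
    · intro y hy
      rw [extendByZero_apply_of_notMem hφ f hy, regπ_zero]; rfl
  · rw [regularRep_apply, regularRep_apply,
      ← (rightOp μ α g).integral_comp_comm (integrable_regularRep α _ x)]
    simp only [rightOp_regU, rightOp_regπ]

/-- Taking adjoints in `T' V = V T` only gives a relation for the adjoint of `V`, and the right
translations need not be adjointable. The relation for `λ(f)*` is therefore checked separately, from
the formula for the adjoint. -/
theorem star_regularRep {φ : H →* G} (hφ : IsOpenEmbedding φ) (hμ : μH = μ.comap φ)
    {αH : Action H A} (hα : ∀ h a, αH.aut h a = α.aut (φ h) a) (f : C_c(H, A)) :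
    Intertwines α hφ hμ (star (CrossedProduct.regularRep αH μH f))
      (star (CrossedProduct.regularRep α μ (extendByZero φ hφ f))) := by
  refine ⟨fun x => ?_, fun g x => ?_⟩
  · rw [star_regularRep_apply, star_regularRep_apply, integral_comap_of_support_subset hφ hμ,
      ← (extendOp A hφ hμ).integral_comp_comm (integrable_star_regularRep αH f x)]
    · simp only [extendByZero_apply, extendOp_regπ hφ hμ hα, extendOp_regU, map_inv]
    · intro y hy
      rw [extendByZero_apply_of_notMem hφ f hy, star_zero, regπ_zero]
      exact map_zero _
  · rw [star_regularRep_apply, star_regularRep_apply,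
      ← (rightOp μ α g).integral_comp_comm (integrable_star_regularRep α _ x)]
    simp only [rightOp_regU, rightOp_regπ]

theorem isClosed_setOf {φ : H → G} (hφ : IsOpenEmbedding φ) (hμ : μH = μ.comap φ) :
    IsClosed {p : Adjointable A μH × Adjointable A μ | Intertwines α hφ hμ p.1 p.2} := by
  have h1 : ∀ x, Continuous fun T : Adjointable A μH => T x := Adjointable.continuous_apply
  have h2 : ∀ x, Continuous fun T : Adjointable A μ => T x := Adjointable.continuous_apply
  simp only [Intertwines, Set.ofPred_and, Set.ofPred_forall]
  refine IsClosed.inter (isClosed_iInter fun x => isClosed_eq ((h2 _).comp continuous_snd)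
    ((extendOp A hφ hμ).continuous.comp ((h1 x).comp continuous_fst)))
    (isClosed_iInter fun g => isClosed_iInter fun x => isClosed_eq ((h2 _).comp continuous_snd)
      ((rightOp μ α g).continuous.comp ((h2 x).comp continuous_snd)))

end Intertwines

/-- The pairs of elements of `A ⋊_r H` and `A ⋊_r G` that are intertwined together with their
adjoints. -/
def intertwiningSubalgebra (αH : Action H A) (α : Action G A) {φ : H → G}
    (hφ : IsOpenEmbedding φ) (hμ : μH = μ.comap φ) :
    NonUnitalStarSubalgebra ℂ (ReducedCrossedProduct αH μH × ReducedCrossedProduct α μ) where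
  carrier := {p | Intertwines α hφ hμ (ReducedCrossedProduct.incl αH μH p.1)
      (ReducedCrossedProduct.incl α μ p.2) ∧
    Intertwines α hφ hμ (star (ReducedCrossedProduct.incl αH μH p.1))
      (star (ReducedCrossedProduct.incl α μ p.2))}
  add_mem' := fun {p q} hp hq => by
    simp only [Set.mem_ofPred_eq, Prod.fst_add, Prod.snd_add, map_add, star_add]
    exact ⟨hp.1.add hq.1, hp.2.add hq.2⟩
  mul_mem' := fun {p q} hp hq => by
    simp only [Set.mem_ofPred_eq, Prod.fst_mul, Prod.snd_mul, map_mul, star_mul]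
    exact ⟨hp.1.mul hq.1, hq.2.mul hp.2⟩
  zero_mem' := by
    simp only [Set.mem_ofPred_eq, Prod.fst_zero, Prod.snd_zero, map_zero, star_zero]
    exact ⟨Intertwines.zero, Intertwines.zero⟩
  smul_mem' := fun c p hp => by
    simp only [Set.mem_ofPred_eq, Prod.smul_fst, Prod.smul_snd, map_smul, star_smul]
    exact ⟨hp.1.smul c, hp.2.smul _⟩
  star_mem' := fun {p} hp => by
    simp only [Set.mem_ofPred_eq, Prod.fst_star, Prod.snd_star, map_star, star_star]
    exact ⟨hp.2, hp.1⟩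

/-- Extension by zero induces an isometric inclusion of reduced crossed products. -/
theorem exists_isInducedByExtension {φ : H →* G} (hφ : IsOpenEmbedding φ) (hμ : μH = μ.comap φ)
    {αH : Action H A} {α : Action G A} (hα : ∀ h a, αH.aut h a = α.aut (φ h) a) :
    ∃ ψ : ReducedCrossedProduct αH μH →⋆ₙₐ[ℂ] ReducedCrossedProduct α μ,
      IsInducedByExtension φ hφ ψ ∧ Isometry ψ := by
  let Γ := intertwiningSubalgebra αH α hφ hμ
  have hincl : Continuous fun p : ReducedCrossedProduct αH μH × ReducedCrossedProduct α μ =>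
      (ReducedCrossedProduct.incl αH μH p.1, ReducedCrossedProduct.incl α μ p.2) :=
    ((ReducedCrossedProduct.isometry_incl αH).continuous.comp continuous_fst).prodMk
      ((ReducedCrossedProduct.isometry_incl α).continuous.comp continuous_snd)
  have hclosed :
      IsClosed (Γ : Set (ReducedCrossedProduct αH μH × ReducedCrossedProduct α μ)) :=
    ((Intertwines.isClosed_setOf hφ hμ).preimage hincl).inter
      ((Intertwines.isClosed_setOf hφ hμ).preimage (continuous_star.comp hincl))
  have hgen : ∀ f, (ReducedCrossedProduct.ofCc αH μH f,
      ReducedCrossedProduct.ofCc α μ (extendByZero φ hφ f)) ∈ Γ := fun f =>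
    ⟨Intertwines.regularRep hφ hμ hα f, Intertwines.star_regularRep hφ hμ hα f⟩
  -- The two vanishing statements play dual roles: `right_eq_zero` makes Γ a graph over `A ⋊_r H`,
  -- and `left_eq_zero` makes the resulting homomorphism injective.
  have hinj : ∀ b, ((0 : ReducedCrossedProduct αH μH), b) ∈ Γ → b = 0 := fun b hb =>
    (ReducedCrossedProduct.isometry_incl α).injective
      (Intertwines.right_eq_zero (hφ := hφ) (hμ := hμ) (by simpa using hb.1))
  obtain ⟨ψ, hψ⟩ := exists_starHom_of_graph Γ hclosed hinj
    ((ReducedCrossedProduct.dense_of_ofCc_mem (Γ.map (NonUnitalStarAlgHom.fst ℂ _ _))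
      fun f => ⟨_, hgen f, rfl⟩).mono (by
        rintro _ ⟨p, hp, rfl⟩
        exact ⟨p.2, hp⟩))
  refine ⟨ψ, fun f => ?_, NonUnitalStarAlgHom.isometry ψ
    ((injective_iff_map_eq_zero ψ).2 fun y hy => ?_)⟩
  · have h := sub_mem (hψ (ReducedCrossedProduct.ofCc αH μH f)) (hgen f)
    rw [Prod.mk_sub_mk, sub_self] at h
    exact sub_eq_zero.1 (hinj _ h)
  · have h := hψ y
    rw [hy] at h
    exact (ReducedCrossedProduct.isometry_incl αH).injective
      (Intertwines.left_eq_zero (hφ := hφ) (hμ := hμ) (by simpa using h.1))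

theorem IsInducedByExtension.unique {φ : H →* G} {hφ : IsOpenEmbedding φ}
    {αH : Action H A} {α : Action G A}
    {ψ ψ' : ReducedCrossedProduct αH μH →⋆ₙₐ[ℂ] ReducedCrossedProduct α μ}
    (h : IsInducedByExtension φ hφ ψ) (h' : IsInducedByExtension φ hφ ψ') : ψ = ψ' :=
  ReducedCrossedProduct.hom_ext_ofCc fun f => (h f).trans (h' f).symm

end Inclusion

end CrossedProduct

end

/-! ### Perturbation of projections, partial isometries and unitaries. -/

noncomputable section

namespace CStarPerturbation

variable {D : Type u} [CStarAlgebra D]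

/-- By the C⋆-identity it is enough that `(v - p v)(v - p v)*` vanishes, and this expands to `p - p
- p + p`. -/
theorem mul_eq_self_of_mul_star_eq {p v : D} (hp : IsStarProjection p) (h : v * star v = p) :
    p * v = v := by
  have h1 : (v - p * v) * star (v - p * v) = 0 := by
    rw [star_sub, star_mul, hp.isSelfAdjoint.star_eq]
    have e : (v - p * v) * (star v - star v * p) =
        v * star v - v * star v * p - p * (v * star v) + p * (v * star v) * p := by noncomm_ring
    rw [e, h, hp.isIdempotentElem.eq, hp.isIdempotentElem.eq]
    abel
  exact (sub_eq_zero.1 ((CStarRing.mul_star_self_eq_zero_iff _).1 h1)).symm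

theorem mul_eq_self_of_star_mul_eq {p v : D} (hp : IsStarProjection p) (h : star v * v = p) :
    v * p = v := by
  have := mul_eq_self_of_mul_star_eq (v := star v) hp (by rwa [star_star])
  simpa [hp.isSelfAdjoint.star_eq] using congrArg star this

theorem isSelfAdjoint_corner {q c : D} (hq : IsStarProjection q) :
    IsSelfAdjoint (star c * c + (1 - q)) :=
  (IsSelfAdjoint.star_mul_self c).add ((IsSelfAdjoint.one D).sub hq.isSelfAdjoint)

theorem abs_sub_one_le_of_mem_spectrum {d : D} (hd : IsSelfAdjoint d) {x : ℝ}
    (hx : x ∈ spectrum ℝ d) : |x - 1| ≤ ‖d - 1‖ := by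
  have h := norm_apply_le_norm_cfc (fun x : ℝ => x - 1) d hx
  have h2 : cfc (fun x : ℝ => x - 1) d = d - 1 := by
    rw [cfc_sub (fun x : ℝ => x) (fun _ => 1) d, cfc_id' ℝ d, cfc_const_one ℝ d]
  rwa [h2] at h

/-- An almost partial isometry between two projections is close to a partial isometry between
them: its polar part. -/
theorem exists_partialIsometry_near {p q c : D} (hp : IsStarProjection p) (hq : IsStarProjection q)
    (hpc : p * c = c) (hcq : c * q = c) (h1 : ‖c * star c - p‖ < 1) (h2 : ‖star c * c - q‖ < 1) :
    ∃ v : D, v * star v = p ∧ star v * v = q ∧ ‖v - c‖ ≤ ‖star c * c - q‖ := by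
  -- Since `c q = c`, the element `c* c` lies in the corner of `q`. Adding `1 - q` makes it
  -- invertible in the whole algebra, with spectrum within `‖c* c - q‖ < 1` of `1`. The partial
  -- isometry will be `c d^(-1/2)`.
  set d := star c * c + (1 - q) with hd
  have hdsa : IsSelfAdjoint d := isSelfAdjoint_corner hq
  have hd1 : d - 1 = star c * c - q := by rw [hd]; abel
  have hpos : ∀ x ∈ spectrum ℝ d, 0 < x := fun x hx => by
    have := abs_sub_one_le_of_mem_spectrum hdsa hx
    rw [hd1] at this
    linarith [(abs_lt.1 (this.trans_lt h2)).1]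
  have hsqrt : ∀ x ∈ spectrum ℝ d, Real.sqrt x ≠ 0 := fun x hx => (Real.sqrt_pos.2 (hpos x hx)).ne'
  have hcont : ContinuousOn (fun x : ℝ => (Real.sqrt x)⁻¹) (spectrum ℝ d) :=
    Real.continuous_sqrt.continuousOn.inv₀ hsqrt
  set h := cfc (fun x : ℝ => (Real.sqrt x)⁻¹) d with hh
  set k := cfc (fun x : ℝ => Real.sqrt x) d with hk
  have hhsa : star h = h := (cfc_predicate (fun x : ℝ => (Real.sqrt x)⁻¹) d : IsSelfAdjoint h)
  have hhd : h * d * h = 1 := by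
    have : d = cfc (fun x : ℝ => x) d := (cfc_id' ℝ d).symm
    nth_rw 1 [this]
    rw [hh, ← cfc_mul _ _ d hcont, 
      ← cfc_mul (fun x : ℝ => (Real.sqrt x)⁻¹ * x) _ d (hcont.mul continuousOn_id) hcont,
      ← cfc_const_one ℝ d]
    refine cfc_congr fun x hx => ?_
    have := Real.mul_self_sqrt (hpos x hx).le
    have h3 := hsqrt x hx
    field_simp
    linarith
  have hhk : h * k = 1 := by
    rw [hh, hk, ← cfc_mul _ _ d hcont, ← cfc_const_one ℝ d]
    exact cfc_congr fun x hx => inv_mul_cancel₀ (hsqrt x hx)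
  have hkd : ‖1 - k‖ ≤ ‖star c * c - q‖ := by
    have e : 1 - k = cfc (fun x : ℝ => 1 - Real.sqrt x) d := by
      rw [cfc_sub (fun _ => 1) (fun x : ℝ => Real.sqrt x) d, cfc_const_one ℝ d]
    rw [e]
    refine norm_cfc_le (norm_nonneg _) fun x hx => ?_
    have h3 := abs_sub_one_le_of_mem_spectrum hdsa hx
    rw [hd1] at h3
    refine le_trans ?_ h3
    have h4 := Real.mul_self_sqrt (hpos x hx).le
    -- The factor `√x + 1` is at least `1`, whence `|1 - √x| ≤ |x - 1|`.
    have h5 : x - 1 = (Real.sqrt x - 1) * (Real.sqrt x + 1) := by linarith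
    rw [Real.norm_eq_abs, abs_sub_comm, h5, abs_mul]
    refine le_mul_of_one_le_right (abs_nonneg _) ?_
    rw [abs_of_pos (by positivity)]
    linarith [Real.sqrt_nonneg x]
  have hqc : q * star c = star c := by
    simpa [hq.isSelfAdjoint.star_eq] using congrArg star hcq
  have hqq := hq.isIdempotentElem.eq
  have hdq : d * (1 - q) = 1 - q := by
    have e : d * (1 - q) = star c * (c - c * q) + (1 - q - q + q * q) := by rw [hd]; noncomm_ring
    rw [e, hcq, hqq, sub_self, mul_zero]; abel
  have hqd : (1 - q) * d = 1 - q := by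
    have e : (1 - q) * d = (star c - q * star c) * c + (1 - q - q + q * q) := by
      rw [hd]; noncomm_ring
    rw [e, hqc, hqq, sub_self, zero_mul]; abel
  have hcomm : Commute h (1 - q) := Commute.cfc_real (hdq.trans hqd.symm) _
  have hcomm' : Commute h d := Commute.cfc_real (Commute.refl d) _
  have hhq : h * (1 - q) * h = 1 - q := by
    calc h * (1 - q) * h = (1 - q) * d * h * h := by rw [hqd, hcomm.eq]
      _ = (1 - q) * (h * d * h) := by rw [hcomm'.eq]; noncomm_ring
      _ = 1 - q := by rw [hhd, mul_one]
  have hvq : star (c * h) * (c * h) = q := by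
    have e : star (c * h) * (c * h) = h * d * h - h * (1 - q) * h := by
      rw [star_mul, hhsa, hd]; noncomm_ring
    rw [e, hhd, hhq]; abel
  -- With `v = c h` and `c = v k`, the identity `v v* v = v` gives `v v* c = c`.
  have hce : c * h * star (c * h) * (c * star c) = c * star c := by
    have e : c = c * h * k := by rw [mul_assoc, hhk, mul_one]
    have e2 : c * h * star (c * h) * (c * h) = c * h := by
      rw [mul_assoc, hvq]
      exact mul_eq_self_of_star_mul_eq hq hvq
    rw [← mul_assoc]
    congr 1
    nth_rw 3 [e]
    rw [← mul_assoc, e2, ← e]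
  have hvp : c * h * star (c * h) = p := by
    set e := c * h * star (c * h) with he
    have hep : e * p = e := by
      have : star c * p = star c := by
        simpa [hp.isSelfAdjoint.star_eq] using congrArg star hpc
      rw [he, star_mul]
      simp only [mul_assoc, this]
    -- Both `p` and `e = v v*` fix `c c*`, so `(p - e) c c* = 0`, while `(p - e) p = p - e`. As `‖c
    -- c* - p‖ < 1`, this forces `p = e`.
    have h3 : (p - e) = -((p - e) * (c * star c - p)) := by
      have e' : (p - e) * (c * star c - p) =
        p * c * star c - e * (c * star c) - p * p + e * p := by noncomm_ring
      rw [e', hce, hpc, hp.isIdempotentElem.eq, hep]; abel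
    have h4 : ‖p - e‖ ≤ ‖p - e‖ * ‖c * star c - p‖ := by
      calc ‖p - e‖ = ‖(p - e) * (c * star c - p)‖ := by rw [← norm_neg (_ * _), ← h3]
        _ ≤ _ := norm_mul_le _ _
    have h5 : ‖p - e‖ = 0 := by
      by_contra hne
      have : 0 < ‖p - e‖ := lt_of_le_of_ne (norm_nonneg _) (Ne.symm hne)
      nlinarith
    exact (sub_eq_zero.1 (norm_eq_zero.1 h5)).symm
  refine ⟨c * h, hvp, hvq, ?_⟩
  have hv1 : ‖c * h‖ ≤ 1 := by
    have h3 : ‖c * h‖ * ‖c * h‖ ≤ 1 := by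
      rw [← CStarRing.norm_star_mul_self, hvq]
      exact hq.norm_le
    nlinarith [norm_nonneg (c * h)]
  calc ‖c * h - c‖ = ‖c * h * (1 - k)‖ := by rw [mul_sub, mul_one, mul_assoc, hhk, mul_one]
    _ ≤ ‖c * h‖ * ‖1 - k‖ := norm_mul_le _ _
    _ ≤ 1 * ‖star c * c - q‖ := by gcongr
    _ = _ := one_mul _

/-- Close projections are Murray–von Neumann equivalent. -/
theorem exists_partialIsometry_of_norm_sub_lt {p q : D} (hp : IsStarProjection p)
    (hq : IsStarProjection q) (h : ‖p - q‖ < 1) :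
    ∃ v : D, v * star v = p ∧ star v * v = q := by
  have key : ∀ {p q : D}, IsStarProjection p → IsStarProjection q → ‖p - q‖ < 1 →
      ‖p * q * p - p‖ < 1 := by
    intro p q hp hq h
    have e : p * q * p - p = -(p * (p - q) * p) := by
      rw [mul_sub, sub_mul, hp.isIdempotentElem.eq, hp.isIdempotentElem.eq]; abel
    rw [e, norm_neg]
    calc ‖p * (p - q) * p‖ ≤ ‖p‖ * ‖p - q‖ * ‖p‖ := norm_mul₃_le
      _ ≤ 1 * ‖p - q‖ * 1 := by gcongr <;> exact hp.norm_le
      _ < 1 := by simpa using h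
  -- The product `p q` is almost a partial isometry: `c c* = p q p` and `c* c = q p q` differ from
  -- `p` and `q` by compressions of `p - q`.
  obtain ⟨v, h1, h2, -⟩ := exists_partialIsometry_near (c := p * q) hp hq
    (by rw [← mul_assoc, hp.isIdempotentElem.eq]) (by rw [mul_assoc, hq.isIdempotentElem.eq])
    (by
      rw [star_mul, hp.isSelfAdjoint.star_eq, hq.isSelfAdjoint.star_eq]
      have e : p * q * (q * p) = p * (q * q) * p := by noncomm_ring
      rw [e, hq.isIdempotentElem.eq]
      exact key hp hq h)
    (by
      rw [star_mul, hp.isSelfAdjoint.star_eq, hq.isSelfAdjoint.star_eq]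
      have e : q * p * (p * q) = q * (p * p) * q := by noncomm_ring
      rw [e, hp.isIdempotentElem.eq]
      exact key hq hp (by rwa [norm_sub_rev]))
  exact ⟨v, h1, h2⟩

/-- An almost idempotent selfadjoint element is close to a projection. -/
theorem exists_isStarProjection_near {a : D} (ha : IsSelfAdjoint a) (h : ‖a * a - a‖ < 1 / 4) :
    ∃ q : D, IsStarProjection q ∧ ‖q - a‖ ≤ 1 / 2 := by
  have hspec : ∀ x ∈ spectrum ℝ a, |x * x - x| < 1 / 4 := fun x hx => by
    have h1 := norm_apply_le_norm_cfc (fun x : ℝ => x * x - x) a hx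
    have h2 : cfc (fun x : ℝ => x * x - x) a = a * a - a := by
      rw [cfc_sub (fun x : ℝ => x * x) (fun x => x) a, cfc_mul (fun x : ℝ => x) (fun x => x) a,
        cfc_id' ℝ a]
    rw [h2] at h1
    exact h1.trans_lt h
  -- At `x = 1/2` one has `|x² - x| = 1/4`, which the hypothesis excludes from the spectrum; so the
  -- jump of `g` is off the spectrum and `g(a)` is a projection.
  let g : ℝ → ℝ := Set.indicator (Set.Ioi (1 / 2)) 1
  have hg : ∀ x, g x = if 1 / 2 < x then 1 else 0 := fun x => by
    simp [g, Set.indicator_apply]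
  have hne : ∀ x ∈ spectrum ℝ a, x ≠ 1 / 2 := by
    rintro x hx rfl
    have := hspec _ hx
    norm_num [abs_lt] at this
  have hcont : ContinuousOn g (spectrum ℝ a) := by
    intro x hx
    refine ContinuousAt.continuousWithinAt ?_
    refine ContinuousOn.continuousAt_indicator continuousOn_const ?_
    rw [frontier_Ioi]
    exact hne x hx
  refine ⟨cfc g a, ⟨?_, cfc_predicate g a⟩, ?_⟩
  · rw [IsIdempotentElem, ← cfc_mul g g a hcont hcont]
    refine cfc_congr fun x _ => ?_
    simp only [hg]
    split_ifs <;> simp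
  · have e : cfc g a - a = cfc (fun x => g x - x) a := by
      rw [cfc_sub g (fun x => x) a hcont, cfc_id' ℝ a]
    rw [e]
    refine norm_cfc_le (by norm_num) fun x hx => ?_
    have h1 := abs_lt.1 (hspec x hx)
    rw [hg, Real.norm_eq_abs, abs_le]
    split_ifs with h2
    · constructor <;> nlinarith
    · have h3 := not_lt.1 h2
      constructor <;> nlinarith

/-- The C⋆-algebras `X n` embed compatibly into `Y`, with dense union. -/
structure IsDenseSystem {X : ℕ → Type u} [∀ n, CStarAlgebra (X n)]
    (f : ∀ m n, m ≤ n → (X m →⋆ₐ[ℂ] X n)) {Y : Type v} [CStarAlgebra Y]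
    (κ : ∀ n, X n →⋆ₐ[ℂ] Y) : Prop where
  compat : ∀ {m n} (h : m ≤ n) x, κ n (f m n h x) = κ m x
  injective : ∀ n, Function.Injective (κ n)
  dense : Dense (⋃ n, Set.range (κ n))

namespace IsDenseSystem

variable {X : ℕ → Type u} [∀ n, CStarAlgebra (X n)] {f : ∀ m n, m ≤ n → (X m →⋆ₐ[ℂ] X n)}
  {Y : Type v} [CStarAlgebra Y] {κ : ∀ n, X n →⋆ₐ[ℂ] Y} (hX : IsDenseSystem f κ)

include hX

theorem norm_map {n : ℕ} (x : X n) : ‖κ n x‖ = ‖x‖ :=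
  NonUnitalStarAlgHom.norm_map (κ n) (hX.injective n) x

/-- The device behind every descent below: an approximate relation is an open condition on `Y`, so
once an element of `Y` satisfies it, an element of some stage beyond `n` does too. Because the `κ m`
are isometric, the estimate can then be read in `X m`. -/
theorem exists_mem_of_isOpen {U : Set Y} (hU : IsOpen U) {y : Y} (hy : y ∈ U) (n : ℕ) :
    ∃ m, n ≤ m ∧ ∃ x : X m, κ m x ∈ U := by
  obtain ⟨z, hzU, hz⟩ := hX.dense.inter_open_nonempty U hU ⟨y, hy⟩
  obtain ⟨m, x, rfl⟩ := Set.mem_iUnion.1 hz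
  exact ⟨max n m, le_max_left _ _, f m _ (le_max_right n m) x, by rwa [hX.compat]⟩

/-- Every projection of the limit is equivalent to one of a finite stage. -/
theorem exists_isStarProjection_equivalent {p : Y} (hp : IsStarProjection p) :
    ∃ n, ∃ q : X n, IsStarProjection q ∧ ∃ v, v * star v = p ∧ star v * v = κ n q := by
  -- An approximant from a finite stage need not be selfadjoint; its real part is, and `s` fixes
  -- `p`.
  let s : Y → Y := fun y => (1 / 2 : ℂ) • (y + star y)
  have hs : Continuous s := by fun_prop
  have hsp : s p = p := by
    simp only [s, hp.isSelfAdjoint.star_eq]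
    rw [← two_smul ℂ p, smul_smul]; norm_num
  obtain ⟨n, -, x, hx1, hx2⟩ := hX.exists_mem_of_isOpen
    (U := {y | ‖s y * s y - s y‖ < 1 / 4} ∩ {y | ‖s y - p‖ < 1 / 2})
    ((isOpen_lt (by fun_prop) continuous_const).inter (isOpen_lt (by fun_prop) continuous_const))
    (y := p) ⟨by simp [hsp, hp.isIdempotentElem.eq], by simp [hsp]⟩ 0
  let a : X n := (1 / 2 : ℂ) • (x + star x)
  have ha : κ n a = s (κ n x) := by simp [a, s, map_star]
  have hasa : IsSelfAdjoint a := by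
    rw [IsSelfAdjoint]
    simp [a, add_comm]
  obtain ⟨q, hq, hqa⟩ := exists_isStarProjection_near hasa (by
    rw [← hX.norm_map, map_sub, map_mul, ha]; exact hx1)
  refine ⟨n, q, hq, exists_partialIsometry_of_norm_sub_lt hp (hq.map (κ n)) ?_⟩
  rw [norm_sub_rev]
  calc ‖κ n q - p‖ = ‖κ n (q - a) + (s (κ n x) - p)‖ := by rw [map_sub, ha]; congr 1; abel
    _ ≤ ‖κ n (q - a)‖ + ‖s (κ n x) - p‖ := norm_add_le _ _
    _ < 1 / 2 + 1 / 2 := by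
      rw [hX.norm_map]
      exact add_lt_add_of_le_of_lt hqa hx2
    _ = 1 := by norm_num

/-- Projections of a finite stage that are equivalent in the limit are equivalent at some finite
stage. -/
theorem exists_partialIsometry {n : ℕ} {p q : X n} (hp : IsStarProjection p)
    (hq : IsStarProjection q) {v : Y} (h1 : v * star v = κ n p) (h2 : star v * v = κ n q) :
    ∃ m, ∃ h : n ≤ m, ∃ w : X m, w * star w = f n m h p ∧ star w * w = f n m h q := by
  -- Compressing by `p` and `q` makes the approximant satisfy `p c = c = c q` exactly, as the
  -- correction to a partial isometry requires; `v` itself is fixed.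
  let c : Y → Y := fun y => κ n p * y * κ n q
  have hc : Continuous c := by fun_prop
  have hcv : c v = v := by
    simp only [c]
    rw [mul_eq_self_of_mul_star_eq (hp.map (κ n)) h1, mul_eq_self_of_star_mul_eq (hq.map (κ n)) h2]
  obtain ⟨m, hm, b, hb1, hb2⟩ := hX.exists_mem_of_isOpen
    (U := {y | ‖c y * star (c y) - κ n p‖ < 1} ∩ {y | ‖star (c y) * c y - κ n q‖ < 1})
    ((isOpen_lt (by fun_prop) continuous_const).inter (isOpen_lt (by fun_prop) continuous_const))
    (y := v) ⟨by simp [hcv, h1], by simp [hcv, h2]⟩ n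
  have hp' := hp.map (f n m hm)
  have hq' := hq.map (f n m hm)
  have hκ : κ m (f n m hm p * b * f n m hm q) = c (κ m b) := by
    simp [c, hX.compat]
  obtain ⟨w, hw1, hw2, -⟩ := exists_partialIsometry_near (c := f n m hm p * b * f n m hm q) hp' hq'
    (by rw [← mul_assoc, ← mul_assoc, hp'.isIdempotentElem.eq])
    (by rw [mul_assoc, hq'.isIdempotentElem.eq])
    (by rw [← hX.norm_map, map_sub, map_mul, map_star, hκ, hX.compat]; exact hb1)
    (by rw [← hX.norm_map, map_sub, map_mul, map_star, hκ, hX.compat]; exact hb2)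
  exact ⟨m, hm, w, hw1, hw2⟩

/-- Every unitary of the limit is close to one of a finite stage. -/
theorem exists_unitary_near {u : Y} (hu : u ∈ unitary Y) :
    ∃ n, ∃ w ∈ unitary (X n), ‖κ n w - u‖ < 1 / 2 := by
  obtain ⟨n, -, c, ⟨hc1, hc2⟩, hc3⟩ := hX.exists_mem_of_isOpen
    -- The polar part moves `c` by at most `‖c* c - 1‖ < 1/4`, which together with `‖c - u‖ < 1/4`
    -- gives the distance `1/2`.
    (U := ({y | ‖y * star y - 1‖ < 1} ∩ {y | ‖star y * y - 1‖ < 1 / 4}) ∩ {y | ‖y - u‖ < 1 / 4})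
    (((isOpen_lt (by fun_prop) continuous_const).inter
      (isOpen_lt (by fun_prop) continuous_const)).inter (isOpen_lt (by fun_prop) continuous_const))
    (y := u) ⟨⟨by simp [hu.2], by simp [hu.1]⟩, by simp⟩ 0
  have hc2' : ‖star c * c - 1‖ < 1 / 4 := by
    rw [← hX.norm_map, map_sub, map_mul, map_star, map_one]; exact hc2
  obtain ⟨w, hw1, hw2, hw⟩ := exists_partialIsometry_near (c := c) (IsStarProjection.one _)
    (IsStarProjection.one _) (one_mul c) (mul_one c)
    (by rw [← hX.norm_map, map_sub, map_mul, map_star, map_one]; exact hc1) (hc2'.trans (by norm_num))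
  refine ⟨n, w, ⟨hw2, hw1⟩, ?_⟩
  calc ‖κ n w - u‖ = ‖κ n (w - c) + (κ n c - u)‖ := by rw [map_sub]; congr 1; abel
    _ ≤ ‖κ n (w - c)‖ + ‖κ n c - u‖ := norm_add_le _ _
    _ < 1 / 4 + 1 / 4 := by
      rw [hX.norm_map]
      exact add_lt_add (hw.trans_lt hc2') hc3
    _ = 1 / 2 := by norm_num

end IsDenseSystem

end CStarPerturbation

end

/-! ### Direct limits of abelian groups and matrices over a dense system. -/

noncomputable section

theorem AddCommGroup.DirectLimit.exists_equiv_of_exact {G : ℕ → Type u} [∀ n, AddCommGroup (G n)]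
    (f : ∀ m n, m ≤ n → G m →+ G n) [DirectedSystem G fun m n h => f m n h]
    {P : Type v} [AddCommGroup P] (g : ∀ n, G n →+ P) (hg : ∀ m n h x, g n (f m n h x) = g m x)
    (hsurj : ∀ y, ∃ n x, g n x = y) (hinj : ∀ n x, g n x = 0 → ∃ m h, f n m h x = 0) :
    ∃ e : AddCommGroup.DirectLimit G f ≃+ P, ∀ n x, e (AddCommGroup.DirectLimit.of G f n x) = g n x := by
  refine ⟨AddEquiv.ofBijective (AddCommGroup.DirectLimit.lift G f P g hg) ⟨?_, fun y => ?_⟩,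
    fun n x => AddCommGroup.DirectLimit.lift_of P g hg n x⟩
  · refine (injective_iff_map_eq_zero _).2 fun z => ?_
    induction z using AddCommGroup.DirectLimit.induction_on with
    | ih n x =>
      rw [AddCommGroup.DirectLimit.lift_of]
      intro h
      obtain ⟨m, hm, h⟩ := hinj n x h
      rw [← AddCommGroup.DirectLimit.of_f (hij := hm), h, map_zero]
  · obtain ⟨n, x, rfl⟩ := hsurj y
    exact ⟨_, AddCommGroup.DirectLimit.lift_of P g hg n x⟩

namespace CStarPerturbation

attribute [local instance] CStarAlgebra.spectralOrder CStarAlgebra.spectralOrderedRing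

section Matrix

variable {ι : Type w} [Fintype ι] [DecidableEq ι]

/-- A unital ⋆-homomorphism applied entrywise to square matrices. -/
def matrixHom (ι : Type w) [Fintype ι] [DecidableEq ι] {B : Type u} [CStarAlgebra B] {C : Type v}
    [CStarAlgebra C] (φ : B →⋆ₐ[ℂ] C) : CStarMatrix ι ι B →⋆ₐ[ℂ] CStarMatrix ι ι C where
  toFun M := M.map φ
  map_one' := by
    ext i j
    rw [CStarMatrix.map_apply, CStarMatrix.one_apply, CStarMatrix.one_apply]
    split_ifs <;> simp
  map_mul' M N := by ext i j; simp [CStarMatrix.mul_apply]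
  map_zero' := by ext i j; simp
  map_add' M N := by ext i j; simp
  commutes' r := by
    ext i j
    rw [CStarMatrix.map_apply, CStarMatrix.algebraMap_apply, CStarMatrix.algebraMap_apply]
    split_ifs
    · exact AlgHomClass.commutes φ r
    · exact map_zero φ
  map_star' M := by
    ext i j
    rw [CStarMatrix.map_apply, CStarMatrix.star_apply, CStarMatrix.star_apply,
      CStarMatrix.map_apply, map_star]

/-- Density can be checked entrywise, since matrices carry the product topology; finitely many
entries taken from finite stages have a common later stage. -/
theorem IsDenseSystem.matrix {X : ℕ → Type u} [∀ n, CStarAlgebra (X n)]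
    {f : ∀ m n, m ≤ n → (X m →⋆ₐ[ℂ] X n)}
    {Y : Type v} [CStarAlgebra Y] {κ : ∀ n, X n →⋆ₐ[ℂ] Y} (hX : IsDenseSystem f κ)
    (ι : Type w) [Fintype ι] [DecidableEq ι] :
    IsDenseSystem (X := fun n => CStarMatrix ι ι (X n)) (Y := CStarMatrix ι ι Y)
      (fun m n h => matrixHom ι (f m n h)) (fun n => matrixHom ι (κ n)) where
  compat h M := CStarMatrix.ext fun i j => hX.compat h (M i j)
  injective n M N hMN := CStarMatrix.ext fun i j =>
    hX.injective n (congrFun (congrFun hMN i) j)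
  dense := by
    have h1 : Dense (Set.univ.pi fun _ : ι => Set.univ.pi fun _ : ι => ⋃ n, Set.range (κ n)) :=
      dense_pi _ fun _ _ => dense_pi _ fun _ _ => hX.dense
    refine Dense.mono (fun M hM => ?_) (show Dense (X := CStarMatrix ι ι Y) _ from h1)
    have h2 : ∀ i j, ∃ n x, κ n x = M i j := fun i j =>
      Set.mem_iUnion.1 (hM i trivial j trivial)
    choose n x hx using h2
    let N := Finset.univ.sup fun i => Finset.univ.sup (n i)
    have hN : ∀ i j, n i j ≤ N := fun i j =>
      (Finset.le_sup (Finset.mem_univ j)).trans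
        (Finset.le_sup (f := fun i => Finset.univ.sup (n i)) (Finset.mem_univ i))
    refine Set.mem_iUnion.2 ⟨N, CStarMatrix.ofMatrix (fun i j => f _ N (hN i j) (x i j)),
      CStarMatrix.ext fun i j => ?_⟩
    exact (hX.compat _ _).trans (hx i j)

end Matrix

namespace IsDenseSystem

variable {X : ℕ → Type u} [∀ n, CStarAlgebra (X n)] {f : ∀ m n, m ≤ n → (X m →⋆ₐ[ℂ] X n)}
  {Y : Type v} [CStarAlgebra Y] {κ : ∀ n, X n →⋆ₐ[ℂ] Y}

theorem comp_eq (hX : IsDenseSystem f κ) {m n : ℕ} (h : m ≤ n) : (κ n).comp (f m n h) = κ m :=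
  StarAlgHom.ext (hX.compat h)

/-- Functoriality of the connecting maps need not be assumed: it holds after the injective map `κ
n`. -/
theorem trans_eq (hX : IsDenseSystem f κ) {k m n : ℕ} (h : k ≤ m) (h' : m ≤ n) :
    (f m n h').comp (f k m h) = f k n (h.trans h') :=
  StarAlgHom.ext fun x => hX.injective n (by simp [hX.compat])

theorem refl_eq (hX : IsDenseSystem f κ) (n : ℕ) : f n n le_rfl = StarAlgHom.id ℂ (X n) :=
  StarAlgHom.ext fun x => hX.injective n (by simp [hX.compat])

end IsDenseSystem

end CStarPerturbation

/-! ### Continuity of `K_00`. -/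

namespace KTheory

open scoped Matrix
open CStarPerturbation

attribute [local instance] CStarAlgebra.spectralOrder CStarAlgebra.spectralOrderedRing

variable {B : Type u} [CStarAlgebra B] {C : Type v} [CStarAlgebra C]

namespace ProjMat

theorem Equivalent.symm {p q : ProjMat B} (h : p.Equivalent q) : q.Equivalent p := by
  obtain ⟨v, h1, h2⟩ := h
  exact ⟨vᴴ, by rw [Matrix.conjTranspose_conjTranspose, h2], by
    rw [Matrix.conjTranspose_conjTranspose, h1]⟩

theorem Equivalent.trans {p q r : ProjMat B} (h : p.Equivalent q) (h' : q.Equivalent r) :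
    p.Equivalent r := by
  obtain ⟨v, h1, h2⟩ := h
  obtain ⟨w, h3, h4⟩ := h'
  refine ⟨v * w, ?_, ?_⟩
  · calc v * w * (v * w)ᴴ = v * (w * wᴴ) * vᴴ := by
          rw [Matrix.conjTranspose_mul]; simp only [Matrix.mul_assoc]
      _ = (v * vᴴ) * (v * vᴴ) := by rw [h3, ← h2]; simp only [Matrix.mul_assoc]
      _ = p.val := by rw [h1, p.isStarProjection.isIdempotentElem.eq]
  · calc (v * w)ᴴ * (v * w) = wᴴ * (vᴴ * v) * w := by
          rw [Matrix.conjTranspose_mul]; simp only [Matrix.mul_assoc]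
      _ = (wᴴ * w) * (wᴴ * w) := by rw [h2, ← h3]; simp only [Matrix.mul_assoc]
      _ = r.val := by rw [h4, r.isStarProjection.isIdempotentElem.eq]

theorem reindex_fromBlocks_mul {k l m k' l' m' : ℕ} (v : Matrix (Fin k) (Fin l) B)
    (w : Matrix (Fin k') (Fin l') B) (v' : Matrix (Fin l) (Fin m) B)
    (w' : Matrix (Fin l') (Fin m') B) :
    Matrix.reindex finSumFinEquiv finSumFinEquiv (Matrix.fromBlocks v 0 0 w) *
      Matrix.reindex finSumFinEquiv finSumFinEquiv (Matrix.fromBlocks v' 0 0 w') =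
    Matrix.reindex finSumFinEquiv finSumFinEquiv (Matrix.fromBlocks (v * v') 0 0 (w * w')) := by
  simp [Matrix.submatrix_mul_equiv, Matrix.fromBlocks_multiply]

theorem conjTranspose_reindex_fromBlocks {k l k' l' : ℕ} (v : Matrix (Fin k) (Fin l) B)
    (w : Matrix (Fin k') (Fin l') B) :
    (Matrix.reindex finSumFinEquiv finSumFinEquiv (Matrix.fromBlocks v 0 0 w))ᴴ =
      Matrix.reindex finSumFinEquiv finSumFinEquiv (Matrix.fromBlocks vᴴ 0 0 wᴴ) := by
  simp [Matrix.fromBlocks_conjTranspose]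

theorem Equivalent.sum {p q p' q' : ProjMat B} (h : p.Equivalent p') (h' : q.Equivalent q') :
    (p.sum q).Equivalent (p'.sum q') := by
  obtain ⟨v, h1, h2⟩ := h
  obtain ⟨w, h3, h4⟩ := h'
  refine ⟨Matrix.reindex finSumFinEquiv finSumFinEquiv (Matrix.fromBlocks v 0 0 w), ?_, ?_⟩
  · have e := reindex_fromBlocks_mul v w vᴴ wᴴ
    rw [← conjTranspose_reindex_fromBlocks, h1, h3] at e
    exact e
  · have e := reindex_fromBlocks_mul vᴴ wᴴ v w
    rw [← conjTranspose_reindex_fromBlocks, h2, h4] at e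
    exact e

theorem map_sum (φ : B →⋆ₐ[ℂ] C) (p q : ProjMat B) :
    (p.sum q).map φ = (p.map φ).sum (q.map φ) := by
  simp [ProjMat.map, ProjMat.sum, diagSum_map]

theorem map_map {D : Type*} [CStarAlgebra D] (ψ : C →⋆ₐ[ℂ] D) (φ : B →⋆ₐ[ℂ] C) (p : ProjMat B) :
    (p.map φ).map ψ = p.map (ψ.comp φ) := by
  simp [ProjMat.map, Matrix.map_map]

variable {X : ℕ → Type u} [∀ n, CStarAlgebra (X n)] {f : ∀ m n, m ≤ n → (X m →⋆ₐ[ℂ] X n)}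
  {Y : Type v} [CStarAlgebra Y] {κ : ∀ n, X n →⋆ₐ[ℂ] Y}

theorem exists_map_equivalent (hX : IsDenseSystem f κ) (p : ProjMat Y) :
    ∃ n, ∃ q : ProjMat (X n), (q.map (κ n)).Equivalent p := by
  have hp : IsStarProjection (CStarMatrix.ofMatrix p.val) :=
    ⟨p.isStarProjection.1, p.isStarProjection.2⟩
  obtain ⟨n, q, hq, v, h1, h2⟩ := (hX.matrix (Fin p.size)).exists_isStarProjection_equivalent hp
  exact ⟨n, ⟨p.size, CStarMatrix.ofMatrix.symm q, ⟨hq.1, hq.2⟩⟩,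
    Equivalent.symm ⟨CStarMatrix.ofMatrix.symm v, h1, h2⟩⟩

/-- The matrix implementing the equivalence may be rectangular, while the descent result concerns
elements of one C⋆-algebra. As the off-diagonal block of a square matrix, it becomes a partial
isometry between `diag(p, 0)` and `diag(0, q)`. -/
theorem exists_map_equivalent_map (hX : IsDenseSystem f κ) {n : ℕ} {p q : ProjMat (X n)}
    (h : (p.map (κ n)).Equivalent (q.map (κ n))) :
    ∃ m, ∃ hm : n ≤ m, (p.map (f n m hm)).Equivalent (q.map (f n m hm)) := by
  obtain ⟨v, h1, h2⟩ := h
  change Matrix (Fin p.size) (Fin q.size) Y at v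
  change v * vᴴ = p.val.map (κ n) at h1
  change vᴴ * v = q.val.map (κ n) at h2
  have hpi := p.isStarProjection.isIdempotentElem.eq
  have hqi := q.isStarProjection.isIdempotentElem.eq
  have hps : p.valᴴ = p.val := p.isStarProjection.isSelfAdjoint
  have hqs : q.valᴴ = q.val := q.isStarProjection.isSelfAdjoint
  let P : Matrix (Fin p.size ⊕ Fin q.size) (Fin p.size ⊕ Fin q.size) (X n) :=
    Matrix.fromBlocks p.val 0 0 0
  let Q : Matrix (Fin p.size ⊕ Fin q.size) (Fin p.size ⊕ Fin q.size) (X n) :=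
    Matrix.fromBlocks 0 0 0 q.val
  let V : Matrix (Fin p.size ⊕ Fin q.size) (Fin p.size ⊕ Fin q.size) Y :=
    Matrix.fromBlocks 0 v 0 0
  have hP : IsStarProjection (CStarMatrix.ofMatrix P) :=
    ⟨show P * P = P by simp [P, Matrix.fromBlocks_multiply, hpi],
      show Pᴴ = P by simp [P, Matrix.fromBlocks_conjTranspose, hps]⟩
  have hQ : IsStarProjection (CStarMatrix.ofMatrix Q) :=
    ⟨show Q * Q = Q by simp [Q, Matrix.fromBlocks_multiply, hqi],
      show Qᴴ = Q by simp [Q, Matrix.fromBlocks_conjTranspose, hqs]⟩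
  have hVP : CStarMatrix.ofMatrix V * star (CStarMatrix.ofMatrix V) =
      matrixHom _ (κ n) (CStarMatrix.ofMatrix P) :=
    show V * Vᴴ = P.map (κ n) by
      simp [V, P, Matrix.fromBlocks_multiply, Matrix.fromBlocks_conjTranspose,
        Matrix.fromBlocks_map, h1]
  have hVQ : star (CStarMatrix.ofMatrix V) * CStarMatrix.ofMatrix V =
      matrixHom _ (κ n) (CStarMatrix.ofMatrix Q) :=
    show Vᴴ * V = Q.map (κ n) by
      simp [V, Q, Matrix.fromBlocks_multiply, Matrix.fromBlocks_conjTranspose,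
        Matrix.fromBlocks_map, h2]
  obtain ⟨m, hm, w, hw1, hw2⟩ := (hX.matrix _).exists_partialIsometry hP hQ hVP hVQ
  refine ⟨m, hm, ?_⟩
  -- From `w = P w` and `w = w Q`, only the upper right block of `w` survives; it is the rectangular
  -- matrix sought.
  have hPw := mul_eq_self_of_mul_star_eq (hP.map (matrixHom _ (f n m hm))) hw1
  have hwQ := mul_eq_self_of_star_mul_eq (hQ.map (matrixHom _ (f n m hm))) hw2
  obtain ⟨w₁₁, w₁₂, w₂₁, w₂₂, hw⟩ : ∃ a b c d, CStarMatrix.ofMatrix.symm w =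
    Matrix.fromBlocks a b c d := ⟨_, _, _, _, (Matrix.fromBlocks_toBlocks _).symm⟩
  have e1 : P.map (f n m hm) * CStarMatrix.ofMatrix.symm w = CStarMatrix.ofMatrix.symm w := hPw
  have e2 : CStarMatrix.ofMatrix.symm w * Q.map (f n m hm) = CStarMatrix.ofMatrix.symm w := hwQ
  have e3 : CStarMatrix.ofMatrix.symm w * (CStarMatrix.ofMatrix.symm w)ᴴ = P.map (f n m hm) := hw1
  have e4 : (CStarMatrix.ofMatrix.symm w)ᴴ * CStarMatrix.ofMatrix.symm w = Q.map (f n m hm) := hw2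
  rw [hw] at e1 e2 e3 e4
  simp only [P, Q, Matrix.fromBlocks_map, Matrix.fromBlocks_multiply, Matrix.fromBlocks_conjTranspose,
    Matrix.fromBlocks_inj, Matrix.map_zero, map_zero, Matrix.zero_mul, Matrix.mul_zero, zero_add,
    add_zero] at e1 e2 e3 e4
  obtain ⟨-, -, rfl, rfl⟩ := e1
  obtain ⟨rfl, -⟩ := e2
  refine ⟨w₁₂, ?_, ?_⟩
  · change w₁₂ * w₁₂ᴴ = p.val.map (f n m hm)
    simpa using e3.1
  · change w₁₂ᴴ * w₁₂ = q.val.map (f n m hm)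
    simpa using e4.2.2.2

end ProjMat

theorem K00.mk_eq_of_equivalent {p q : ProjMat B} (h : p.Equivalent q) : K00.mk p = K00.mk q := by
  exact QuotientAddGroup.eq_iff_sub_mem.2 (AddSubgroup.subset_closure (Or.inl ⟨p, q, h, rfl⟩))

theorem K00.mk_sum (p q : ProjMat B) : K00.mk (p.sum q) = K00.mk p + K00.mk q := by
  exact QuotientAddGroup.eq_iff_sub_mem.2 (AddSubgroup.subset_closure (Or.inr ⟨p, q, rfl⟩))

theorem K00.map_id : K00.map (StarAlgHom.id ℂ B) = AddMonoidHom.id (K00 B) :=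
  K00.hom_ext fun p => by simp [ProjMat.map]

section Continuity

variable {X : ℕ → Type u} [∀ n, CStarAlgebra (X n)] {f : ∀ m n, m ≤ n → (X m →⋆ₐ[ℂ] X n)}
  {Y : Type v} [CStarAlgebra Y] {κ : ∀ n, X n →⋆ₐ[ℂ] Y}

theorem K00.directedSystem (hX : IsDenseSystem f κ) :
    DirectedSystem (fun n => K00 (X n)) fun m n h => K00.map (f m n h) where
  map_self n x := by
    rw [hX.refl_eq, K00.map_id]; rfl
  map_map k j i hij hjk x := by
    rw [← hX.trans_eq hij hjk, K00.map_comp]; rfl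

/-- The map inverse to `lim K_00(X n) → K_00(Y)`. -/
theorem K00.exists_toDirectLimit (hX : IsDenseSystem f κ) :
    ∃ σ : K00 Y →+ AddCommGroup.DirectLimit (fun n => K00 (X n)) (fun m n h => K00.map (f m n h)),
      (∀ n x, σ (K00.map (κ n) x) = AddCommGroup.DirectLimit.of _ _ n x) ∧
      ∀ p : ProjMat Y, ∃ n x, K00.map (κ n) x = K00.mk p := by
  -- The class in the direct limit depends only on the equivalence class of the image in `Y`. This
  -- makes the choice of a finite-stage representative harmless and also yields both kinds of
  -- relations.
  have key : ∀ {n m} {q : ProjMat (X n)} {q' : ProjMat (X m)},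
      (q.map (κ n)).Equivalent (q'.map (κ m)) →
      AddCommGroup.DirectLimit.of (fun n => K00 (X n)) (fun m n h => K00.map (f m n h)) n
        (K00.mk q) = AddCommGroup.DirectLimit.of _ _ m (K00.mk q') := by
    intro n m q q' h
    rw [← hX.comp_eq (le_max_left n m), ← hX.comp_eq (le_max_right n m), ← ProjMat.map_map,
      ← ProjMat.map_map] at h
    obtain ⟨l, hl, h⟩ := ProjMat.exists_map_equivalent_map hX h
    rw [ProjMat.map_map, ProjMat.map_map, hX.trans_eq, hX.trans_eq] at h
    rw [← AddCommGroup.DirectLimit.of_f (hij := (le_max_left n m).trans hl),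
      ← AddCommGroup.DirectLimit.of_f (i := m) (hij := (le_max_right n m).trans hl),
      K00.map_mk, K00.map_mk, K00.mk_eq_of_equivalent h]
  choose n q hq using fun p : ProjMat Y => ProjMat.exists_map_equivalent hX p
  let σ₀ : FreeAbelianGroup (ProjMat Y) →+
      AddCommGroup.DirectLimit (fun n => K00 (X n)) (fun m n h => K00.map (f m n h)) :=
    FreeAbelianGroup.lift fun p => AddCommGroup.DirectLimit.of _ _ (n p) (K00.mk (q p))
  have hσ₀ : ∀ p, σ₀ (FreeAbelianGroup.of p) =
      AddCommGroup.DirectLimit.of _ _ (n p) (K00.mk (q p)) := fun p =>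
    FreeAbelianGroup.lift_apply_of _ _
  have hrel : projRelations Y ≤ σ₀.ker := by
    rw [projRelations, AddSubgroup.closure_le]
    rintro x (⟨p, p', h, rfl⟩ | ⟨p, p', rfl⟩)
    · rw [SetLike.mem_coe, AddMonoidHom.mem_ker, map_sub, hσ₀, hσ₀, sub_eq_zero]
      exact key ((hq p).trans (h.trans (hq p').symm))
    · rw [SetLike.mem_coe, AddMonoidHom.mem_ker, map_sub, map_add, hσ₀, hσ₀, hσ₀, sub_eq_zero]
      rw [← AddCommGroup.DirectLimit.of_f (i := n p) (hij := le_max_left (n p) (n p')),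
        ← AddCommGroup.DirectLimit.of_f (i := n p') (hij := le_max_right (n p) (n p')), ← map_add,
        K00.map_mk, K00.map_mk, ← K00.mk_sum]
      refine key ((hq (p.sum p')).trans (ProjMat.Equivalent.symm ?_))
      rw [ProjMat.map_sum, ProjMat.map_map, ProjMat.map_map, hX.comp_eq, hX.comp_eq]
      exact (hq p).sum (hq p')
  let σ : K00 Y →+ AddCommGroup.DirectLimit (fun n => K00 (X n)) (fun m n h => K00.map (f m n h)) :=
    QuotientAddGroup.lift (projRelations Y) σ₀ hrel
  refine ⟨σ, fun k x => ?_, fun p =>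
    ⟨n p, K00.mk (q p), by rw [K00.map_mk, K00.mk_eq_of_equivalent (hq p)]⟩⟩
  have h : σ.comp (K00.map (κ k)) = AddCommGroup.DirectLimit.of (fun n => K00 (X n))
      (fun m n h => K00.map (f m n h)) k := K00.hom_ext fun p => by
    rw [AddMonoidHom.comp_apply, K00.map_mk]
    exact (hσ₀ _).trans (key (hq _))
  exact DFunLike.congr_fun h x

/-- The canonical map from the direct limit has `σ` as a right inverse, as one sees on generators,
and every element of a direct limit comes from a stage. -/
theorem K00.exists_map_eq (hX : IsDenseSystem f κ) (y : K00 Y) : ∃ n x, K00.map (κ n) x = y := by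
  obtain ⟨σ, hσ, hσ'⟩ := K00.exists_toDirectLimit hX
  have hg : ∀ m n (h : m ≤ n) x, K00.map (κ n) (K00.map (f m n h) x) = K00.map (κ m) x :=
    fun m n h x => by rw [← hX.comp_eq h, K00.map_comp]; rfl
  let L := AddCommGroup.DirectLimit.lift (fun n => K00 (X n)) (fun m n h => K00.map (f m n h))
    (K00 Y) (fun n => K00.map (κ n)) hg
  have hLof : ∀ n x, L (AddCommGroup.DirectLimit.of _ _ n x) = K00.map (κ n) x := fun n x =>
    AddCommGroup.DirectLimit.lift_of (K00 Y) (fun n => K00.map (κ n)) hg n x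
  have hL : L.comp σ = AddMonoidHom.id _ := K00.hom_ext fun p => by
    obtain ⟨n, x, hx⟩ := hσ' p
    rw [AddMonoidHom.comp_apply, ← hx, hσ, hLof]; rfl
  have hy : L (σ y) = y := DFunLike.congr_fun hL y
  rw [← hy]
  induction σ y using AddCommGroup.DirectLimit.induction_on with
  | ih n x => exact ⟨n, x, (hLof n x).symm⟩

/-- Applying `σ` shows that `x` vanishes in the direct limit, hence at a later stage. No explicit
criterion for a class of `K_00` to vanish is involved. -/
theorem K00.exists_map_eq_zero (hX : IsDenseSystem f κ) {n : ℕ} {x : K00 (X n)}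
    (h : K00.map (κ n) x = 0) : ∃ m, ∃ hm : n ≤ m, K00.map (f n m hm) x = 0 := by
  obtain ⟨σ, hσ, -⟩ := K00.exists_toDirectLimit hX
  have := K00.directedSystem hX
  refine AddCommGroup.DirectLimit.of.zero_exact (f := fun m n h => K00.map (f m n h)) n x ?_
  rw [← hσ, h, map_zero]

end Continuity

end KTheory

end

/-! ### Continuity of `K_11`. -/

noncomputable section

namespace KTheory

open scoped Matrix
open CStarPerturbation

attribute [local instance] CStarAlgebra.spectralOrder CStarAlgebra.spectralOrderedRing

variable {B : Type u} [CStarAlgebra B] {C : Type v} [CStarAlgebra C]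

namespace UnitaryMat

/-- Unitary matrices at distance less than `2` are joined by a path. -/
theorem joined_of_norm_sub_lt {k : ℕ} {u v : unitary (Matrix (Fin k) (Fin k) B)}
    (h : ‖CStarMatrix.ofMatrix u.1 - CStarMatrix.ofMatrix v.1‖ < 2) : Joined u v := by
  let u' : unitary (CStarMatrix (Fin k) (Fin k) B) := ⟨CStarMatrix.ofMatrix u.1, u.2⟩
  let v' : unitary (CStarMatrix (Fin k) (Fin k) B) := ⟨CStarMatrix.ofMatrix v.1, v.2⟩
  have hj : Joined v' u' := Unitary.joined v' u' h
  let F : unitary (CStarMatrix (Fin k) (Fin k) B) → unitary (Matrix (Fin k) (Fin k) B) :=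
    fun w => ⟨CStarMatrix.ofMatrix.symm w.1, w.2⟩
  have hF : Continuous F := Continuous.subtype_mk continuous_subtype_val _
  exact (hj.map hF).symm

/-- The direct sum of unitary matrices of fixed sizes. -/
def sumUnitary {k l : ℕ} (u : unitary (Matrix (Fin k) (Fin k) B))
    (v : unitary (Matrix (Fin l) (Fin l) B)) : unitary (Matrix (Fin (k + l)) (Fin (k + l)) B) :=
  (sum ⟨k, u⟩ ⟨l, v⟩).val

theorem mapUnitary_sumUnitary (φ : B →⋆ₐ[ℂ] C) {k l : ℕ} (u : unitary (Matrix (Fin k) (Fin k) B))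
    (v : unitary (Matrix (Fin l) (Fin l) B)) :
    mapUnitary φ (sumUnitary u v) = sumUnitary (mapUnitary φ u) (mapUnitary φ v) :=
  Subtype.ext (diagSum_map φ u.1 v.1)

theorem joined_sumUnitary {k l : ℕ} {u u' : unitary (Matrix (Fin k) (Fin k) B)}
    {v v' : unitary (Matrix (Fin l) (Fin l) B)} (hu : Joined u u') (hv : Joined v v') :
    Joined (sumUnitary u v) (sumUnitary u' v') := by
  obtain ⟨γ⟩ := hu
  obtain ⟨δ⟩ := hv
  refine ⟨⟨⟨fun t => sumUnitary (γ t) (δ t), continuous_induced_rng.2 ?_⟩,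
    congrArg₂ sumUnitary γ.source δ.source, congrArg₂ sumUnitary γ.target δ.target⟩⟩
  have h : Continuous fun t => Matrix.fromBlocks (γ t).1 0 0 (δ t).1 :=
    Continuous.matrix_fromBlocks (continuous_subtype_val.comp γ.continuous) continuous_const
      continuous_const (continuous_subtype_val.comp δ.continuous)
  exact h.matrix_reindex finSumFinEquiv finSumFinEquiv

theorem map_map {D : Type*} [CStarAlgebra D] (ψ : C →⋆ₐ[ℂ] D) (φ : B →⋆ₐ[ℂ] C)
    (u : UnitaryMat B) : (u.map φ).map ψ = u.map (ψ.comp φ) :=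
  congrArg (UnitaryMat.mk u.size) (Subtype.ext (Matrix.map_map ..))

variable {X : ℕ → Type u} [∀ n, CStarAlgebra (X n)] {f : ∀ m n, m ≤ n → (X m →⋆ₐ[ℂ] X n)}
  {Y : Type v} [CStarAlgebra Y] {κ : ∀ n, X n →⋆ₐ[ℂ] Y}

theorem exists_map_near (hX : IsDenseSystem f κ) {k : ℕ} (u : unitary (Matrix (Fin k) (Fin k) Y)) :
    ∃ n, ∃ w : unitary (Matrix (Fin k) (Fin k) (X n)),
      ‖CStarMatrix.ofMatrix (mapUnitary (κ n) w).1 - CStarMatrix.ofMatrix u.1‖ < 1 / 2 := by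
  obtain ⟨n, w, hw, h⟩ := (hX.matrix (Fin k)).exists_unitary_near
    (u := CStarMatrix.ofMatrix u.1) u.2
  exact ⟨n, ⟨CStarMatrix.ofMatrix.symm w, hw⟩, h⟩

/-- Paths need not be lifted from the limit: the distance of the images is already the distance at
stage `n`, and distance less than `2` produces a path there. -/
theorem joined_of_map_near (hX : IsDenseSystem f κ) {k n : ℕ}
    {u v : unitary (Matrix (Fin k) (Fin k) (X n))}
    (h : ‖CStarMatrix.ofMatrix (mapUnitary (κ n) u).1 -
      CStarMatrix.ofMatrix (mapUnitary (κ n) v).1‖ < 2) : Joined u v := by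
  refine joined_of_norm_sub_lt ?_
  rw [← (hX.matrix (Fin k)).norm_map, map_sub]
  exact h

end UnitaryMat

/-- The class of a unitary. -/
def K11.mk (u : UnitaryMat B) : K11 B :=
  QuotientAddGroup.mk' (unitaryRelations B) (FreeAbelianGroup.of u)

theorem K11.mk_eq_of_joined {k : ℕ} {u v : unitary (Matrix (Fin k) (Fin k) B)} (h : Joined u v) :
    K11.mk ⟨k, u⟩ = K11.mk ⟨k, v⟩ := by
  exact QuotientAddGroup.eq_iff_sub_mem.2
    (AddSubgroup.subset_closure (Or.inl (Or.inl ⟨k, u, v, h, rfl⟩)))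

theorem K11.mk_sum (u v : UnitaryMat B) : K11.mk (u.sum v) = K11.mk u + K11.mk v := by
  exact QuotientAddGroup.eq_iff_sub_mem.2
    (AddSubgroup.subset_closure (Or.inl (Or.inr ⟨u, v, rfl⟩)))

theorem K11.mk_one (n : ℕ) : K11.mk (⟨n, 1⟩ : UnitaryMat B) = 0 := by
  exact (QuotientAddGroup.eq_zero_iff _).2 (AddSubgroup.subset_closure (Or.inr ⟨n, rfl⟩))

@[simp] theorem K11.map_mk (φ : B →⋆ₐ[ℂ] C) (u : UnitaryMat B) :
    K11.map φ (K11.mk u) = K11.mk (u.map φ) := by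
  change QuotientAddGroup.mk' (unitaryRelations C)
    (FreeAbelianGroup.map (UnitaryMat.map φ) (FreeAbelianGroup.of u)) = _
  rw [FreeAbelianGroup.map_of_apply]; rfl

theorem K11.hom_ext {M : Type*} [AddCommGroup M] {f g : K11 B →+ M}
    (h : ∀ u, f (K11.mk u) = g (K11.mk u)) : f = g :=
  QuotientAddGroup.addMonoidHom_ext _ (FreeAbelianGroup.lift_ext _ _ h)

theorem K11.map_comp {D : Type*} [CStarAlgebra D] (ψ : C →⋆ₐ[ℂ] D) (φ : B →⋆ₐ[ℂ] C) :
    K11.map (ψ.comp φ) = (K11.map ψ).comp (K11.map φ) :=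
  K11.hom_ext fun u => by simp [UnitaryMat.map_map]

theorem K11.map_id : K11.map (StarAlgHom.id ℂ B) = AddMonoidHom.id (K11 B) :=
  K11.hom_ext fun u => by
    rw [K11.map_mk]
    exact congrArg K11.mk (congrArg (UnitaryMat.mk u.size) (Subtype.ext (Matrix.map_id _)))

section Continuity

variable {X : ℕ → Type u} [∀ n, CStarAlgebra (X n)] {f : ∀ m n, m ≤ n → (X m →⋆ₐ[ℂ] X n)}
  {Y : Type v} [CStarAlgebra Y] {κ : ∀ n, X n →⋆ₐ[ℂ] Y}

theorem K11.directedSystem (hX : IsDenseSystem f κ) :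
    DirectedSystem (fun n => K11 (X n)) fun m n h => K11.map (f m n h) where
  map_self n x := by
    rw [hX.refl_eq, K11.map_id]; rfl
  map_map k j i hij hjk x := by
    rw [← hX.trans_eq hij hjk, K11.map_comp]; rfl

/-- The map inverse to `lim K_11(X n) → K_11(Y)`. -/
theorem K11.exists_toDirectLimit (hX : IsDenseSystem f κ) :
    ∃ σ : K11 Y →+ AddCommGroup.DirectLimit (fun n => K11 (X n)) (fun m n h => K11.map (f m n h)),
      (∀ n x, σ (K11.map (κ n) x) = AddCommGroup.DirectLimit.of _ _ n x) ∧
      ∀ u : UnitaryMat Y, ∃ n x, K11.map (κ n) x = K11.mk u := by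
  have key : ∀ {k n m} {w : unitary (Matrix (Fin k) (Fin k) (X n))}
      {w' : unitary (Matrix (Fin k) (Fin k) (X m))},
      ‖CStarMatrix.ofMatrix (UnitaryMat.mapUnitary (κ n) w).1 -
        CStarMatrix.ofMatrix (UnitaryMat.mapUnitary (κ m) w').1‖ < 2 →
      AddCommGroup.DirectLimit.of (fun n => K11 (X n)) (fun m n h => K11.map (f m n h)) n
        (K11.mk ⟨k, w⟩) = AddCommGroup.DirectLimit.of _ _ m (K11.mk ⟨k, w'⟩) := by
    intro k n m w w' h
    rw [← AddCommGroup.DirectLimit.of_f (i := n) (hij := le_max_left n m),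
      ← AddCommGroup.DirectLimit.of_f (i := m) (hij := le_max_right n m), K11.map_mk, K11.map_mk]
    refine congrArg _ (K11.mk_eq_of_joined (UnitaryMat.joined_of_map_near hX ?_))
    have e : ∀ {n l} (hl : n ≤ l) (w : unitary (Matrix (Fin k) (Fin k) (X n))),
        UnitaryMat.mapUnitary (κ l) (UnitaryMat.mapUnitary (f n l hl) w) =
          UnitaryMat.mapUnitary (κ n) w := fun hl w =>
      Subtype.ext (Matrix.ext fun i j => hX.compat hl _)
    rw [e, e]
    exact h
  choose n q hq using fun (k : ℕ) (u : unitary (Matrix (Fin k) (Fin k) Y)) =>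
    UnitaryMat.exists_map_near hX u
  -- The class of a chosen finite-stage unitary within `1/2` of `u`. By `key`, any other
  -- finite-stage unitary whose image is less than `2` away from that of the chosen one gives the
  -- same class.
  let τ : ∀ k, unitary (Matrix (Fin k) (Fin k) Y) →
      AddCommGroup.DirectLimit (fun n => K11 (X n)) (fun m n h => K11.map (f m n h)) :=
    fun k u => AddCommGroup.DirectLimit.of _ _ (n k u) (K11.mk ⟨k, q k u⟩)
  have hτκ : ∀ k m (w : unitary (Matrix (Fin k) (Fin k) (X m))),
      τ k (UnitaryMat.mapUnitary (κ m) w) = AddCommGroup.DirectLimit.of _ _ m (K11.mk ⟨k, w⟩) :=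
    fun k m w => key ((hq k _).trans (by norm_num))
  -- If `‖v - u‖ < 1`, the approximants of `v` and `u` differ by less than `1/2 + 1 + 1/2 = 2`, so
  -- `key` applies. Since a path is connected, homotopy invariance follows.
  have hτloc : ∀ k, IsLocallyConstant (τ k) := by
    intro k
    rw [IsLocallyConstant.iff_eventually_eq]
    intro u
    have hc : Continuous fun v : unitary (Matrix (Fin k) (Fin k) Y) =>
        ‖CStarMatrix.ofMatrix v.1 - CStarMatrix.ofMatrix u.1‖ := by
      have : Continuous fun v : unitary (Matrix (Fin k) (Fin k) Y) =>
          (CStarMatrix.ofMatrix v.1 : CStarMatrix (Fin k) (Fin k) Y) := continuous_subtype_val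
      exact (this.sub continuous_const).norm
    filter_upwards [(isOpen_lt hc continuous_const).mem_nhds
      (show u ∈ {v | _ < (1 : ℝ)} by simp)] with v hv
    refine key ?_
    have hv' : ‖CStarMatrix.ofMatrix v.1 - CStarMatrix.ofMatrix u.1‖ < 1 := hv
    have h1 := hq k v
    have h2 := hq k u
    rw [norm_sub_rev] at h2
    calc _ ≤ ‖CStarMatrix.ofMatrix (UnitaryMat.mapUnitary (κ _) (q k v)).1 -
            CStarMatrix.ofMatrix u.1‖ + _ := norm_sub_le_norm_sub_add_norm_sub _ _ _
      _ ≤ (_ + ‖CStarMatrix.ofMatrix v.1 - CStarMatrix.ofMatrix u.1‖) + _ := by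
          gcongr
          exact norm_sub_le_norm_sub_add_norm_sub _ _ _
      _ < 2 := by linarith
  have hτjoin : ∀ {k} {u v : unitary (Matrix (Fin k) (Fin k) Y)}, Joined u v → τ k u = τ k v := by
    rintro k u v ⟨γ⟩
    have := ((hτloc k).comp_continuous γ.continuous).apply_eq_of_isPreconnected
      isPreconnected_univ (Set.mem_univ 0) (Set.mem_univ 1)
    simpa using this
  have hqjoin : ∀ k u, Joined (UnitaryMat.mapUnitary (κ (n k u)) (q k u)) u := fun k u =>
    UnitaryMat.joined_of_norm_sub_lt ((hq k u).trans (by norm_num))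
  let σ₀ : FreeAbelianGroup (UnitaryMat Y) →+
      AddCommGroup.DirectLimit (fun n => K11 (X n)) (fun m n h => K11.map (f m n h)) :=
    FreeAbelianGroup.lift fun u => τ u.size u.val
  have hσ₀ : ∀ u, σ₀ (FreeAbelianGroup.of u) = τ u.size u.val := fun u =>
    FreeAbelianGroup.lift_apply_of _ _
  have hrel : unitaryRelations Y ≤ σ₀.ker := by
    rw [unitaryRelations, AddSubgroup.closure_le]
    rintro x ((⟨k, u, v, h, rfl⟩ | ⟨⟨k, u⟩, ⟨l, v⟩, rfl⟩) | ⟨k, rfl⟩)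
    · rw [SetLike.mem_coe, AddMonoidHom.mem_ker, map_sub, hσ₀, hσ₀, sub_eq_zero]
      exact hτjoin h
    · rw [SetLike.mem_coe, AddMonoidHom.mem_ker, map_sub, map_add, hσ₀, hσ₀, hσ₀, sub_eq_zero]
      -- Both approximants are moved to a common stage. Their direct sum is joined to `diag(u, v)`
      -- in `Y`, so homotopy invariance of `τ` gives additivity without an estimate for the norm of
      -- a block sum.
      set N := max (n k u) (n l v)
      let w₁ := UnitaryMat.mapUnitary (f _ N (le_max_left (n k u) (n l v))) (q k u)
      let w₂ := UnitaryMat.mapUnitary (f _ N (le_max_right (n k u) (n l v))) (q l v)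
      have e₁ : UnitaryMat.mapUnitary (κ N) w₁ = UnitaryMat.mapUnitary (κ _) (q k u) :=
        Subtype.ext (Matrix.ext fun i j => hX.compat _ _)
      have e₂ : UnitaryMat.mapUnitary (κ N) w₂ = UnitaryMat.mapUnitary (κ _) (q l v) :=
        Subtype.ext (Matrix.ext fun i j => hX.compat _ _)
      have h₁ : τ k u = AddCommGroup.DirectLimit.of _ _ N (K11.mk ⟨k, w₁⟩) := by
        rw [← hτκ, e₁]; exact (hτjoin (hqjoin k u)).symm
      have h₂ : τ l v = AddCommGroup.DirectLimit.of _ _ N (K11.mk ⟨l, w₂⟩) := by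
        rw [← hτκ, e₂]; exact (hτjoin (hqjoin l v)).symm
      change τ (k + l) (UnitaryMat.sumUnitary u v) = τ k u + τ l v
      rw [h₁, h₂, ← map_add, ← K11.mk_sum]
      refine (hτjoin (Joined.symm ?_)).trans (hτκ (k + l) N (UnitaryMat.sumUnitary w₁ w₂))
      rw [UnitaryMat.mapUnitary_sumUnitary, e₁, e₂]
      exact UnitaryMat.joined_sumUnitary (hqjoin k u) (hqjoin l v)
    · rw [SetLike.mem_coe, AddMonoidHom.mem_ker, hσ₀]
      -- The approximant chosen for `1` may differ from `1`; viewing `1` as the image of the unit of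
      -- stage `0` determines its value.
      have e : UnitaryMat.mapUnitary (κ 0) (1 : unitary (Matrix (Fin k) (Fin k) (X 0))) = 1 :=
        Subtype.ext (by simp [UnitaryMat.mapUnitary])
      change τ k 1 = 0
      rw [← e, hτκ, K11.mk_one, map_zero]
  let σ : K11 Y →+ AddCommGroup.DirectLimit (fun n => K11 (X n)) (fun m n h => K11.map (f m n h)) :=
    QuotientAddGroup.lift (unitaryRelations Y) σ₀ hrel
  refine ⟨σ, fun m x => ?_, fun u => ⟨n _ u.val, K11.mk ⟨u.size, q _ u.val⟩, by
    rw [K11.map_mk]; exact K11.mk_eq_of_joined (hqjoin _ u.val)⟩⟩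
  have h : σ.comp (K11.map (κ m)) = AddCommGroup.DirectLimit.of (fun n => K11 (X n))
      (fun m n h => K11.map (f m n h)) m := K11.hom_ext fun u => by
    rw [AddMonoidHom.comp_apply, K11.map_mk]
    exact (hσ₀ _).trans (hτκ _ _ _)
  exact DFunLike.congr_fun h x

theorem K11.exists_map_eq (hX : IsDenseSystem f κ) (y : K11 Y) : ∃ n x, K11.map (κ n) x = y := by
  obtain ⟨σ, hσ, hσ'⟩ := K11.exists_toDirectLimit hX
  have hg : ∀ m n (h : m ≤ n) x, K11.map (κ n) (K11.map (f m n h) x) = K11.map (κ m) x :=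
    fun m n h x => by rw [← hX.comp_eq h, K11.map_comp]; rfl
  let L := AddCommGroup.DirectLimit.lift (fun n => K11 (X n)) (fun m n h => K11.map (f m n h))
    (K11 Y) (fun n => K11.map (κ n)) hg
  have hLof : ∀ n x, L (AddCommGroup.DirectLimit.of _ _ n x) = K11.map (κ n) x := fun n x =>
    AddCommGroup.DirectLimit.lift_of (K11 Y) (fun n => K11.map (κ n)) hg n x
  have hL : L.comp σ = AddMonoidHom.id _ := K11.hom_ext fun u => by
    obtain ⟨n, x, hx⟩ := hσ' u
    rw [AddMonoidHom.comp_apply, ← hx, hσ, hLof]; rfl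
  have hy : L (σ y) = y := DFunLike.congr_fun hL y
  rw [← hy]
  induction σ y using AddCommGroup.DirectLimit.induction_on with
  | ih n x => exact ⟨n, x, (hLof n x).symm⟩

theorem K11.exists_map_eq_zero (hX : IsDenseSystem f κ) {n : ℕ} {x : K11 (X n)}
    (h : K11.map (κ n) x = 0) : ∃ m, ∃ hm : n ≤ m, K11.map (f n m hm) x = 0 := by
  obtain ⟨σ, hσ, -⟩ := K11.exists_toDirectLimit hX
  have := K11.directedSystem hX
  refine AddCommGroup.DirectLimit.of.zero_exact (f := fun m n h => K11.map (f m n h)) n x ?_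
  rw [← hσ, h, map_zero]

end Continuity

end KTheory

end

/-! ### From unital to non-unital algebras. -/

noncomputable section

namespace KTheory

open CStarPerturbation

section Unitization

variable {X : ℕ → Type u} [∀ n, NonUnitalCStarAlgebra (X n)] {f : ∀ m n, m ≤ n → (X m →⋆ₙₐ[ℂ] X n)}

/-- The scalar part is available at every stage, so only the part in `Y` has to be approximated; the
inclusion of `Y` into its unitization is isometric. -/
theorem isDenseSystem_unitization {Y : Type v} [NonUnitalCStarAlgebra Y] {κ : ∀ n, X n →⋆ₙₐ[ℂ] Y}
    (hκ : ∀ m n (h : m ≤ n), (κ n).comp (f m n h) = κ m) (hinj : ∀ n, Function.Injective (κ n))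
    (hd : Dense (⋃ n, Set.range (κ n))) :
    IsDenseSystem (X := fun n => Unitization ℂ (X n)) (Y := Unitization ℂ Y)
      (fun m n h => Unitization.starMap (f m n h)) (fun n => Unitization.starMap (κ n)) where
  compat {m n} h x := by
    rw [← hκ m n h, Unitization.starMap_comp]; rfl
  injective n := Unitization.starMap_injective (hinj n)
  dense z := by
    induction z using Unitization.ind with
    | inl_add_inr c y =>
      refine map_mem_closure (f := fun y : Y => (Unitization.inl c + (y : Unitization ℂ Y)))
        (continuous_const.add (Unitization.isometry_inr (𝕜 := ℂ)).continuous) (hd y) ?_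
      rintro _ ⟨_, ⟨n, rfl⟩, x, rfl⟩
      exact Set.mem_iUnion.2 ⟨n, Unitization.inl c + (x : Unitization ℂ (X n)), by
        rw [map_add, Unitization.starMap_inl, Unitization.starMap_inr]; rfl⟩

theorem K0.directedSystem (h1 : ∀ n, f n n le_rfl = NonUnitalStarAlgHom.id ℂ (X n))
    (h2 : ∀ k m n (h : k ≤ m) (h' : m ≤ n), (f m n h').comp (f k m h) = f k n (h.trans h')) :
    DirectedSystem (fun n => K0 (X n)) fun m n h => K0.map (f m n h) where
  map_self n x := by
    refine Subtype.ext ?_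
    change K00.map (Unitization.starMap (f n n le_rfl)) x.1 = x.1
    rw [h1, Unitization.starMap_id, K00.map_id]; rfl
  map_map k j i hij hjk x := by
    refine Subtype.ext ?_
    change K00.map (Unitization.starMap (f j k hjk)) (K00.map (Unitization.starMap (f i j hij)) x.1) =
      K00.map (Unitization.starMap (f i k _)) x.1
    rw [← h2 i j k hij hjk, Unitization.starMap_comp, K00.map_comp]; rfl

theorem K1.directedSystem (h1 : ∀ n, f n n le_rfl = NonUnitalStarAlgHom.id ℂ (X n))
    (h2 : ∀ k m n (h : k ≤ m) (h' : m ≤ n), (f m n h').comp (f k m h) = f k n (h.trans h')) :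
    DirectedSystem (fun n => K1 (X n)) fun m n h => K1.map (f m n h) where
  map_self n x := by
    rw [K1.map, h1, Unitization.starMap_id, K11.map_id]; rfl
  map_map k j i hij hjk x := by
    rw [K1.map, K1.map, K1.map, ← h2 i j k hij hjk, Unitization.starMap_comp, K11.map_comp]; rfl

variable {Y : Type v} [NonUnitalCStarAlgebra Y] {κ : ∀ n, X n →⋆ₙₐ[ℂ] Y}

/-- `K_0` is continuous. -/
theorem K0.exists_directLimit_equiv
    (h1 : ∀ n, f n n le_rfl = NonUnitalStarAlgHom.id ℂ (X n))
    (h2 : ∀ k m n (h : k ≤ m) (h' : m ≤ n), (f m n h').comp (f k m h) = f k n (h.trans h'))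
    (hκ : ∀ m n (h : m ≤ n), (κ n).comp (f m n h) = κ m) (hinj : ∀ n, Function.Injective (κ n))
    (hd : Dense (⋃ n, Set.range (κ n))) :
    ∃ e : AddCommGroup.DirectLimit (fun n => K0 (X n)) (fun m n h => K0.map (f m n h)) ≃+ K0 Y,
      ∀ n x, e (AddCommGroup.DirectLimit.of _ _ n x) = K0.map (κ n) x := by
  have hX := isDenseSystem_unitization hκ hinj hd
  have := K0.directedSystem h1 h2
  refine AddCommGroup.DirectLimit.exists_equiv_of_exact _ (fun n => K0.map (κ n)) ?_ ?_ ?_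
  · intro m n h x
    refine Subtype.ext ?_
    change K00.map (Unitization.starMap (κ n)) (K00.map (Unitization.starMap (f m n h)) x.1) =
      K00.map (Unitization.starMap (κ m)) x.1
    rw [← hκ m n h, Unitization.starMap_comp, K00.map_comp]; rfl
  · intro y
    obtain ⟨n, x, hx⟩ := K00.exists_map_eq hX y.1
    refine ⟨n, ⟨x, ?_⟩, Subtype.ext hx⟩
    -- The preimage found in `K_00` of the unitization automatically lies in the kernel that defines
    -- `K_0`, since the connecting maps preserve the augmentation.
    have hy := y.2
    rw [← hx, AddMonoidHom.mem_ker] at hy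
    rw [AddMonoidHom.mem_ker, ← augmentation_comp_starMap (κ n), K00.map_comp]
    exact hy
  · intro n x hx
    obtain ⟨m, hm, h⟩ := K00.exists_map_eq_zero hX (x := x.1) (congrArg Subtype.val hx)
    exact ⟨m, hm, Subtype.ext h⟩

/-- `K_1` is continuous. -/
theorem K1.exists_directLimit_equiv
    (h1 : ∀ n, f n n le_rfl = NonUnitalStarAlgHom.id ℂ (X n))
    (h2 : ∀ k m n (h : k ≤ m) (h' : m ≤ n), (f m n h').comp (f k m h) = f k n (h.trans h'))
    (hκ : ∀ m n (h : m ≤ n), (κ n).comp (f m n h) = κ m) (hinj : ∀ n, Function.Injective (κ n))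
    (hd : Dense (⋃ n, Set.range (κ n))) :
    ∃ e : AddCommGroup.DirectLimit (fun n => K1 (X n)) (fun m n h => K1.map (f m n h)) ≃+ K1 Y,
      ∀ n x, e (AddCommGroup.DirectLimit.of _ _ n x) = K1.map (κ n) x := by
  have hX := isDenseSystem_unitization hκ hinj hd
  have := K1.directedSystem h1 h2
  refine AddCommGroup.DirectLimit.exists_equiv_of_exact _ (fun n => K1.map (κ n)) ?_
    (K11.exists_map_eq hX) fun n x hx => K11.exists_map_eq_zero hX hx
  intro m n h x
  rw [K1.map, K1.map, K1.map, ← hκ m n h, Unitization.starMap_comp, K11.map_comp]; rfl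

end Unitization

end KTheory

/-! ### Ascending sequences of open subgroups. -/

namespace CrossedProduct

theorem extendByZero_comp {X Y Z A : Type*} [TopologicalSpace X] [TopologicalSpace Y]
    [TopologicalSpace Z] [T2Space Y] [T2Space Z] [TopologicalSpace A] [Zero A] {φ : X → Y}
    {ψ : Y → Z} {χ : X → Z} (hφ : IsOpenEmbedding φ) (hψ : IsOpenEmbedding ψ)
    (hχ : IsOpenEmbedding χ) (h : ∀ x, ψ (φ x) = χ x) (f : C_c(X, A)) :
    extendByZero ψ hψ (extendByZero φ hφ f) = extendByZero χ hχ f := by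
  refine DFunLike.ext _ _ fun z => ?_
  change Function.extend ψ (Function.extend φ f 0) 0 z = Function.extend χ f 0 z
  by_cases hz : ∃ x, χ x = z
  · obtain ⟨x, rfl⟩ := hz
    rw [hχ.injective.extend_apply, ← h, hψ.injective.extend_apply, hφ.injective.extend_apply]
  · rw [Function.extend_apply' _ _ _ hz]
    by_cases hz' : ∃ y, ψ y = z
    · obtain ⟨y, rfl⟩ := hz'
      rw [hψ.injective.extend_apply, Function.extend_apply' _ _ _ fun ⟨x, hx⟩ =>
        hz ⟨x, by rw [← h, hx]⟩]
      rfl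
    · rw [Function.extend_apply' _ _ _ hz']

section OpenSubgroups

variable {G : Type u} [Group G] [TopologicalSpace G] [IsTopologicalGroup G]
    [LocallyCompactSpace G] [T2Space G] [SecondCountableTopology G]
    [MeasurableSpace G] [BorelSpace G] {A : Type v} [NonUnitalCStarAlgebra A]

theorem restrictMeasure_eq_comap (μ : Measure G) {H K : OpenSubgroup G} (h : H ≤ K) :
    restrictMeasure μ H = (restrictMeasure μ K).comap (SubgroupClass.inclusion h) := by
  ext s _
  rw [restrictMeasure, restrictMeasure, (isOpenEmbedding_subtype H).measurableEmbedding.comap_apply,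
    (isOpenEmbedding_inclusion h).measurableEmbedding.comap_apply,
    (isOpenEmbedding_subtype K).measurableEmbedding.comap_apply, Set.image_image]
  rfl

/-- A compactly supported function on the union of an ascending sequence of open subgroups lives on
one of them. -/
theorem exists_extendByZero_eq (μ : Measure G) [μ.IsHaarMeasure] {Gs : ℕ → OpenSubgroup G}
    (hGs : Monotone Gs) (hG : ∀ g : G, ∃ n, g ∈ Gs n) (f : C_c(G, A)) :
    ∃ n, ∃ f' : C_c(Gs n, A),
      extendByZero (SubgroupClass.subtype (Gs n)) (isOpenEmbedding_subtype (Gs n)) f' = f := by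
  -- The subgroups form a directed open cover, so one of them contains the compact support.
  obtain ⟨n, hn⟩ := f.hasCompactSupport.isCompact.elim_directed_cover (fun n => (Gs n : Set G))
    (fun n => (Gs n).isOpen) (fun g _ => Set.mem_iUnion.2 (hG g))
    (Monotone.directed_le fun m n h => hGs h)
  refine ⟨n, PreL2.exists_extend_eq (μ := μ) (μH := restrictMeasure μ (Gs n))
    (isOpenEmbedding_subtype (Gs n)) (ξ := f) fun y hy => ?_⟩
  by_contra hne
  exact hy ⟨⟨y, hn (subset_tsupport _ hne)⟩, rfl⟩

end OpenSubgroups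

end CrossedProduct

end

namespace CrossedProduct

open MeasureTheory Topology
open scoped CompactlySupported

variable {G : Type u} [Group G] [TopologicalSpace G] [IsTopologicalGroup G]
    [LocallyCompactSpace G] [T2Space G] [SecondCountableTopology G]
    [MeasurableSpace G] [BorelSpace G] {A : Type v} [NonUnitalCStarAlgebra A]

/-- The reduced crossed products by an ascending sequence of open subgroups with union `G` have
dense union. -/
theorem dense_iUnion_range (α : Action G A) (μ : Measure G) [μ.IsHaarMeasure]
    {Gs : ℕ → OpenSubgroup G} (hGs : Monotone Gs) (hG : ∀ g : G, ∃ n, g ∈ Gs n)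
    {ι : ∀ m n, m ≤ n →
      (SubgroupCrossedProduct α μ (Gs m) →⋆ₙₐ[ℂ] SubgroupCrossedProduct α μ (Gs n))}
    {κ : ∀ n, SubgroupCrossedProduct α μ (Gs n) →⋆ₙₐ[ℂ] ReducedCrossedProduct α μ}
    (hκ : ∀ n, IsInducedByExtension (SubgroupClass.subtype (Gs n))
      (isOpenEmbedding_subtype (Gs n)) (κ n))
    (hκι : ∀ m n (h : m ≤ n), (κ n).comp (ι m n h) = κ m) :
    Dense (⋃ n, Set.range (κ n)) := by
  have hmono : Monotone fun n => NonUnitalStarAlgHom.range (κ n) := by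
    rintro m n h _ ⟨x, rfl⟩
    exact ⟨ι m n h x, DFunLike.congr_fun (hκι m n h) x⟩
  -- Directedness is what makes the union of the ranges a ⋆-subalgebra, namely their supremum.
  have hdir : Directed (· ≤ ·) fun n => NonUnitalStarAlgHom.range (κ n) := hmono.directed_le
  have hd := ReducedCrossedProduct.dense_of_ofCc_mem (α := α) (μ := μ)
    (⨆ n, NonUnitalStarAlgHom.range (κ n)) fun f => by
      obtain ⟨n, f', rfl⟩ := exists_extendByZero_eq μ hGs hG f
      exact le_iSup (fun n => NonUnitalStarAlgHom.range (κ n)) n ⟨_, hκ n f'⟩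
  rw [NonUnitalStarSubalgebra.coe_iSup_of_directed hdir] at hd
  simpa using hd

end CrossedProduct

/-! ### Inclusions, inductive systems and the limit theorem. -/

theorem mainTheorem7 {G : Type u} [Group G] [TopologicalSpace G] [IsTopologicalGroup G]
    [LocallyCompactSpace G] [T2Space G] [SecondCountableTopology G]
    [MeasurableSpace G] [BorelSpace G]
    {A : Type v} [NonUnitalCStarAlgebra A] (α : CrossedProduct.Action G A)
    (μ : MeasureTheory.Measure G) [μ.IsHaarMeasure] :
    ∃ (ι : ∀ H K : OpenSubgroup G, H ≤ K →
          (CrossedProduct.SubgroupCrossedProduct α μ H →⋆ₙₐ[ℂ]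
            CrossedProduct.SubgroupCrossedProduct α μ K))
      (κ : ∀ H : OpenSubgroup G,
          (CrossedProduct.SubgroupCrossedProduct α μ H →⋆ₙₐ[ℂ]
            CrossedProduct.ReducedCrossedProduct α μ)),
      -- extension by zero induces unique isometric inclusions of crossed products
      (∀ H : OpenSubgroup G,
        CrossedProduct.IsInducedByExtension (SubgroupClass.subtype H)
          (CrossedProduct.isOpenEmbedding_subtype H) (κ H) ∧
        Isometry (κ H) ∧
        ∀ ψ : CrossedProduct.SubgroupCrossedProduct α μ H →⋆ₙₐ[ℂ]
            CrossedProduct.ReducedCrossedProduct α μ,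
          CrossedProduct.IsInducedByExtension (SubgroupClass.subtype H)
            (CrossedProduct.isOpenEmbedding_subtype H) ψ → ψ = κ H) ∧
      (∀ (H K : OpenSubgroup G) (h : H ≤ K),
        CrossedProduct.IsInducedByExtension (SubgroupClass.inclusion h)
          (CrossedProduct.isOpenEmbedding_inclusion h) (ι H K h) ∧
        Isometry (ι H K h) ∧
        ∀ ψ : CrossedProduct.SubgroupCrossedProduct α μ H →⋆ₙₐ[ℂ]
            CrossedProduct.SubgroupCrossedProduct α μ K,
          CrossedProduct.IsInducedByExtension (SubgroupClass.inclusion h)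
            (CrossedProduct.isOpenEmbedding_inclusion h) ψ → ψ = ι H K h) ∧
      ∀ (Gs : ℕ → OpenSubgroup G) (hGs : Monotone Gs),
        -- the K-groups form inductive systems
        DirectedSystem (fun n => KTheory.K0 (CrossedProduct.SubgroupCrossedProduct α μ (Gs n)))
          (fun m n h => KTheory.K0.map (ι (Gs m) (Gs n) (hGs h))) ∧
        DirectedSystem (fun n => KTheory.K1 (CrossedProduct.SubgroupCrossedProduct α μ (Gs n)))
          (fun m n h => KTheory.K1.map (ι (Gs m) (Gs n) (hGs h))) ∧
        ((∀ g : G, ∃ n, g ∈ Gs n) →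
          -- the crossed product by the union is the inductive limit
          Dense (⋃ n, Set.range (κ (Gs n))) ∧
          CrossedProduct.IsCStarInductiveLimit.{max u v, max u v, w}
            (fun n => CrossedProduct.SubgroupCrossedProduct α μ (Gs n))
            (fun m n h => ι (Gs m) (Gs n) (hGs h))
            (CrossedProduct.ReducedCrossedProduct α μ) (fun n => κ (Gs n)) ∧
          -- K-theory commutes with this limit
          (∃ e : AddCommGroup.DirectLimit
                (fun n => KTheory.K0 (CrossedProduct.SubgroupCrossedProduct α μ (Gs n)))
                (fun m n h => KTheory.K0.map (ι (Gs m) (Gs n) (hGs h))) ≃+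
              KTheory.K0 (CrossedProduct.ReducedCrossedProduct α μ),
            ∀ n x, e (AddCommGroup.DirectLimit.of _ _ n x) = KTheory.K0.map (κ (Gs n)) x) ∧
          (∃ e : AddCommGroup.DirectLimit
                (fun n => KTheory.K1 (CrossedProduct.SubgroupCrossedProduct α μ (Gs n)))
                (fun m n h => KTheory.K1.map (ι (Gs m) (Gs n) (hGs h))) ≃+
              KTheory.K1 (CrossedProduct.ReducedCrossedProduct α μ),
            ∀ n x, e (AddCommGroup.DirectLimit.of _ _ n x) = KTheory.K1.map (κ (Gs n)) x)) := by
  -- For the inclusions between two subgroups, the larger one takes the place of the ambient group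
  -- and has to be second countable itself.
  have hsc : ∀ K : OpenSubgroup G, SecondCountableTopology K := fun K =>
    TopologicalSpace.Subtype.secondCountableTopology (K : Set G)
  have hι := fun (H K : OpenSubgroup G) (h : H ≤ K) =>
    CrossedProduct.exists_isInducedByExtension (φ := SubgroupClass.inclusion h)
      (CrossedProduct.isOpenEmbedding_inclusion h) (CrossedProduct.restrictMeasure_eq_comap μ h)
      (αH := α.comap (SubgroupClass.subtype H) (CrossedProduct.isOpenEmbedding_subtype H).continuous)
      (α := α.comap (SubgroupClass.subtype K) (CrossedProduct.isOpenEmbedding_subtype K).continuous)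
      fun _ _ => rfl
  have hκ := fun H : OpenSubgroup G =>
    CrossedProduct.exists_isInducedByExtension (φ := SubgroupClass.subtype H)
      (CrossedProduct.isOpenEmbedding_subtype H) (μ := μ)
      (μH := CrossedProduct.restrictMeasure μ H) rfl
      (αH := α.comap (SubgroupClass.subtype H) (CrossedProduct.isOpenEmbedding_subtype H).continuous)
      (α := α) fun _ _ => rfl
  choose ι hι hιiso using hι
  choose κ hκ hκiso using hκ
  -- Extension by zero is transitive, so both sides are induced by the same extension, and
  -- uniqueness identifies them. The two compatibilities below are obtained in the same way.
  have hιι : ∀ (H K L : OpenSubgroup G) (h : H ≤ K) (h' : K ≤ L),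
      (ι K L h').comp (ι H K h) = ι H L (h.trans h') := fun H K L h h' =>
    CrossedProduct.IsInducedByExtension.unique (fun f => by
      rw [NonUnitalStarAlgHom.comp_apply, hι, hι]
      exact congrArg _ (CrossedProduct.extendByZero_comp _ _ _ (fun _ => rfl) f)) (hι H L _)
  have hιid : ∀ H : OpenSubgroup G, ι H H le_rfl = NonUnitalStarAlgHom.id ℂ _ := fun H =>
    CrossedProduct.IsInducedByExtension.unique (hι H H _) fun f =>
      congrArg (CrossedProduct.ReducedCrossedProduct.ofCc _ _) (DFunLike.ext _ _ fun x => (CrossedProduct.extendByZero_apply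
        (CrossedProduct.isOpenEmbedding_inclusion (le_refl H)) f x).symm)
  have hκι : ∀ (H K : OpenSubgroup G) (h : H ≤ K), (κ K).comp (ι H K h) = κ H := fun H K h =>
    CrossedProduct.IsInducedByExtension.unique (fun f => by
      rw [NonUnitalStarAlgHom.comp_apply, hι, hκ]
      exact congrArg _ (CrossedProduct.extendByZero_comp _ _ _ (fun _ => rfl) f)) (hκ H)
  refine ⟨ι, κ, fun H => ⟨hκ H, hκiso H, fun ψ hψ => hψ.unique (hκ H)⟩,
    fun H K h => ⟨hι H K h, hιiso H K h, fun ψ hψ => hψ.unique (hι H K h)⟩, fun Gs hGs => ?_⟩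
  have h1 : ∀ n, ι (Gs n) (Gs n) (hGs le_rfl) = NonUnitalStarAlgHom.id ℂ _ := fun n => hιid _
  have h2 : ∀ k m n (h : k ≤ m) (h' : m ≤ n), (ι (Gs m) (Gs n) (hGs h')).comp
      (ι (Gs k) (Gs m) (hGs h)) = ι (Gs k) (Gs n) (hGs (h.trans h')) := fun k m n h h' => hιι ..
  have h3 : ∀ m n (h : m ≤ n), (κ (Gs n)).comp (ι (Gs m) (Gs n) (hGs h)) = κ (Gs m) :=
    fun m n h => hκι ..
  refine ⟨KTheory.K0.directedSystem h1 h2, KTheory.K1.directedSystem h1 h2, fun hG => ?_⟩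
  have hd := CrossedProduct.dense_iUnion_range α μ hGs hG (fun n => hκ (Gs n)) h3
  exact ⟨hd, CrossedProduct.isCStarInductiveLimit_of_dense _ _ _ _ h3 (fun n => hκiso (Gs n)) hd,
    KTheory.K0.exists_directLimit_equiv h1 h2 h3 (fun n => (hκiso (Gs n)).injective) hd,
    KTheory.K1.exists_directLimit_equiv h1 h2 h3 (fun n => (hκiso (Gs n)).injective) hd⟩
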